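/- Work over the field $\mathbb{Q}(q,t)$. For $m\ge 0$ let $R_m$ be the ring of formal power series of bounded degree in $x_1,x_2,\dots$ over $\mathbb{Q}(q,t)$ that are symmetric in $x_{m+1},x_{m+2},\dots$. An $m$-partition is a pair $\Lambda=(\boldsymbol a;\lambda)$ with $\boldsymbol a=(a_1,\dots,a_m)\in\mathbb{Z}_{\ge0}^m$ and $\lambda$ a partition; it is dominant if $a_1\ge\cdots\ge a_m$; its degree is $\sum a_i+|\lambda|$; $s_i$ exchanges $a_i$ and $a_{i+1}$. For partitions, or compositions, $\alpha\cup\beta$ is the partition whose parts are the nonzero entries of both. Let $$T_i=t+\frac{tx_i-x_{i+1}}{x_i-x_{i+1}}(K_{i,i+1}-1)\qquad(1\le i\le m-1)$$ on $R_m$, where $K_{i,i+1}$ exchanges $x_i$ and $x_{i+1}$. Let $H_{\boldsymbol a}(x_1,\dots,x_m;t)$ be the non-symmetric Hall–Littlewood polynomials: $H_{\boldsymbol a}=x^{\boldsymbol a}$ if $\boldsymbol a$ is dominant, and $H_{\boldsymbol a}=T_iH_{s_i\boldsymbol a}$ if $a_i<a_{i+1}$. Put $k_\Lambda=H_{\boldsymbol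 a}(x_1,\dots,x_m;t)\,s_\lambda(x_1,x_2,\dots)$ with $s_\lambda$ the usual Schur function, let $\langle\cdot,\cdot\rangle_m$ be the bilinear form on $R_m$ with $\langle k_\Lambda,k_\Omega\rangle_m=\delta_{\Lambda\Omega}$, and let $T_i^*$ be the adjoint of $T_i$. The dual $m$-symmetric Schur functions $s^*_\Lambda\in R_m$ are defined as follows. If $\Lambda=(\boldsymbol a;\lambda)$ is dominant, $$s^*_\Lambda=\sum_{\Omega}\ \sum_{T\in\mathcal S_{\Lambda\Omega}}t^{\,\mathrm{Inv}(\boldsymbol b)+\mathrm{charge}(\bar T u_{\boldsymbol a})}\,k_\Omega,$$ the sum being over the $m$-partitions $\Omega=(\boldsymbol b;\mu)$ of the degree of $\Lambda$. Here $\mathrm{Inv}(\boldsymbol b)=\#\{i<j: b_i<b_j\}$; $\mathcal S_{\Lambda\Omega}$ is the set of skew tableaux of shape $(\boldsymbol a\cup\lambda)/\mu$ (rows weakly, columns strictly increasing) in which each letter $i\in\{1,\dots,m\}$ appears $b_i$ times, always within the first $a_i$ columns; $\bar T$ is the tableau of shape $\mu/\lambda$ in the letters $\bar1>\bar2>\cdots>\bar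 m$ whose column $c$ contains $\bar\imath$ if and only if $c\le a_i$ and column $c$ of $T$ does not contain $i$; it is identified with the word obtained by reading its rows from bottom to top, each from left to right; and $u_{\boldsymbol a}=\bar1^{\,a_1-a_1}\bar2^{\,a_1-a_2}\cdots\bar m^{\,a_1-a_m}$. The charge of a word in the barred letters is the Lascoux–Schützenberger charge of the word obtained by $\bar\imath\mapsto m+1-i$, a word of non-dominant evaluation being first replaced by the word of dominant evaluation in its orbit under the Lascoux–Schützenberger action of the symmetric group on words. (The charge of a word of dominant evaluation is the sum of the following labels. Reading cyclically from right to left, starting at the right end with label $0$, label the first unlabelled $1$ met, then the first unlabelled $2$ met after it, then the first unlabelled $3$ met after that, and so on, increasing the label by $1$ each time the reading returns to the right end; once no next letter is left, repeat with the unlabelled letters, until all letters are labelled.) If $\Lambda$ is not dominant and $a_i<a_{i+1}$, then $s^*_\Lambda=t^{-1}T_i^*s^*_{s_i\Lambda}$. The $m$-symmetric Schur functions $s_\Lambda\in R_m$ are defined by $\langle s_\Lambda,s^*_\Omega\rangle_m=\delta_{\Lambda\Omega}$ for all $\Lambda,\Omega$. Let $i:R_m\to R_{m+1}$ be the inclusion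 and let $r:R_{m+1}\to R_m$ be the restriction, which sets $x_{m+1}=0$ and then replaces $x_{m+2},x_{m+3},\dots$ by $x_{m+1},x_{m+2},\dots$. **Proposition.** For every $m\ge0$ the form $\langle\cdot,\cdot\rangle_m$, the adjoints $T_i^*$ and the family $(s_\Lambda)$ exist and are unique, and the following hold. 1. For every $m\ge0$ and every $(m+1)$-partition $\Lambda=(a_1,\dots,a_{m+1};\lambda)$, $$r(s^*_\Lambda)=s^*_{\hat\Lambda},\qquad \hat\Lambda=(a_1,\dots,a_m;\lambda\cup(a_{m+1})).$$ 2. For every $m\ge0$ and every $m$-partition $\Lambda=(a_1,\dots,a_m;\lambda)$, $$i(s_\Lambda)=\sum_\Omega s_\Omega,$$ the sum being over all distinct $(m+1)$-partitions $\Omega=(a_1,\dots,a_m,a_{m+1};\mu)$ with $\mu\cup(a_{m+1})=\lambda$. Equivalently, $\Omega$ runs over the $(m+1)$-partitions whose diagram is obtained from that of $\Lambda$ by adding an $(m+1)$-circle to a symmetric row, possibly the row of size $0$. -/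

import Mathlib

open Finset

noncomputable section

namespace MSymmetric

/-! ## The base field and the rings `R_m` -/

/-- The field `ℚ(q,t)`; the two polynomial variables are `q` (index `0`) and `t` (index `1`). -/
abbrev Qqt : Type := FractionRing (MvPolynomial (Fin 2) ℚ)

/-- The element `t` of `ℚ(q,t)`. -/
def tt : Qqt := algebraMap (MvPolynomial (Fin 2) ℚ) Qqt (MvPolynomial.X 1)

/-- Formal power series over `ℚ(q,t)` in the variables `x₁, x₂, …`.  The variable `x_{j+1}` is
`MvPowerSeries.X j`: all indices are shifted by one and start at `0`. -/
abbrev PS : Type := MvPowerSeries ℕ Qqt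

/-- The power series has bounded degree. -/
def BoundedDegree (f : PS) : Prop :=
  ∃ D : ℕ, ∀ d : ℕ →₀ ℕ, D < d.degree → MvPowerSeries.coeff d f = 0

/-- The power series is symmetric in the variables `x_{m+1}, x_{m+2}, …`. -/
def SymmetricAfter (m : ℕ) (f : PS) : Prop :=
  ∀ σ : Equiv.Perm ℕ, (∀ j < m, σ j = j) → MvPowerSeries.renameEquiv Qqt σ f = f

theorem BoundedDegree.add {f g : PS} (hf : BoundedDegree f) (hg : BoundedDegree g) :
    BoundedDegree (f + g) := by
  obtain ⟨A, hA⟩ := hf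
  obtain ⟨B, hB⟩ := hg
  refine ⟨max A B, fun d hd => ?_⟩
  rw [map_add, hA d (lt_of_le_of_lt (le_max_left _ _) hd),
    hB d (lt_of_le_of_lt (le_max_right _ _) hd), add_zero]

theorem BoundedDegree.mul {f g : PS} (hf : BoundedDegree f) (hg : BoundedDegree g) :
    BoundedDegree (f * g) := by
  obtain ⟨A, hA⟩ := hf
  obtain ⟨B, hB⟩ := hg
  refine ⟨A + B, fun d hd => ?_⟩
  rw [MvPowerSeries.coeff_mul]
  refine Finset.sum_eq_zero fun p hp => ?_
  rw [Finset.HasAntidiagonal.mem_antidiagonal] at hp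
  have h : p.1.degree + p.2.degree = d.degree := by rw [← hp, map_add]
  by_cases h1 : A < p.1.degree
  · rw [hA _ h1, zero_mul]
  · rw [hB _ (by omega), mul_zero]

theorem BoundedDegree.monomial (d : ℕ →₀ ℕ) (c : Qqt) :
    BoundedDegree (MvPowerSeries.monomial d c) := by
  refine ⟨d.degree, fun e he => ?_⟩
  rw [MvPowerSeries.coeff_monomial_ne]
  rintro rfl
  exact lt_irrefl _ he

/-- The ring `R_m` of `m`-symmetric functions: power series of bounded degree which are symmetric
in the variables `x_{m+1}, x_{m+2}, …`. -/
def R (m : ℕ) : Subalgebra Qqt PS where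
  carrier := {f | BoundedDegree f ∧ SymmetricAfter m f}
  mul_mem' hf hg := ⟨hf.1.mul hg.1, fun σ hσ => by rw [map_mul, hf.2 σ hσ, hg.2 σ hσ]⟩
  add_mem' hf hg := ⟨hf.1.add hg.1, fun σ hσ => by rw [map_add, hf.2 σ hσ, hg.2 σ hσ]⟩
  algebraMap_mem' c := ⟨BoundedDegree.monomial 0 c, fun σ _ => AlgEquiv.commutes _ c⟩

theorem mem_R {m : ℕ} {f : PS} : f ∈ R m ↔ BoundedDegree f ∧ SymmetricAfter m f := Iff.rfl

theorem R_mono {m n : ℕ} (h : m ≤ n) : R m ≤ R n :=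
  fun _ hf => ⟨hf.1, fun σ hσ => hf.2 σ fun j hj => hσ j (lt_of_lt_of_le hj h)⟩

/-- The inclusion `i : R_m → R_{m+1}`. -/
def incl (m : ℕ) : R m →ₐ[Qqt] R (m + 1) := Subalgebra.inclusion (R_mono (Nat.le_succ m))

/-- The order embedding of `ℕ` which omits the value `m`. -/
def skip (m : ℕ) : ℕ ↪ ℕ where
  toFun j := if j < m then j else j + 1
  inj' a b h := by
    dsimp only at h
    split_ifs at h <;> omega

theorem skip_apply (m j : ℕ) : skip m j = if j < m then j else j + 1 := rfl

theorem killCompl_skip_mem (m : ℕ) {f : PS} (hf : f ∈ R (m + 1)) :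
    MvPowerSeries.killCompl (skip m) f ∈ R m := by
  obtain ⟨⟨D, hD⟩, hs⟩ := hf
  refine ⟨⟨D, fun d hd => ?_⟩, fun τ hτ => ?_⟩
  · rw [MvPowerSeries.coeff_killCompl]
    apply hD
    rwa [Finsupp.embDomain_eq_mapDomain, Finsupp.degree_mapDomain]
  · have key : MvPowerSeries.renameEquiv Qqt (τ.viaEmbedding (skip m)) f = f := by
      apply hs
      intro j hj
      rcases Nat.lt_succ_iff_lt_or_eq.mp hj with hj | rfl
      · have h1 : skip m j = j := by simp [skip_apply, hj]
        conv_lhs => rw [← h1]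
        rw [Equiv.Perm.viaEmbedding_apply, hτ j hj, h1]
      · apply Equiv.Perm.viaEmbedding_apply_of_notMem
        rintro ⟨x, hx⟩
        rw [skip_apply] at hx
        split_ifs at hx <;> omega
    ext d
    obtain ⟨d, rfl⟩ : ∃ d', d = Finsupp.embDomain τ.toEmbedding d' :=
      ⟨Finsupp.embDomain τ.symm.toEmbedding d, by
        rw [Finsupp.embDomain_eq_mapDomain, Finsupp.embDomain_eq_mapDomain,
          ← Finsupp.mapDomain_comp]
        simp⟩
    rw [MvPowerSeries.renameEquiv_apply]
    erw [MvPowerSeries.coeff_embDomain_rename τ.toEmbedding]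
    rw [MvPowerSeries.coeff_killCompl, MvPowerSeries.coeff_killCompl]
    conv_rhs => rw [← key]
    have : Finsupp.embDomain (skip m) (Finsupp.embDomain τ.toEmbedding d)
        = Finsupp.embDomain (τ.viaEmbedding (skip m)).toEmbedding
          (Finsupp.embDomain (skip m) d) := by
      simp only [Finsupp.embDomain_eq_mapDomain, ← Finsupp.mapDomain_comp]
      congr 1
      funext x
      simp [Equiv.Perm.viaEmbedding_apply]
    rw [this, MvPowerSeries.renameEquiv_apply]
    erw [MvPowerSeries.coeff_embDomain_rename (τ.viaEmbedding (skip m)).toEmbedding]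

/-- The restriction `r : R_{m+1} → R_m`: set `x_{m+1} = 0`, then replace
`x_{m+2}, x_{m+3}, …` by `x_{m+1}, x_{m+2}, …`. -/
def restr (m : ℕ) : R (m + 1) →ₐ[Qqt] R m :=
  ((MvPowerSeries.killCompl (skip m)).comp (R (m + 1)).val).codRestrict (R m)
    fun f => killCompl_skip_mem m f.2

/-! ## Hecke operators -/

/-- The divided difference `(K f - f) / (x_i - x_{i+1})` of a power series, where `K` exchanges
the two variables with (shifted) indices `i` and `i + 1`; see `X_sub_X_mul_divDiff`. -/
def divDiff (i : ℕ) (f : PS) : PS := fun d =>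
  ∑ k ∈ range (min (d i) (d (i + 1)) + 1),
    (MvPowerSeries.coeff ((d.update i k).update (i + 1) (d i + d (i + 1) + 1 - k)) f
      - MvPowerSeries.coeff ((d.update i (d i + d (i + 1) + 1 - k)).update (i + 1) k) f)

theorem coeff_divDiff (i : ℕ) (f : PS) (d : ℕ →₀ ℕ) :
    MvPowerSeries.coeff d (divDiff i f) =
      ∑ k ∈ range (min (d i) (d (i + 1)) + 1),
        (MvPowerSeries.coeff ((d.update i k).update (i + 1) (d i + d (i + 1) + 1 - k)) f
          - MvPowerSeries.coeff ((d.update i (d i + d (i + 1) + 1 - k)).update (i + 1) k) f) :=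
  rfl

/-- The exchange operator `K_{i,i+1}`. -/
def exchange (i : ℕ) : PS ≃ₐ[Qqt] PS := MvPowerSeries.renameEquiv Qqt (Equiv.swap i (i + 1))

theorem coeff_exchange (i : ℕ) (f : PS) (d : ℕ →₀ ℕ) :
    MvPowerSeries.coeff d (exchange i f)
      = MvPowerSeries.coeff ((d.update i (d (i + 1))).update (i + 1) (d i)) f := by
  have h : d = Finsupp.embDomain (Equiv.swap i (i + 1)).toEmbedding
      ((d.update i (d (i + 1))).update (i + 1) (d i)) := by
    rw [Finsupp.embDomain_eq_mapDomain]
    ext j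
    have hj : j = Equiv.swap i (i + 1) (Equiv.swap i (i + 1) j) := by simp
    conv_rhs => rw [hj]
    erw [Finsupp.mapDomain_apply (Equiv.swap i (i + 1)).injective]
    rcases eq_or_ne j i with rfl | h1
    · simp
    rcases eq_or_ne j (i + 1) with rfl | h2
    · simp [Finsupp.update]
    · rw [Equiv.swap_apply_of_ne_of_ne h1 h2]
      simp [Finsupp.update, h1, h2]
  conv_lhs => rw [h]
  rw [exchange, MvPowerSeries.renameEquiv_apply]
  erw [MvPowerSeries.coeff_embDomain_rename (Equiv.swap i (i + 1)).toEmbedding]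

theorem coeff_X_mul' (j : ℕ) (g : PS) (d : ℕ →₀ ℕ) :
    MvPowerSeries.coeff d (MvPowerSeries.X j * g)
      = if d j = 0 then 0 else MvPowerSeries.coeff (d.update j (d j - 1)) g := by
  rw [MvPowerSeries.X_def, MvPowerSeries.coeff_monomial_mul, one_mul]
  by_cases h : d j = 0
  · rw [if_neg, if_pos h]
    intro hle
    have := hle j
    simp [h] at this
  · rw [if_pos, if_neg h]
    · congr 2
      ext k
      rcases eq_or_ne k j with rfl | hk
      · simp [Finsupp.update]
      · simp [Finsupp.update, hk]
    · intro k
      rcases eq_or_ne k j with rfl | hk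
      · simp; omega
      · simp [hk.symm]

theorem coeff_divDiff_update (i : ℕ) (f : PS) (d : ℕ →₀ ℕ) (a b : ℕ) :
    MvPowerSeries.coeff ((d.update i a).update (i + 1) b) (divDiff i f) =
      ∑ k ∈ range (min a b + 1),
        (MvPowerSeries.coeff ((d.update i k).update (i + 1) (a + b + 1 - k)) f
          - MvPowerSeries.coeff ((d.update i (a + b + 1 - k)).update (i + 1) k) f) := by
  have h (u v : ℕ) : (((d.update i a).update (i + 1) b).update i u).update (i + 1) v
      = (d.update i u).update (i + 1) v := by
    ext j
    simp only [Finsupp.coe_update, Function.update_apply]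
    split_ifs <;> rfl
  rw [coeff_divDiff]
  simp [h]

theorem X_sub_X_mul_divDiff (i : ℕ) (f : PS) :
    (MvPowerSeries.X i - MvPowerSeries.X (i + 1)) * divDiff i f = exchange i f - f := by
  ext d
  have e1 : d.update i (d i - 1) = (d.update i (d i - 1)).update (i + 1) (d (i + 1)) := by
    ext j
    simp only [Finsupp.coe_update, Function.update_apply]
    split_ifs <;> simp_all
  have e2 : d.update (i + 1) (d (i + 1) - 1) =
      (d.update i (d i)).update (i + 1) (d (i + 1) - 1) := by simp
  have e3 : MvPowerSeries.coeff d f =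
      MvPowerSeries.coeff ((d.update i (d i)).update (i + 1) (d (i + 1))) f := by simp
  rw [sub_mul, map_sub, map_sub, coeff_X_mul', coeff_X_mul', coeff_exchange, e1, e2,
    coeff_divDiff_update, coeff_divDiff_update, e3]
  generalize d i = p
  generalize d (i + 1) = q
  rcases Nat.eq_zero_or_pos p with rfl | hp
  · rcases Nat.eq_zero_or_pos q with rfl | hq
    · simp
    · have : 0 + (q - 1) + 1 = q := by omega
      rw [if_pos rfl, if_neg hq.ne', this]
      simp
  · rcases Nat.eq_zero_or_pos q with rfl | hq
    · have : p - 1 + 1 = p := by omega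
      simp [hp.ne', this]
    · have h1 : p - 1 + q + 1 = p + q := by omega
      have h2 : p + (q - 1) + 1 = p + q := by omega
      rw [if_neg hp.ne', if_neg hq.ne', h1, h2]
      rcases lt_trichotomy p q with h | h | h
      · have h3 : min (p - 1) q + 1 = p := by omega
        have h4 : min p (q - 1) + 1 = p + 1 := by omega
        have h5 : p + q - p = q := by omega
        rw [h3, h4, Finset.sum_range_succ, h5]
        ring
      · subst h
        have h3 : min (p - 1) p = min p (p - 1) := min_comm _ _
        rw [h3]
        ring
      · have h3 : min (p - 1) q + 1 = q + 1 := by omega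
        have h4 : min p (q - 1) + 1 = q := by omega
        have h5 : p + q - q = p := by omega
        rw [h3, h4, Finset.sum_range_succ, h5]
        ring

theorem renameEquiv_X (σ : Equiv.Perm ℕ) (j : ℕ) :
    MvPowerSeries.renameEquiv Qqt σ (MvPowerSeries.X j) = MvPowerSeries.X (σ j) :=
  MvPowerSeries.rename_X _ _

theorem X_mem_R {m j : ℕ} (h : j < m) : (MvPowerSeries.X j : PS) ∈ R m :=
  ⟨BoundedDegree.monomial _ _, fun σ hσ => by
    rw [renameEquiv_X, hσ j h]⟩

theorem X_sub_X_ne_zero (i : ℕ) :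
    (MvPowerSeries.X i - MvPowerSeries.X (i + 1) : PS) ≠ 0 := by
  rw [sub_ne_zero]
  intro h
  have := MvPowerSeries.X_inj.mp h
  omega

theorem divDiff_mem {m i : ℕ} (hi : i + 1 < m) {f : PS} (hf : f ∈ R m) : divDiff i f ∈ R m := by
  obtain ⟨⟨D, hD⟩, hs⟩ := hf
  refine ⟨⟨D, fun d hd => ?_⟩, fun σ hσ => ?_⟩
  · have hdeg (u v : ℕ) (huv : u + v = d i + d (i + 1) + 1) :
        D < ((d.update i u).update (i + 1) v).degree := by
      have h : (d.update i u).update (i + 1) v + (Finsupp.single i (d i)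
          + Finsupp.single (i + 1) (d (i + 1)))
          = d + (Finsupp.single i u + Finsupp.single (i + 1) v) := by
        ext j
        simp only [Finsupp.add_apply, Finsupp.coe_update, Function.update_apply,
          Finsupp.single_apply]
        grind
      have h' := congrArg Finsupp.degree h
      simp only [map_add, Finsupp.degree_single] at h'
      omega
    rw [coeff_divDiff]
    refine Finset.sum_eq_zero fun k hk => ?_
    have hk : k ≤ d i := by
      have := Finset.mem_range.mp hk
      omega
    rw [hD _ (hdeg _ _ (by omega)), hD _ (hdeg _ _ (by omega)), sub_zero]
  · apply mul_left_cancel₀ (X_sub_X_ne_zero i)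
    rw [X_sub_X_mul_divDiff]
    have h1 := congrArg (MvPowerSeries.renameEquiv Qqt σ) (X_sub_X_mul_divDiff i f)
    have hc : MvPowerSeries.renameEquiv Qqt σ (exchange i f) =
        exchange i (MvPowerSeries.renameEquiv Qqt σ f) := by
      rw [exchange, ← AlgEquiv.trans_apply, ← AlgEquiv.trans_apply,
        MvPowerSeries.renameEquiv_trans, MvPowerSeries.renameEquiv_trans]
      congr 2
      ext j
      have s1 : σ i = i := hσ i (by omega)
      have s2 : σ (i + 1) = i + 1 := hσ (i + 1) hi
      have := Equiv.swap_apply_apply σ i (i + 1)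
      rw [s1, s2] at this
      conv_rhs => rw [this]
      simp
    rw [map_mul, map_sub, map_sub, hc, hs σ hσ, renameEquiv_X, renameEquiv_X,
      hσ i (by omega), hσ (i + 1) hi] at h1
    exact h1

theorem divDiff_add (i : ℕ) (f g : PS) : divDiff i (f + g) = divDiff i f + divDiff i g := by
  ext d
  simp only [map_add, coeff_divDiff]
  rw [← Finset.sum_add_distrib]
  exact Finset.sum_congr rfl fun _ _ => by ring

theorem divDiff_smul (i : ℕ) (c : Qqt) (f : PS) : divDiff i (c • f) = c • divDiff i f := by
  ext d
  simp only [map_smul, coeff_divDiff, Finset.smul_sum, smul_sub]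

/-- The Hecke operator `T = t + (t x_i - x_{i+1}) / (x_i - x_{i+1}) (K_{i,i+1} - 1)` acting on
`R_m`, in the two variables with (shifted) indices `i` and `i + 1`, where `i + 1 < m`. -/
def heckeT (m i : ℕ) (hi : i + 1 < m) : R m →ₗ[Qqt] R m where
  toFun f := tt • f
    + (tt • ⟨MvPowerSeries.X i, X_mem_R (Nat.lt_of_succ_lt hi)⟩
        - ⟨MvPowerSeries.X (i + 1), X_mem_R hi⟩)
      * ⟨divDiff i f, divDiff_mem hi f.2⟩
  map_add' f g := by
    apply Subtype.ext
    simp only [Subalgebra.coe_add, Subalgebra.coe_mul, Subalgebra.coe_sub, Subalgebra.coe_smul,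
      divDiff_add, smul_add]
    ring
  map_smul' c f := by
    apply Subtype.ext
    simp only [Subalgebra.coe_add, Subalgebra.coe_mul, Subalgebra.coe_sub, Subalgebra.coe_smul,
      divDiff_smul, smul_add, RingHom.id_apply, mul_smul_comm]
    rw [smul_comm]

theorem X_sub_X_mul_heckeT {m i : ℕ} (hi : i + 1 < m) (f : R m) :
    (MvPowerSeries.X i - MvPowerSeries.X (i + 1) : PS) * ((heckeT m i hi f : PS) - tt • (f : PS))
      = (tt • MvPowerSeries.X i - MvPowerSeries.X (i + 1)) * (exchange i f - (f : PS)) := by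
  rw [← X_sub_X_mul_divDiff]
  simp only [heckeT, LinearMap.coe_mk, AddHom.coe_mk, Subalgebra.coe_add, Subalgebra.coe_mul,
    Subalgebra.coe_sub, Subalgebra.coe_smul]
  ring

/-! ## `m`-partitions -/

/-- An `m`-partition `(a; lam)`: a weak composition `a` with `m` parts and a partition `lam`, given
as the multiset of its (positive) parts. -/
@[ext]
structure MPartition (m : ℕ) where
  a : Fin m → ℕ
  lam : Multiset ℕ
  pos : 0 ∉ lam

namespace MPartition

variable {m : ℕ}

/-- The degree `a_1 + ⋯ + a_m + lam_1 + lam_2 + ⋯`. -/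
def degree (L : MPartition m) : ℕ := ∑ i, L.a i + L.lam.sum

/-- The `m`-partition `s_i L`, with the entries of `a` in positions `i` and `i + 1` exchanged. -/
def swap (L : MPartition m) (i : ℕ) (hi : i + 1 < m) : MPartition m :=
  ⟨L.a ∘ Equiv.swap ⟨i, Nat.lt_of_succ_lt hi⟩ ⟨i + 1, hi⟩, L.lam, L.pos⟩

/-- The partition `a ∪ lam`, up to parts of size zero. -/
def total (L : MPartition m) : Multiset ℕ := univ.val.map L.a + L.lam

theorem finite_degree (m d : ℕ) : {L : MPartition m | L.degree = d}.Finite := by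
  have hle (L : {L : MPartition m | L.degree = d}) (i : Fin m) : L.1.a i < d + 1 := by
    have h1 : L.1.degree = d := L.2
    have h2 : L.1.a i ≤ ∑ i, L.1.a i :=
      Finset.single_le_sum (f := L.1.a) (fun _ _ => Nat.zero_le _) (Finset.mem_univ i)
    unfold degree at h1
    omega
  have hs (L : {L : MPartition m | L.degree = d}) : L.1.lam.sum < d + 1 := by
    have h1 : L.1.degree = d := L.2
    unfold degree at h1
    omega
  let φ : {L : MPartition m | L.degree = d} →
      (Fin m → Fin (d + 1)) × (Σ n : Fin (d + 1), Nat.Partition n) := fun L =>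
    (fun i => ⟨L.1.a i, hle L i⟩, ⟨⟨L.1.lam.sum, hs L⟩,
      ⟨L.1.lam, fun {i} h => Nat.pos_of_ne_zero fun h0 => L.1.pos (h0 ▸ h), rfl⟩⟩)
  have hφ : Function.Injective φ := by
    intro L M h
    have h1 := congrArg Prod.fst h
    have h2 := congrArg (fun x => x.2.2.parts) h
    apply Subtype.ext
    apply MPartition.ext
    · funext i
      exact congrArg Fin.val (congrFun h1 i)
    · exact h2
  exact Set.finite_coe_iff.mp (Finite.of_injective φ hφ)

/-- The finite set of `m`-partitions of degree `d`. -/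
def ofDegree (m d : ℕ) : Finset (MPartition m) := (finite_degree m d).toFinset

/-- For `L = (a_1, …, a_{m+1}; lam)`, the `m`-partition `(a_1, …, a_m; lam ∪ (a_{m+1}))`: the
`(m+1)`-circle is removed from the diagram. -/
def hat (L : MPartition (m + 1)) : MPartition m :=
  ⟨fun i => L.a i.castSucc, (L.a (Fin.last m) ::ₘ L.lam).filter (· ≠ 0), by simp⟩

theorem degree_hat (L : MPartition (m + 1)) : L.hat.degree = L.degree := by
  have h : ((L.a (Fin.last m) ::ₘ L.lam).filter (· ≠ 0)).sum = L.a (Fin.last m) + L.lam.sum := by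
    rw [← Multiset.sum_cons]
    generalize L.a (Fin.last m) ::ₘ L.lam = s
    induction s using Multiset.induction_on with
    | empty => simp
    | cons x s ih =>
      by_cases hx : x = 0
      · simp [hx, ih]
      · rw [Multiset.filter_cons_of_pos (p := (· ≠ 0)) s hx, Multiset.sum_cons, ih,
          Multiset.sum_cons]
  simp only [degree, hat, h, Fin.sum_univ_castSucc]
  ring

theorem finite_addCircle (L : MPartition m) :
    {O : MPartition (m + 1) | (∀ i : Fin m, O.a i.castSucc = L.a i) ∧
      (O.a (Fin.last m) ::ₘ O.lam).filter (· ≠ 0) = L.lam}.Finite := by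
  refine (finite_degree (m + 1) L.degree).subset fun O hO => ?_
  have h : O.hat = L := MPartition.ext (funext hO.1) hO.2
  rw [Set.mem_ofPred_eq, ← h, degree_hat]

/-- The finite set of all `(m+1)`-partitions `(a_1, …, a_m, a_{m+1}; mu)` such that
`mu ∪ (a_{m+1}) = lam`, where `L = (a_1, …, a_m; lam)`: an `(m+1)`-circle is added to a symmetric
row of the diagram of `L`, possibly to the row of size `0`. -/
def addCircle (L : MPartition m) : Finset (MPartition (m + 1)) := (finite_addCircle L).toFinset

end MPartition

/-! ## Non-symmetric Hall–Littlewood polynomials -/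

/-- The number of inversions `#{i < j | a_i < a_j}`. -/
def inv {m : ℕ} (a : Fin m → ℕ) : ℕ :=
  #{p : Fin m × Fin m | p.1 < p.2 ∧ a p.1 < a p.2}

/-- Exchange of the entries in positions `i` and `i + 1`. -/
def swapEntries {m : ℕ} (a : Fin m → ℕ) (i : ℕ) (hi : i + 1 < m) : Fin m → ℕ :=
  a ∘ Equiv.swap ⟨i, Nat.lt_of_succ_lt hi⟩ ⟨i + 1, hi⟩

/-- The composition satisfies `a_i < a_{i+1}`; it is dominant if this holds for no `i`. -/
def HasAscent {m : ℕ} (a : Fin m → ℕ) (i : ℕ) : Prop :=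
  ∃ hi : i + 1 < m, a ⟨i, Nat.lt_of_succ_lt hi⟩ < a ⟨i + 1, hi⟩

theorem inv_swapEntries_lt {m : ℕ} (a : Fin m → ℕ) (i : ℕ) (hi : i + 1 < m)
    (h : a ⟨i, Nat.lt_of_succ_lt hi⟩ < a ⟨i + 1, hi⟩) : inv (swapEntries a i hi) < inv a := by
  set x : Fin m := ⟨i, Nat.lt_of_succ_lt hi⟩ with hx
  set y : Fin m := ⟨i + 1, hi⟩ with hy
  have hxy : x < y := by simp [hx, hy, Fin.lt_def]
  have hmem : (x, y) ∈ ({p : Fin m × Fin m | p.1 < p.2 ∧ a p.1 < a p.2} : Finset _) := by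
    simp [hxy, h]
  have hord (p q : Fin m) (hpq : p < q) (hne : ¬ (p = x ∧ q = y)) :
      Equiv.swap x y p < Equiv.swap x y q := by
    simp only [Equiv.swap_apply_def, Fin.lt_def, Fin.ext_iff, hx, hy] at hpq hne ⊢
    split_ifs <;> simp_all <;> omega
  rw [inv, inv, ← Finset.card_erase_add_one hmem]
  apply Nat.lt_succ_of_le
  apply Finset.card_le_card_of_injOn
    (fun p : Fin m × Fin m => (Equiv.swap x y p.1, Equiv.swap x y p.2))
  · rintro ⟨p, q⟩ hpq
    rw [Finset.mem_coe, Finset.mem_filter] at hpq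
    replace hpq := hpq.2
    simp only [swapEntries, Function.comp_apply] at hpq
    have hne : ¬ (p = x ∧ q = y) := by
      rintro ⟨rfl, rfl⟩
      have := hpq.2
      rw [Equiv.swap_apply_left, Equiv.swap_apply_right] at this
      exact lt_asymm h this
    simp only [Finset.coe_erase, Set.mem_sdiff, Finset.mem_coe, Finset.mem_filter, Finset.mem_univ,
      true_and, Set.mem_singleton_iff, Prod.mk.injEq]
    refine ⟨⟨hord p q hpq.1 hne, hpq.2⟩, ?_⟩
    rintro ⟨h1, h2⟩
    rw [Equiv.swap_apply_eq_iff, Equiv.swap_apply_left] at h1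
    rw [Equiv.swap_apply_eq_iff, Equiv.swap_apply_right] at h2
    rw [h1, h2] at hpq
    exact lt_asymm hxy hpq.1
  · rintro ⟨p, q⟩ _ ⟨p', q'⟩ _ h
    simpa using h

open Classical in
/-- The non-symmetric Hall–Littlewood polynomials `H_a(x_1, …, x_m; t)`: `H_a = x^a` if `a` is
dominant, and `H_a = T_i H_{s_i a}` if `a_i < a_{i+1}` (the smallest such `i` is taken). -/
def hallLittlewood (m : ℕ) (a : Fin m → ℕ) : R m :=
  if h : ∃ i, HasAscent a i then
    heckeT m (Nat.find h) (Nat.find_spec h).fst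
      (hallLittlewood m (swapEntries a (Nat.find h) (Nat.find_spec h).fst))
  else ∏ j : Fin m, (⟨MvPowerSeries.X (j : ℕ), X_mem_R j.2⟩ : R m) ^ a j
termination_by inv a
decreasing_by exact inv_swapEntries_lt a _ _ (Nat.find_spec h).snd

/-! ## Schur functions and the basis `k` -/

/-- The length of the row `r` (`r = 0, 1, …`) of the Young diagram of a partition. -/
def rowLen (p : Multiset ℕ) (r : ℕ) : ℕ := (p.sort (· ≥ ·)).getD r 0

/-- The length of the column `c` (`c = 0, 1, …`) of the Young diagram of a partition. -/
def colLen (p : Multiset ℕ) (c : ℕ) : ℕ := (p.filter (c < ·)).card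

/-- The sum of all monomials of degree `n` in `x_1, x_2, …`. -/
def completeHomSeries (n : ℕ) : PS := fun d => if d.degree = n then 1 else 0

theorem coeff_completeHomSeries (n : ℕ) (d : ℕ →₀ ℕ) :
    MvPowerSeries.coeff d (completeHomSeries n) = if d.degree = n then 1 else 0 := rfl

theorem completeHomSeries_mem (n : ℕ) : completeHomSeries n ∈ R 0 := by
  refine ⟨⟨n, fun d hd => ?_⟩, fun σ _ => ?_⟩
  · rw [coeff_completeHomSeries, if_neg hd.ne']
  · ext d
    have h : d = Finsupp.embDomain σ.toEmbedding (Finsupp.embDomain σ.symm.toEmbedding d) := by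
      rw [Finsupp.embDomain_eq_mapDomain, Finsupp.embDomain_eq_mapDomain,
        ← Finsupp.mapDomain_comp]
      simp
    conv_lhs => rw [h]
    rw [MvPowerSeries.renameEquiv_apply]
    erw [MvPowerSeries.coeff_embDomain_rename σ.toEmbedding]
    rw [coeff_completeHomSeries, coeff_completeHomSeries, Finsupp.embDomain_eq_mapDomain,
      Finsupp.degree_mapDomain]

/-- The complete homogeneous symmetric function `h_n` in `x_1, x_2, …`. -/
def completeHom (n : ℕ) : R 0 := ⟨completeHomSeries n, completeHomSeries_mem n⟩

/-- `h_n` for an integer `n`, with `h_n = 0` for `n < 0`. -/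
def completeHomInt (n : ℤ) : R 0 := if 0 ≤ n then completeHom n.toNat else 0

/-- The Schur function `s_lam = det (h_{lam_i - i + j})` in all the variables `x_1, x_2, …`. -/
def classicalSchur (lam : Multiset ℕ) : R 0 :=
  (Matrix.of fun i j : Fin lam.card =>
    completeHomInt ((rowLen lam i : ℤ) - (i : ℤ) + (j : ℤ))).det

/-- `k_L(x; t) = H_a(x_1, …, x_m; t) s_lam(x)` for `L = (a; lam)`. -/
def k {m : ℕ} (L : MPartition m) : R m :=
  hallLittlewood m L.a * Subalgebra.inclusion (R_mono (Nat.zero_le m)) (classicalSchur L.lam)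

open Classical in
/-- The bilinear form on `R_m` for which the basis of all `k_L` is self-dual. -/
def IsScalarProduct (m : ℕ) (B : R m →ₗ[Qqt] R m →ₗ[Qqt] Qqt) : Prop :=
  ∀ L O : MPartition m, B (k L) (k O) = if L = O then 1 else 0

/-- The scalar product `⟨·,·⟩_m` on `R_m`. -/
def scalarProduct (m : ℕ) : R m →ₗ[Qqt] R m →ₗ[Qqt] Qqt := Classical.epsilon (IsScalarProduct m)

/-- `S` is the adjoint of the Hecke operator `T_i` for the scalar product of `R_m`. -/
def IsHeckeAdjoint (m i : ℕ) (hi : i + 1 < m) (S : R m →ₗ[Qqt] R m) : Prop :=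
  ∀ f g : R m, scalarProduct m (heckeT m i hi f) g = scalarProduct m f (S g)

/-- The adjoint `T_i^*` of the Hecke operator `T_i`. -/
def heckeTAdj (m i : ℕ) (hi : i + 1 < m) : R m →ₗ[Qqt] R m :=
  Classical.epsilon (IsHeckeAdjoint m i hi)

/-! ## Words and charge

Words are lists of letters `0, 1, 2, …` (these stand for the letters `1, 2, 3, …`). -/

/-- Marrying of the factors `(i+1) i`: reads a list of (position, letter) from left to right, given
the positions (most recent first) of the unmarried letters `i` and of the letters `i + 1` still
unmarried among the letters already read. -/
def unmarriedAux (i : ℕ) : List (ℕ × ℕ) → List ℕ → List ℕ → List ℕ × List ℕ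
  | [], as, bs => (as, bs)
  | (p, x) :: w, as, bs =>
    if x = i + 1 then unmarriedAux i w as (p :: bs)
    else if x = i then
      match bs with
      | [] => unmarriedAux i w (p :: as) []
      | _ :: bs' => unmarriedAux i w as bs'
    else unmarriedAux i w as bs

/-- The action of `σ_i` on words: the unmarried letters `i^r (i+1)^s` are replaced by
`i^s (i+1)^r`. -/
def sigmaWord (i : ℕ) (w : List ℕ) : List ℕ :=
  let u := unmarriedAux i (w.mapIdx fun p x => (p, x)) [] []
  let positions := u.1.reverse ++ u.2.reverse
  w.mapIdx fun p x =>
    if p ∈ positions then (if positions.idxOf p < u.2.length then i else i + 1) else x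

/-- One pass of bubble sort on the evaluation of a word in `m` letters: for `i = 0, …, m - 2`,
apply `σ_i` if `i` occurs less often than `i + 1`. -/
def sortPass (m : ℕ) (w : List ℕ) : List ℕ :=
  (List.range (m - 1)).foldl
    (fun v i => if v.count i < v.count (i + 1) then sigmaWord i v else v) w

/-- The word of dominant evaluation in the orbit, under the symmetric group, of a word in `m`
letters. -/
def dominantWord (m : ℕ) (w : List ℕ) : List ℕ := (sortPass m)^[m] w

/-- One round of the labelling in the computation of the charge.  The arguments are the letters
which remain to be labelled in this round, the current label, and the unlabelled letters: those
already passed and those not yet passed since the last return to the start.  The result is the sum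
of the labels given and the word of the letters which remain unlabelled. -/
def chargeRound : List ℕ → ℕ → List ℕ → List ℕ → ℕ × List ℕ
  | [], _, seen, rest => (0, seen ++ rest)
  | x :: xs, l, seen, rest =>
    if x ∈ rest then
      let u := chargeRound xs l (seen ++ rest.takeWhile (· ≠ x)) (rest.dropWhile (· ≠ x)).tail
      (l + u.1, u.2)
    else if x ∈ seen then
      let u := chargeRound xs (l + 1) (seen.takeWhile (· ≠ x))
        ((seen.dropWhile (· ≠ x)).tail ++ rest)
      (l + 1 + u.1, u.2)
    else (0, seen ++ rest)

/-- The sum of all labels in at most `n` rounds. -/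
def chargeRounds (m : ℕ) : ℕ → List ℕ → ℕ
  | 0, _ => 0
  | n + 1, w =>
    let u := chargeRound (List.range m) 0 [] w
    u.1 + chargeRounds m n u.2

/-- The charge of a word in `m` letters.  Words are read from right to left, whence the
`reverse`; each round labels at least one letter, so the number of rounds suffices. -/
def wordCharge (m : ℕ) (w : List ℕ) : ℕ :=
  chargeRounds m w.length (dominantWord m w).reverse

/-- The charge of a word in the letters `1̄ > 2̄ > ⋯ > m̄`, where `i : Fin m` stands for the letter
with a bar and the reversal of the alphabet turns it into an ordinary letter. -/
def barCharge {m : ℕ} (w : List (Fin m)) : ℕ := wordCharge m (w.map fun i => (Fin.rev i : ℕ))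

/-! ## Tableaux and the dual `m`-symmetric Schur functions -/

/-- The cells (row, column) of the skew diagram `outer / inner`. -/
def skewCells (outer inner : Multiset ℕ) : Finset (ℕ × ℕ) :=
  {c ∈ range outer.card ×ˢ range outer.sum | rowLen inner c.1 ≤ c.2 ∧ c.2 < rowLen outer c.1}

/-- Fillings of the skew diagram `(a ∪ lam) / mu` with letters `1, …, m`, where `L = (a; lam)` and
`O = (b; mu)`. -/
abbrev Filling {m : ℕ} (L O : MPartition m) : Type :=
  {c : ℕ × ℕ // c ∈ skewCells L.total O.lam} → Fin m

open Classical in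
/-- The set of skew tableaux of shape `(a ∪ lam) / mu` in which the letter `i` appears `b_i` times
and always within the first `a_i` columns, where `L = (a; lam)` and `O = (b; mu)`. -/
def tableaux {m : ℕ} (L O : MPartition m) : Finset (Filling L O) :=
  {T | (∀ r, rowLen O.lam r ≤ rowLen L.total r) ∧
    (∀ x y, x.1.1 = y.1.1 → x.1.2 < y.1.2 → T x ≤ T y) ∧
    (∀ x y, x.1.2 = y.1.2 → x.1.1 < y.1.1 → T x < T y) ∧
    (∀ i : Fin m, #{x | T x = i} = O.a i) ∧
    (∀ x, x.1.2 < L.a (T x))}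

open Classical in
/-- The column `c`, from top to bottom, of the tableau `T̄` complementary to `T`: it contains `ī`
for all `i` with `c` among the first `a_i` columns for which `i` is not in the column `c` of `T`. -/
def barColumn {m : ℕ} {L O : MPartition m} (T : Filling L O) (c : ℕ) : List (Fin m) :=
  (List.finRange m).reverse.filter fun i => c < L.a i ∧ ∀ x, x.1.2 = c → T x ≠ i

/-- The word of the tableau `T̄` of shape `mu / lam`: its rows are read from bottom to top, each
from left to right. -/
def barWord {m : ℕ} {L O : MPartition m} (T : Filling L O) : List (Fin m) :=
  (List.range O.lam.card).reverse.flatMap fun r =>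
    (List.range' (rowLen L.lam r) (rowLen O.lam r - rowLen L.lam r)).filterMap fun c =>
      (barColumn T c)[r - colLen L.lam c]?

/-- The word `1̄^(a_1 - a_1) 2̄^(a_1 - a_2) ⋯ m̄^(a_1 - a_m)` for a dominant composition `a`, whose
largest entry is `a_1`. -/
def uWord {m : ℕ} (a : Fin m → ℕ) : List (Fin m) :=
  (List.finRange m).flatMap fun i => List.replicate (univ.sup a - a i) i

/-- The charge `Inv(b) + charge(T̄ u_a)` of a tableau, for dominant `L = (a; lam)`. -/
def tableauCharge {m : ℕ} {L O : MPartition m} (T : Filling L O) : ℕ :=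
  inv O.a + barCharge (barWord T ++ uWord L.a)

/-- The coefficient `D_{L O}(t)` for dominant `L`. -/
def dominantCoeff {m : ℕ} (L O : MPartition m) : Qqt :=
  ∑ T ∈ tableaux L O, tt ^ tableauCharge T

open Classical in
/-- The dual `m`-symmetric Schur functions `s^*_L(x; t)`: the combination of the `k_O` with
coefficients `D_{L O}(t)` if `L` is dominant, and `t⁻¹ T_i^* s^*_{s_i L}` if `a_i < a_{i+1}` (the
smallest such `i` is taken). -/
def dualSchur {m : ℕ} (L : MPartition m) : R m :=
  if h : ∃ i, HasAscent L.a i then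
    tt⁻¹ • heckeTAdj m (Nat.find h) (Nat.find_spec h).fst
      (dualSchur (L.swap (Nat.find h) (Nat.find_spec h).fst))
  else ∑ O ∈ MPartition.ofDegree m L.degree, dominantCoeff L O • k O
termination_by inv L.a
decreasing_by exact inv_swapEntries_lt L.a _ _ (Nat.find_spec h).snd

open Classical in
/-- The family `F` is dual to the family of the dual `m`-symmetric Schur functions. -/
def IsSchurFamily (m : ℕ) (F : MPartition m → R m) : Prop :=
  ∀ L O : MPartition m, scalarProduct m (F L) (dualSchur O) = if L = O then 1 else 0

/-- The `m`-symmetric Schur functions `s_L(x; t)`. -/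
def schur {m : ℕ} : MPartition m → R m := Classical.epsilon (IsSchurFamily m)

end MSymmetric

end

open MSymmetric

/-! The two formulas are dual to each other. In the basis `k_L`, the inclusion sends `k_(a; λ)` to
`k_(a,0; λ)`, because `H_(a,0) = H_a`. The restriction sends `k_(a,c; λ)` to `k_(a; λ)` if `c = 0`
and to `0` otherwise, because `x_{m+1}` divides `H_(a,c)` for `c > 0`. So the two maps are adjoint
(`scalarProduct_incl`), and the formula for the inclusion of `s_Λ` is the transpose of the formula
for the restriction of `s*_Λ`. Since `T_i` commutes with the inclusion, `T_i^*` commutes with the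
restriction (`restr_heckeTAdj`), and it is enough to treat `Λ` with `(a_1, …, a_m)` dominant.

In that case the coefficients on the `k_M` are compared. The operators `T_i^*` carry `a_{m+1}` to
its sorted place; the zero in the last place of the index of `k_(M,0)` moves along with it, and each
step across a nonzero entry gives a power of `t` which the change of `Inv` accounts for
(`scalarProduct_k_dualSchur_insert`). A combinatorial identity remains (`sum_tableaux_insert`): both
sides sum over fillings of the same skew shape, those of the larger alphabet not using the letter
`j` at the new place, and the charge of `T̄ u_a` has to be the same in both alphabets.

The charge is a plactic invariant (`Plactic.wordCharge`): the reflections `σ_i` are powers of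
crystal operators, which respect Knuth relations, and the labelling procedure does not notice a
Knuth move. Now `T̄` is a tableau in the reversed alphabet, so its row word is equivalent to its
column word, and the letters of `u_a` can be absorbed into the columns. The result is the
concatenation of the complements, in the whole alphabet, of the columns of `T`
(`plactic_barWord_append_uWord`). A letter that `T` does not use is thus inserted into every column.
Sorting the evaluation turns such a letter into the smallest one, where it can be deleted without
changing the charge (`wordCharge_insCol`); full columns at the end can be deleted as well
(`wordCharge_append_full`).

For existence and uniqueness, the `k_L` have to form a basis (`linearIndependent_k`, `span_k`). The
products `x^a e_λ` have distinct initial monomials, which represent all monomials up to permutation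
of the symmetric variables. They lie in the span of the `k_L`: the `H_a` are unitriangular in the
monomials, and Jacobi–Trudi inversion expresses the `e_μ` by Schur functions. Counting dimensions in
bounded degree then gives the basis property. Finally `s*_L` is `k_L` plus terms with a larger
symmetric part (`dualSchur_sub_k_mem`), so the `s*_L` have a unique dual family. -/

namespace MSymmetric

/-! ## Parenthesis matching in words -/

/-- The number of unmatched letters `i` of a word, a letter `i` being matched with a letter `i + 1`
on its left. -/
def unmatchedLow (i : ℕ) : List ℕ → ℕ
  | [] => 0
  | a :: v => if a = i then unmatchedLow i v + 1
      else if a = i + 1 then unmatchedLow i v - 1 else unmatchedLow i v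

/-- The number of unmatched letters `i + 1` of a word. -/
def unmatchedHigh (i : ℕ) : List ℕ → ℕ
  | [] => 0
  | a :: v => if a = i + 1 ∧ unmatchedLow i v = 0 then unmatchedHigh i v + 1
      else unmatchedHigh i v

/-- The word in which the first unmatched letter `i + 1` is replaced by `i`. -/
def raiseWord (i : ℕ) : List ℕ → List ℕ
  | [] => []
  | a :: v => if a = i + 1 ∧ unmatchedLow i v = 0 then i :: v else a :: raiseWord i v

/-- The word in which the first `k` unmatched letters `i + 1` are replaced by `i`. -/
def raiseFirst (i : ℕ) : ℕ → List ℕ → List ℕ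
  | _, [] => []
  | k, a :: v => if a = i + 1 ∧ unmatchedLow i v = 0 ∧ 0 < k then i :: raiseFirst i (k - 1) v
      else a :: raiseFirst i k v

/-- An unmatched `i + 1` has no unmatched `i` on its right, so turning it into `i` breaks no pair
and yields one more unmatched `i`. -/
theorem unmatchedLow_raiseFirst (i : ℕ) : ∀ (k : ℕ) (w : List ℕ),
    unmatchedLow i (raiseFirst i k w) = unmatchedLow i w + min k (unmatchedHigh i w)
  | k, [] => by simp [raiseFirst, unmatchedHigh, unmatchedLow]
  | k, a :: v => by
    have h1 := unmatchedLow_raiseFirst i k v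
    have h2 := unmatchedLow_raiseFirst i (k - 1) v
    simp only [raiseFirst, unmatchedHigh]
    split_ifs <;> simp only [unmatchedLow] <;> split_ifs <;> omega

/-- After the first `k` replacements the remaining unmatched letters `i + 1` are still unmatched.
Thus several replacements amount to a power of one crystal operator, whose behaviour under Knuth
moves can be checked one letter at a time. -/
theorem raiseWord_raiseFirst (i : ℕ) : ∀ (k : ℕ) (w : List ℕ),
    raiseWord i (raiseFirst i k w) = raiseFirst i (k + 1) w
  | k, [] => by simp [raiseFirst, raiseWord]
  | k, a :: v => by
    have h1 := raiseWord_raiseFirst i k v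
    have h2 := raiseWord_raiseFirst i (k - 1) v
    have h3 := unmatchedLow_raiseFirst i k v
    simp only [raiseFirst]
    by_cases ha : a = i + 1
    · by_cases hl : unmatchedLow i v = 0
      · rcases Nat.eq_zero_or_pos k with rfl | hk
        · simp [ha, hl, raiseWord, h3]
        · have : k - 1 + 1 = k := by omega
          rw [this] at h2
          simp [ha, hl, hk, raiseWord, h2]
      · have : unmatchedLow i (raiseFirst i k v) ≠ 0 := by omega
        simp [ha, hl, raiseWord, this, h1]
    · simp [ha, raiseWord, h1]

theorem raiseFirst_zero (i : ℕ) : ∀ w : List ℕ, raiseFirst i 0 w = w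
  | [] => rfl
  | a :: v => by simp [raiseFirst, raiseFirst_zero i v]

theorem raiseFirst_eq_iterate (i k : ℕ) (w : List ℕ) : raiseFirst i k w = (raiseWord i)^[k] w := by
  induction k with
  | zero => exact raiseFirst_zero i w
  | succ k ih => rw [Function.iterate_succ_apply', ← ih, raiseWord_raiseFirst]

/-- Matched letters come in pairs, one of each kind. -/
theorem count_add_unmatchedLow (i : ℕ) : ∀ w : List ℕ,
    w.count (i + 1) + unmatchedLow i w = w.count i + unmatchedHigh i w
  | [] => by simp [unmatchedHigh, unmatchedLow]
  | a :: v => by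
    have h := count_add_unmatchedLow i v
    simp only [List.count_cons, unmatchedLow, unmatchedHigh, beq_iff_eq]
    split_ifs <;> omega

/-- The positions of the unmatched letters `i`, the first letter having position `p`. -/
def lowPositions (i : ℕ) : ℕ → List ℕ → List ℕ
  | _, [] => []
  | p, a :: v => if a = i then p :: lowPositions i (p + 1) v
      else if a = i + 1 then (lowPositions i (p + 1) v).tail else lowPositions i (p + 1) v

/-- The positions of the unmatched letters `i + 1`, the first letter having position `p`. -/
def highPositions (i : ℕ) : ℕ → List ℕ → List ℕ
  | _, [] => []
  | p, a :: v => if a = i + 1 ∧ unmatchedLow i v = 0 then p :: highPositions i (p + 1) v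
      else highPositions i (p + 1) v

theorem length_lowPositions (i : ℕ) : ∀ (p : ℕ) (w : List ℕ),
    (lowPositions i p w).length = unmatchedLow i w
  | _, [] => rfl
  | p, a :: v => by
    have h := length_lowPositions i (p + 1) v
    simp only [lowPositions, unmatchedLow]
    split_ifs <;> simp [h]

theorem length_highPositions (i : ℕ) : ∀ (p : ℕ) (w : List ℕ),
    (highPositions i p w).length = unmatchedHigh i w
  | _, [] => rfl
  | p, a :: v => by
    have h := length_highPositions i (p + 1) v
    simp only [highPositions, unmatchedHigh]
    split_ifs <;> simp [h]

theorem le_of_mem_lowPositions (i : ℕ) : ∀ (p : ℕ) (w : List ℕ), ∀ q ∈ lowPositions i p w, p ≤ q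
  | _, [] => by simp [lowPositions]
  | p, a :: v => by
    intro q hq
    have h := le_of_mem_lowPositions i (p + 1) v q
    simp only [lowPositions] at hq
    split_ifs at hq
    · rcases List.mem_cons.mp hq with rfl | hq
      · exact le_rfl
      · have := h hq; omega
    · have := h (List.mem_of_mem_tail hq); omega
    · have := h hq; omega

theorem le_of_mem_highPositions (i : ℕ) :
    ∀ (p : ℕ) (w : List ℕ), ∀ q ∈ highPositions i p w, p ≤ q
  | _, [] => by simp [highPositions]
  | p, a :: v => by
    intro q hq
    have h := le_of_mem_highPositions i (p + 1) v q
    simp only [highPositions] at hq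
    split_ifs at hq
    · rcases List.mem_cons.mp hq with rfl | hq
      · exact le_rfl
      · have := h hq; omega
    · have := h hq; omega

/-- Reconciles the reading from the left with the recursion from the right. The pending letters `i +
1` in `bs` absorb the first `bs.length` letters `i` that the rest of the word leaves unmatched, and
each of these cancels the most recent pending letter. -/
theorem unmarriedAux_eq (i : ℕ) : ∀ (w : List ℕ) (p : ℕ) (as bs : List ℕ),
    unmarriedAux i (w.mapIdx fun q x => (p + q, x)) as bs =
      (((lowPositions i p w).drop bs.length).reverse ++ as,
        (highPositions i p w).reverse ++ bs.drop (unmatchedLow i w))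
  | [], p, as, bs => by simp [unmarriedAux, lowPositions, highPositions, unmatchedLow]
  | a :: v, p, as, bs => by
    have hs : (fun q x => (p + (q + 1), x) : ℕ → ℕ → ℕ × ℕ) = fun q x => (p + 1 + q, x) := by
      funext q x; congr 1; omega
    have ih := unmarriedAux_eq i v (p + 1)
    rw [List.mapIdx_cons, hs]
    simp only [unmarriedAux, lowPositions, highPositions, unmatchedLow, add_zero]
    by_cases h1 : a = i + 1
    · have h2 : a ≠ i := by omega
      rw [if_pos h1, ih]
      by_cases h3 : unmatchedLow i v = 0
      · simp [h1, h3]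
      · obtain ⟨n, hn⟩ := Nat.exists_eq_succ_of_ne_zero h3
        simp [h1, hn]
    · rw [if_neg h1]
      by_cases h2 : a = i
      · cases bs with
        | nil => simp [h2, ih]
        | cons b bs => simp [h2, ih]
      · simp [h1, h2, ih]

theorem getElem?_of_mem_lowPositions (i : ℕ) : ∀ (w : List ℕ) (p q : ℕ),
    p + q ∈ lowPositions i p w → w[q]? = some i
  | [], _, _ => by simp [lowPositions]
  | a :: v, p, q => by
    intro h
    have h' : p + q ∈ (if a = i then [p] else []) ++ lowPositions i (p + 1) v := by
      simp only [lowPositions] at h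
      split_ifs at h ⊢
      · simpa using h
      · simpa using List.mem_of_mem_tail h
      · simpa using h
    have hle := le_of_mem_lowPositions i (p + 1) v (p + q)
    cases q with
    | zero =>
      have hn : p + 0 ∉ lowPositions i (p + 1) v := fun h => by have := hle h; omega
      split_ifs at h' with ha
      · simp [ha]
      · simp at h' hn; contradiction
    | succ q =>
      rw [List.getElem?_cons_succ]
      apply getElem?_of_mem_lowPositions i v (p + 1)
      rw [add_assoc, add_comm 1 q]
      split_ifs at h'
      · simpa using h'
      · simpa using h'

theorem getElem?_of_mem_highPositions (i : ℕ) : ∀ (w : List ℕ) (p q : ℕ),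
    p + q ∈ highPositions i p w → w[q]? = some (i + 1)
  | [], _, _ => by simp [highPositions]
  | a :: v, p, q => by
    intro h
    have h' : p + q ∈ (if a = i + 1 then [p] else []) ++ highPositions i (p + 1) v := by
      simp only [highPositions] at h
      split_ifs at h ⊢ <;> simp_all
    have hle := le_of_mem_highPositions i (p + 1) v (p + q)
    cases q with
    | zero =>
      have hn : p + 0 ∉ highPositions i (p + 1) v := fun h => by have := hle h; omega
      split_ifs at h' with ha
      · simp [ha]
      · simp at h' hn; contradiction
    | succ q =>
      rw [List.getElem?_cons_succ]
      apply getElem?_of_mem_highPositions i v (p + 1)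
      rw [add_assoc, add_comm 1 q]
      split_ifs at h'
      · simpa using h'
      · simpa using h'

theorem mapIdx_eq_raiseFirst (i : ℕ) : ∀ (w : List ℕ) (p k : ℕ),
    w.mapIdx (fun q x => if p + q ∈ (highPositions i p w).take k then i else x) = raiseFirst i k w
  | [], _, _ => by simp [raiseFirst]
  | a :: v, p, k => by
    have hs (L : List ℕ) : v.mapIdx (fun q x => if p + (q + 1) ∈ L then i else x)
        = v.mapIdx (fun q x => if p + 1 + q ∈ L then i else x) := by
      congr 1; funext q x; rw [add_comm q 1, ← add_assoc]
    have hn (k : ℕ) : p ∉ (highPositions i (p + 1) v).take k := fun h => by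
      have := le_of_mem_highPositions i (p + 1) v p (List.mem_of_mem_take h); omega
    by_cases h1 : a = i + 1 ∧ unmatchedLow i v = 0
    · have hp : highPositions i p (a :: v) = p :: highPositions i (p + 1) v := by
        simp [highPositions, h1]
      rw [hp, List.mapIdx_cons, hs]
      rcases Nat.eq_zero_or_pos k with rfl | hk
      · have := mapIdx_eq_raiseFirst i v (p + 1) 0
        simp only [List.take_zero, List.not_mem_nil, if_false, raiseFirst] at this ⊢
        simp [this]
      · obtain ⟨k, rfl⟩ := Nat.exists_eq_succ_of_ne_zero hk.ne'
        have := mapIdx_eq_raiseFirst i v (p + 1) k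
        have h3 (q : ℕ) : p + 1 + q ≠ p := by omega
        simp [raiseFirst, h1, this, h3]
    · have hp : highPositions i p (a :: v) = highPositions i (p + 1) v := by
        simp [highPositions, h1]
      have := mapIdx_eq_raiseFirst i v (p + 1) k
      rw [hp, List.mapIdx_cons, hs, this, add_zero, if_neg (hn k), raiseFirst, if_neg (by tauto)]

/-- The unmatched letters form a subword `i^r (i+1)^s`, here with `r ≤ s`. Passing to `i^s (i+1)^r`
keeps the unmatched `i` and changes the first `s - r` unmatched `i + 1`, and `s - r` is the
difference of the multiplicities. -/
theorem sigmaWord_eq_raiseFirst (i : ℕ) (w : List ℕ) (h : w.count i ≤ w.count (i + 1)) :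
    sigmaWord i w = raiseFirst i (w.count (i + 1) - w.count i) w := by
  have hc := count_add_unmatchedLow i w
  have hu := unmarriedAux_eq i w 0 [] []
  simp only [zero_add, List.length_nil, List.drop_zero, List.append_nil, List.drop_nil] at hu
  rw [← mapIdx_eq_raiseFirst i w 0, sigmaWord]
  simp only [hu, List.reverse_reverse, List.length_reverse, zero_add]
  have e1 := length_lowPositions i 0 w
  have e2 := length_highPositions i 0 w
  apply List.ext_getElem (by simp)
  intro q h1 h2
  simp only [List.getElem_mapIdx]
  have hl := getElem?_of_mem_lowPositions i w 0 q
  have hh := getElem?_of_mem_highPositions i w 0 q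
  simp only [zero_add] at hl hh
  have hq : q < w.length := by simpa using h1
  rw [List.getElem?_eq_getElem hq] at hl hh
  have ht := List.mem_take_iff_idxOf_lt (l := highPositions i 0 w) (a := q)
    (n := w.count (i + 1) - w.count i)
  by_cases hql : q ∈ lowPositions i 0 w
  · have hqh : q ∉ highPositions i 0 w := fun h' => by
      have := hl hql; have := hh h'; simp_all
    have h3 : List.idxOf q (lowPositions i 0 w ++ highPositions i 0 w)
        < (highPositions i 0 w).length := by
      rw [List.idxOf_append_of_mem hql]
      have := List.idxOf_lt_length_iff.mpr hql
      omega
    rw [if_pos (by simp [hql]), if_pos h3, if_neg (fun h => hqh (List.mem_of_mem_take h))]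
    simpa using (hl hql).symm
  · by_cases hqh : q ∈ highPositions i 0 w
    · rw [if_pos (by simp [hqh]), List.idxOf_append_of_notMem hql]
      have hv := hh hqh
      have ht := ht hqh
      simp only [Option.some.injEq] at hv
      rw [hv]
      congr 1
      rw [ht, e1, e2]
      exact propext (by omega)
    · rw [if_neg (by simp [hql, hqh]), if_neg (fun h => hqh (List.mem_of_mem_take h))]

/-! ## Plactic equivalence -/

/-- An elementary Knuth transformation of words. -/
inductive KnuthStep : List ℕ → List ℕ → Prop
  | left (x y z : ℕ) (v : List ℕ) : x ≤ y → y < z → KnuthStep (x :: z :: y :: v) (z :: x :: y :: v)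
  | right (x y z : ℕ) (v : List ℕ) : x < y → y ≤ z → KnuthStep (y :: z :: x :: v) (y :: x :: z :: v)
  | cons (a : ℕ) {w w' : List ℕ} : KnuthStep w w' → KnuthStep (a :: w) (a :: w')

/-- Plactic equivalence of words. -/
def Plactic : List ℕ → List ℕ → Prop := Relation.EqvGen KnuthStep

namespace Plactic

theorem refl (w : List ℕ) : Plactic w w := Relation.EqvGen.refl w

theorem of_eq {w w' : List ℕ} (h : w = w') : Plactic w w' := h ▸ refl w

theorem symm {w w' : List ℕ} (h : Plactic w w') : Plactic w' w := Relation.EqvGen.symm _ _ h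

theorem trans {w w' w'' : List ℕ} (h : Plactic w w') (h' : Plactic w' w'') : Plactic w w'' :=
  Relation.EqvGen.trans _ _ _ h h'

theorem map_of_step {f : List ℕ → List ℕ} (hf : ∀ w w', KnuthStep w w' → Plactic (f w) (f w'))
    {w w' : List ℕ} (h : Plactic w w') : Plactic (f w) (f w') := by
  induction h with
  | rel _ _ h => exact hf _ _ h
  | refl _ => exact refl _
  | symm _ _ _ ih => exact ih.symm
  | trans _ _ _ _ _ ih1 ih2 => exact ih1.trans ih2

theorem cons (a : ℕ) {w w' : List ℕ} (h : Plactic w w') : Plactic (a :: w) (a :: w') :=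
  map_of_step (f := (a :: ·)) (fun _ _ h => .rel _ _ (.cons a h)) h

theorem append_left (u : List ℕ) {w w' : List ℕ} (h : Plactic w w') :
    Plactic (u ++ w) (u ++ w') := by
  induction u with
  | nil => exact h
  | cons a u ih => exact ih.cons a

theorem append_right {w w' : List ℕ} (h : Plactic w w') (u : List ℕ) :
    Plactic (w ++ u) (w' ++ u) := by
  refine map_of_step (f := (· ++ u)) (fun w w' h => .rel _ _ ?_) h
  induction h with
  | left x y z v h1 h2 => exact .left _ _ _ _ h1 h2
  | right x y z v h1 h2 => exact .right _ _ _ _ h1 h2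
  | cons a _ ih => exact .cons a ih

end Plactic

theorem KnuthStep.perm {w w' : List ℕ} (h : KnuthStep w w') : w.Perm w' := by
  induction h with
  | left x y z v => exact .swap _ _ _
  | right x y z v => exact .cons _ (.swap _ _ _)
  | cons a _ ih => exact ih.cons a

theorem Plactic.perm {w w' : List ℕ} (h : Plactic w w') : w.Perm w' := by
  induction h with
  | rel _ _ h => exact h.perm
  | refl _ => exact .refl _
  | symm _ _ _ ih => exact ih.symm
  | trans _ _ _ _ _ ih1 ih2 => exact ih1.trans ih2

/-- The equality of the numbers of unmatched `i` shows that letters on the left of a Knuth triple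
see no difference, which makes the induction on the prefix work. For the triple itself only the
position of `x`, `y`, `z` relative to `i`, `i + 1` and the first few values of `unmatchedLow i v`
matter; the image may be a Knuth triple of the other kind. -/
theorem KnuthStep.raiseWord (i : ℕ) {w w' : List ℕ} (h : KnuthStep w w') :
    unmatchedLow i w = unmatchedLow i w' ∧ KnuthStep (raiseWord i w) (raiseWord i w') := by
  have tri (x : ℕ) : x = i ∨ x = i + 1 ∨ (x ≠ i ∧ x ≠ i + 1) := by omega
  induction h with
  | left x y z v h1 h2 =>
    constructor
    · simp only [unmatchedLow]
      split_ifs <;> omega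
    · have h3 : ∀ n : ℕ, n = 0 ∨ ∃ k, n = k + 1 := fun n => by cases n <;> simp
      rcases tri x with hx | hx | hx <;> rcases tri y with hy | hy | hy <;>
        rcases tri z with hz | hz | hz <;> try omega
      all_goals
        rcases h3 (unmatchedLow i v) with hv | ⟨k, hv⟩
        all_goals
          simp [MSymmetric.raiseWord, unmatchedLow, hx, hy, hz, hv]
          try first
          | exact .left _ _ _ _ (by omega) (by omega)
          | exact .right _ _ _ _ (by omega) (by omega)
          | (split_ifs <;> exact .left _ _ _ _ (by omega) (by omega))
  | right x y z v h1 h2 =>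
    constructor
    · simp only [unmatchedLow]
      split_ifs <;> omega
    · have h3 : ∀ n : ℕ, n = 0 ∨ n = 1 ∨ ∃ k, n = k + 2 := fun n => by
        rcases n with _ | _ | n <;> simp
      rcases tri x with hx | hx | hx <;> rcases tri y with hy | hy | hy <;>
        rcases tri z with hz | hz | hz <;> try omega
      all_goals
        rcases h3 (unmatchedLow i v) with hv | hv | ⟨k, hv⟩
        all_goals
          simp [MSymmetric.raiseWord, unmatchedLow, hx, hy, hz, hv]
          try first
          | exact .left _ _ _ _ (by omega) (by omega)
          | exact .right _ _ _ _ (by omega) (by omega)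
  | cons a h ih =>
    constructor
    · simp only [unmatchedLow, ih.1]
    · simp only [MSymmetric.raiseWord, ih.1]
      split_ifs
      · exact .cons _ h
      · exact .cons _ ih.2

/-- Equivalent words have the same evaluation, so the same power of the crystal operator is applied
to both. -/
theorem Plactic.sigmaWord (i : ℕ) {w w' : List ℕ} (h : Plactic w w')
    (hw : w.count i ≤ w.count (i + 1)) : Plactic (sigmaWord i w) (sigmaWord i w') := by
  have h1 := h.perm.count_eq i
  have h2 := h.perm.count_eq (i + 1)
  rw [sigmaWord_eq_raiseFirst i w hw, sigmaWord_eq_raiseFirst i w' (by omega), ← h1, ← h2,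
    raiseFirst_eq_iterate, raiseFirst_eq_iterate]
  generalize w.count (i + 1) - w.count i = k
  induction k with
  | zero => exact h
  | succ k ih =>
    rw [Function.iterate_succ_apply', Function.iterate_succ_apply']
    exact map_of_step (fun _ _ h => .rel _ _ (h.raiseWord i).2) ih

theorem Plactic.sortPass (m : ℕ) {w w' : List ℕ} (h : Plactic w w') :
    Plactic (sortPass m w) (sortPass m w') := by
  unfold MSymmetric.sortPass
  induction List.range (m - 1) generalizing w w' with
  | nil => exact h
  | cons i l ih =>
    rw [List.foldl_cons, List.foldl_cons]
    apply ih
    have h1 := h.perm.count_eq i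
    have h2 := h.perm.count_eq (i + 1)
    rw [← h1, ← h2]
    split_ifs with hc
    · exact h.sigmaWord i hc.le
    · exact h

theorem Plactic.dominantWord (m : ℕ) {w w' : List ℕ} (h : Plactic w w') :
    Plactic (dominantWord m w) (dominantWord m w') := by
  have key (k : ℕ) : Plactic ((MSymmetric.sortPass m)^[k] w) ((MSymmetric.sortPass m)^[k] w') := by
    induction k with
    | zero => exact h
    | succ k ih =>
      rw [Function.iterate_succ_apply', Function.iterate_succ_apply']
      exact ih.sortPass m
  exact key m

/-! ## The charge is a plactic invariant -/

theorem chargeRound_rest {x : ℕ} {p : List ℕ} (hp : x ∉ p) (xs : List ℕ) (l : ℕ) (s q : List ℕ) :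
    chargeRound (x :: xs) l s (p ++ x :: q) =
      (l + (chargeRound xs l (s ++ p) q).1, (chargeRound xs l (s ++ p) q).2) := by
  have h : ∀ y ∈ p, decide (y ≠ x) = true := fun y hy => by
    simpa using fun h : y = x => hp (h ▸ hy)
  rw [chargeRound, if_pos (by simp)]
  rw [List.takeWhile_append_of_pos h, List.dropWhile_append_of_pos h]
  simp

theorem chargeRound_seen {x : ℕ} {p r : List ℕ} (hp : x ∉ p) (hr : x ∉ r) (xs : List ℕ) (l : ℕ)
    (q : List ℕ) :
    chargeRound (x :: xs) l (p ++ x :: q) r =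
      (l + 1 + (chargeRound xs (l + 1) p (q ++ r)).1,
        (chargeRound xs (l + 1) p (q ++ r)).2) := by
  have h : ∀ y ∈ p, decide (y ≠ x) = true := fun y hy => by
    simpa using fun h : y = x => hp (h ▸ hy)
  rw [chargeRound, if_neg hr, if_pos (by simp)]
  rw [List.takeWhile_append_of_pos h, List.dropWhile_append_of_pos h]
  simp

theorem chargeRound_none {x : ℕ} {s r : List ℕ} (hs : x ∉ s) (hr : x ∉ r) (xs : List ℕ) (l : ℕ) :
    chargeRound (x :: xs) l s r = (0, s ++ r) := by
  rw [chargeRound, if_neg hr, if_neg hs]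

/-- A letter which is not sought next may cross the point where the cyclic reading stands. -/
theorem chargeRound_cross {xs : List ℕ} {b : ℕ} (hb : xs.head? ≠ some b) (l : ℕ) (p q : List ℕ) :
    chargeRound xs l (p ++ [b]) q = chargeRound xs l p (b :: q) := by
  cases xs with
  | nil => simp [chargeRound]
  | cons x xs =>
    have hxb : x ≠ b := by simpa using hb
    by_cases hq : x ∈ q
    · obtain ⟨q1, q2, rfl, h1⟩ := List.eq_append_cons_of_mem hq
      rw [chargeRound_rest h1, ← List.cons_append, chargeRound_rest (by simp [hxb, h1])]
      simp
    · by_cases hp : x ∈ p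
      · obtain ⟨p1, p2, rfl, h1⟩ := List.eq_append_cons_of_mem hp
        rw [List.append_assoc, List.cons_append, chargeRound_seen h1 hq,
          chargeRound_seen h1 (by simp [hxb, hq])]
        simp
      · rw [chargeRound_none (by simp [hxb, hp]) hq, chargeRound_none hp (by simp [hxb, hq])]
        simp

/-- The elementary transformations of words in `m` letters, read from right to left, which
preserve the charge in any context. -/
inductive ChargeCore (m : ℕ) : List ℕ → List ℕ → Prop
  | swap (a b : ℕ) : a + 1 < b ∨ b + 1 < a → ChargeCore m [a, b] [b, a]
  | low (i : ℕ) : i + 1 < m → ChargeCore m [i, i + 1, i] [i, i, i + 1]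
  | high (i : ℕ) : i + 1 < m → ChargeCore m [i, i + 1, i + 1] [i + 1, i, i + 1]

theorem ChargeCore.mem_iff {m : ℕ} {K K' : List ℕ} (h : ChargeCore m K K') (x : ℕ) :
    x ∈ K ↔ x ∈ K' := by
  cases h <;> simp <;> tauto

theorem head?_range'_ne {a n b : ℕ} (h : a ≠ b) : (List.range' a n).head? ≠ some b := by
  cases n <;> simp [List.range'_succ, h]

/-- This is the case in which the reading point enters the block. Once `x` is taken, the two
versions differ by letters that may cross the reading point because they are not sought next, or
else the next letter `x + 1` is taken from the block in both and what remains differs only in this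
way. -/
theorem ChargeCore.pick {m n x : ℕ} {K K' : List ℕ} (h : ChargeCore m K K') (hx : x ∈ K)
    (hn : x + 1 + n = m) :
    ∃ A B A' B', K = A ++ x :: B ∧ K' = A' ++ x :: B' ∧ x ∉ A ∧ x ∉ A' ∧ ∀ l p q,
      chargeRound (List.range' (x + 1) n) l (p ++ A) (B ++ q) =
        chargeRound (List.range' (x + 1) n) l (p ++ A') (B' ++ q) := by
  cases h with
  | swap a b hab =>
    by_cases hxa : x = a
    · subst hxa
      refine ⟨[], [b], [b], [], rfl, rfl, by simp, by simp; omega, fun l p q => ?_⟩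
      simpa using (chargeRound_cross (head?_range'_ne (by omega)) l p q).symm
    · obtain rfl : x = b := by simpa [hxa] using hx
      refine ⟨[a], [], [], [a], rfl, rfl, by simpa using hxa, by simp, fun l p q => ?_⟩
      simpa using (chargeRound_cross (head?_range'_ne (by omega)) l p q)
  | low i hi =>
    by_cases hxi : x = i
    · subst hxi
      refine ⟨[], [x + 1, x], [], [x, x + 1], rfl, rfl, by simp, by simp, fun l p q => ?_⟩
      obtain ⟨n, rfl⟩ : ∃ k, n = k + 1 := ⟨n - 1, by omega⟩
      rw [List.range'_succ]
      have h1 := chargeRound_rest (x := x + 1) (p := []) (by simp) (List.range' (x + 1 + 1) n) l p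
        (x :: q)
      have h2 := chargeRound_rest (x := x + 1) (p := [x]) (by simp) (List.range' (x + 1 + 1) n) l p
        q
      have h3 := chargeRound_cross (head?_range'_ne (n := n) (show x + 1 + 1 ≠ x by omega)) l p q
      simp only [List.nil_append, List.append_nil, List.cons_append] at h1 h2 ⊢
      rw [h1, h2, h3]
    · obtain rfl : x = i + 1 := by simpa [hxi] using hx
      refine ⟨[i], [i], [i, i], [], rfl, rfl, by simp, by simp, fun l p q => ?_⟩
      have h3 := chargeRound_cross (head?_range'_ne (n := n) (show i + 1 + 1 ≠ i by omega)) l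
        (p ++ [i]) q
      simpa using h3.symm
  | high i hi =>
    by_cases hxi : x = i
    · subst hxi
      refine ⟨[], [x + 1, x + 1], [x + 1], [x + 1], rfl, rfl, by simp, by simp, fun l p q => ?_⟩
      obtain ⟨n, rfl⟩ : ∃ k, n = k + 1 := ⟨n - 1, by omega⟩
      rw [List.range'_succ]
      have h1 := chargeRound_rest (x := x + 1) (p := []) (by simp) (List.range' (x + 1 + 1) n) l p
        ((x + 1) :: q)
      have h2 := chargeRound_rest (x := x + 1) (p := []) (by simp) (List.range' (x + 1 + 1) n) l
        (p ++ [x + 1]) q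
      have h3 := chargeRound_cross (head?_range'_ne (n := n) (show x + 1 + 1 ≠ x + 1 by omega)) l
        p q
      simp only [List.nil_append, List.append_nil, List.cons_append] at h1 h2 ⊢
      rw [h1, h2, h3]
    · obtain rfl : x = i + 1 := by simpa [hxi] using hx
      refine ⟨[i], [i + 1], [], [i, i + 1], rfl, rfl, by simp, by simp, fun l p q => ?_⟩
      have h3 := chargeRound_cross (head?_range'_ne (n := n) (show i + 1 + 1 ≠ i by omega)) l
        p ((i + 1) :: q)
      simpa using h3

/-- Words which are equal or differ by an elementary transformation. -/
def ChargeMove (m : ℕ) (v v' : List ℕ) : Prop :=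
  v = v' ∨ ∃ p K K' q, ChargeCore m K K' ∧ v = p ++ (K ++ q) ∧ v' = p ++ (K' ++ q)

/-- States of the cyclic reading which are obtained from each other by an elementary transformation
of one of the two factors. -/
def StateMove (m : ℕ) (s r s' r' : List ℕ) : Prop :=
  ∃ p K K' q, ChargeCore m K K' ∧
    ((s = s' ∧ r = p ++ (K ++ q) ∧ r' = p ++ (K' ++ q)) ∨
      (r = r' ∧ s = p ++ (K ++ q) ∧ s' = p ++ (K' ++ q)))

theorem StateMove.chargeMove {m : ℕ} {s r s' r' : List ℕ} (h : StateMove m s r s' r') :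
    ChargeMove m (s ++ r) (s' ++ r') := by
  obtain ⟨p, K, K', q, hK, ⟨rfl, rfl, rfl⟩ | ⟨rfl, rfl, rfl⟩⟩ := h
  · exact .inr ⟨s ++ p, K, K', q, hK, by simp, by simp⟩
  · exact .inr ⟨p, K, K', q ++ r, hK, by simp, by simp⟩

/-- Induction on the letters still to be sought. A letter found outside the block leaves the block
whole on one side of the reading point; a letter found inside it makes both states continue
identically, by `ChargeCore.pick`; an absent letter ends the round. -/
theorem StateMove.chargeRound {m : ℕ} : ∀ (n x l : ℕ) {s r s' r' : List ℕ},
    StateMove m s r s' r' → x + n = m →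
    (chargeRound (List.range' x n) l s r).1 = (chargeRound (List.range' x n) l s' r').1 ∧
      ChargeMove m (chargeRound (List.range' x n) l s r).2
        (chargeRound (List.range' x n) l s' r').2
  | 0, x, l, s, r, s', r', h, hn => by simpa [MSymmetric.chargeRound] using h.chargeMove
  | n + 1, x, l, s, r, s', r', h, hn => by
    have ih (l : ℕ) {s r s' r' : List ℕ} (h : StateMove m s r s' r') :=
      StateMove.chargeRound n (x + 1) l h (by omega)
    rw [List.range'_succ]
    have h0 := h
    obtain ⟨p, K, K', q, hK, ⟨rfl, rfl, rfl⟩ | ⟨rfl, rfl, rfl⟩⟩ := h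
    · by_cases hp : x ∈ p
      · obtain ⟨p1, p2, rfl, h1⟩ := List.eq_append_cons_of_mem hp
        have := ih l (s := s ++ p1) (r := p2 ++ (K ++ q)) (s' := s ++ p1) (r' := p2 ++ (K' ++ q))
          ⟨p2, K, K', q, hK, .inl ⟨rfl, rfl, rfl⟩⟩
        rw [List.append_assoc, List.append_assoc, List.cons_append, List.cons_append,
          chargeRound_rest h1, chargeRound_rest h1]
        exact ⟨by rw [this.1], this.2⟩
      by_cases hxK : x ∈ K
      · obtain ⟨A, B, A', B', rfl, rfl, hA, hA', he⟩ := hK.pick hxK (n := n) (by omega)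
        have e1 : p ++ ((A ++ x :: B) ++ q) = (p ++ A) ++ x :: (B ++ q) := by simp
        have e2 : p ++ ((A' ++ x :: B') ++ q) = (p ++ A') ++ x :: (B' ++ q) := by simp
        rw [e1, e2, chargeRound_rest (by simp [hp, hA]), chargeRound_rest (by simp [hp, hA']),
          ← List.append_assoc, ← List.append_assoc, he]
        exact ⟨rfl, .inl rfl⟩
      have hxK' : x ∉ K' := fun h => hxK ((hK.mem_iff x).mpr h)
      by_cases hq : x ∈ q
      · obtain ⟨q1, q2, rfl, h1⟩ := List.eq_append_cons_of_mem hq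
        have := ih l (s := s ++ (p ++ (K ++ q1))) (r := q2) (s' := s ++ (p ++ (K' ++ q1))) (r' := q2)
          ⟨s ++ p, K, K', q1, hK, .inr ⟨rfl, by simp, by simp⟩⟩
        have e1 : p ++ (K ++ (q1 ++ x :: q2)) = (p ++ (K ++ q1)) ++ x :: q2 := by simp
        have e2 : p ++ (K' ++ (q1 ++ x :: q2)) = (p ++ (K' ++ q1)) ++ x :: q2 := by simp
        rw [e1, e2, chargeRound_rest (by simp [*]), chargeRound_rest (by simp [*])]
        exact ⟨by rw [this.1], this.2⟩
      by_cases hs : x ∈ s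
      · obtain ⟨s1, s2, rfl, h1⟩ := List.eq_append_cons_of_mem hs
        have := ih (l + 1) (s := s1) (r := s2 ++ (p ++ (K ++ q))) (s' := s1)
          (r' := s2 ++ (p ++ (K' ++ q))) ⟨s2 ++ p, K, K', q, hK, .inl ⟨rfl, by simp, by simp⟩⟩
        rw [chargeRound_seen h1 (by simp [*]), chargeRound_seen h1 (by simp [*])]
        exact ⟨by rw [this.1], this.2⟩
      rw [chargeRound_none hs (by simp [*]), chargeRound_none hs (by simp [*])]
      exact ⟨rfl, h0.chargeMove⟩
    · by_cases hr : x ∈ r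
      · obtain ⟨r1, r2, rfl, h1⟩ := List.eq_append_cons_of_mem hr
        have := ih l (s := (p ++ (K ++ q)) ++ r1) (r := r2) (s' := (p ++ (K' ++ q)) ++ r1) (r' := r2)
          ⟨p, K, K', q ++ r1, hK, .inr ⟨rfl, by simp, by simp⟩⟩
        rw [chargeRound_rest h1, chargeRound_rest h1]
        exact ⟨by rw [this.1], this.2⟩
      by_cases hp : x ∈ p
      · obtain ⟨p1, p2, rfl, h1⟩ := List.eq_append_cons_of_mem hp
        have := ih (l + 1) (s := p1) (r := (p2 ++ (K ++ q)) ++ r) (s' := p1)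
          (r' := (p2 ++ (K' ++ q)) ++ r) ⟨p2, K, K', q ++ r, hK, .inl ⟨rfl, by simp, by simp⟩⟩
        rw [List.append_assoc, List.append_assoc, List.cons_append, List.cons_append,
          chargeRound_seen h1 hr, chargeRound_seen h1 hr]
        exact ⟨by rw [this.1], this.2⟩
      by_cases hxK : x ∈ K
      · obtain ⟨A, B, A', B', rfl, rfl, hA, hA', he⟩ := hK.pick hxK (n := n) (by omega)
        have e1 : p ++ ((A ++ x :: B) ++ q) = (p ++ A) ++ x :: (B ++ q) := by simp
        have e2 : p ++ ((A' ++ x :: B') ++ q) = (p ++ A') ++ x :: (B' ++ q) := by simp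
        rw [e1, e2, chargeRound_seen (by simp [hp, hA]) hr, chargeRound_seen (by simp [hp, hA']) hr,
          List.append_assoc B, List.append_assoc B', he]
        exact ⟨rfl, .inl rfl⟩
      have hxK' : x ∉ K' := fun h => hxK ((hK.mem_iff x).mpr h)
      by_cases hq : x ∈ q
      · obtain ⟨q1, q2, rfl, h1⟩ := List.eq_append_cons_of_mem hq
        have := ih (l + 1) (s := p ++ (K ++ q1)) (r := q2 ++ r) (s' := p ++ (K' ++ q1))
          (r' := q2 ++ r) ⟨p, K, K', q1, hK, .inr ⟨rfl, rfl, rfl⟩⟩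
        have e1 : p ++ (K ++ (q1 ++ x :: q2)) = (p ++ (K ++ q1)) ++ x :: q2 := by simp
        have e2 : p ++ (K' ++ (q1 ++ x :: q2)) = (p ++ (K' ++ q1)) ++ x :: q2 := by simp
        rw [e1, e2, chargeRound_seen (by simp [*]) hr, chargeRound_seen (by simp [*]) hr]
        exact ⟨by rw [this.1], this.2⟩
      rw [chargeRound_none (by simp [*]) hr, chargeRound_none (by simp [*]) hr]
      exact ⟨rfl, h0.chargeMove⟩

theorem ChargeMove.chargeRounds {m : ℕ} : ∀ (n : ℕ) {v v' : List ℕ}, ChargeMove m v v' →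
    chargeRounds m n v = chargeRounds m n v'
  | 0, _, _, _ => rfl
  | n + 1, v, v', h => by
    rcases h with rfl | ⟨p, K, K', q, hK, h1, h2⟩
    · rfl
    · have := StateMove.chargeRound m 0 0 (s := []) (s' := [])
        ⟨p, K, K', q, hK, .inl ⟨rfl, h1, h2⟩⟩ (by omega)
      rw [← List.range_eq_range'] at this
      simp only [MSymmetric.chargeRounds]
      rw [this.1, ChargeMove.chargeRounds n this.2]

theorem KnuthStep.exists_context {w w' : List ℕ} (h : KnuthStep w w') : ∃ u v x y z,
    (x ≤ y ∧ y < z ∧ w = u ++ x :: z :: y :: v ∧ w' = u ++ z :: x :: y :: v) ∨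
    (x < y ∧ y ≤ z ∧ w = u ++ y :: z :: x :: v ∧ w' = u ++ y :: x :: z :: v) := by
  induction h with
  | left x y z v h1 h2 => exact ⟨[], v, x, y, z, .inl ⟨h1, h2, rfl, rfl⟩⟩
  | right x y z v h1 h2 => exact ⟨[], v, x, y, z, .inr ⟨h1, h2, rfl, rfl⟩⟩
  | cons a _ ih =>
    obtain ⟨u, v, x, y, z, ⟨h1, h2, rfl, rfl⟩ | ⟨h1, h2, rfl, rfl⟩⟩ := ih
    · exact ⟨a :: u, v, x, y, z, .inl ⟨h1, h2, rfl, rfl⟩⟩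
    · exact ⟨a :: u, v, x, y, z, .inr ⟨h1, h2, rfl, rfl⟩⟩

/-- A Knuth move exchanges `x < z` next to a witness `y`. If `x + 1 < z` the labelling does not
depend on their order, with or without a witness; if `z = x + 1`, the witness equals one of them and
the move is one of the two other core moves. The words are reversed since the charge is read from
the right. -/
theorem KnuthStep.chargeMove {m : ℕ} {w w' : List ℕ} (h : KnuthStep w w') (hw : ∀ x ∈ w, x < m) :
    ChargeMove m w.reverse w'.reverse := by
  obtain ⟨u, v, x, y, z, ⟨h1, h2, rfl, rfl⟩ | ⟨h1, h2, rfl, rfl⟩⟩ := h.exists_context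
  · have hz : z < m := hw z (by simp)
    by_cases hxz : x + 1 < z
    · exact .inr ⟨v.reverse ++ [y], [z, x], [x, z], u.reverse, .swap _ _ (.inr hxz), by simp,
        by simp⟩
    · obtain rfl : z = x + 1 := by omega
      obtain rfl : y = x := by omega
      exact .inr ⟨v.reverse, _, _, u.reverse, .low y hz, by simp, by simp⟩
  · have hz : z < m := hw z (by simp)
    by_cases hxz : x + 1 < z
    · exact .inr ⟨v.reverse, [x, z], [z, x], [y] ++ u.reverse, .swap _ _ (.inl hxz), by simp,
        by simp⟩
    · obtain rfl : z = x + 1 := by omega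
      obtain rfl : y = x + 1 := by omega
      exact .inr ⟨v.reverse, _, _, u.reverse, .high x hz, by simp, by simp⟩

theorem Plactic.chargeRounds {m : ℕ} (n : ℕ) {w w' : List ℕ} (h : Plactic w w')
    (hw : ∀ x ∈ w, x < m) : chargeRounds m n w.reverse = chargeRounds m n w'.reverse := by
  induction h with
  | rel _ _ h => exact (h.chargeMove hw).chargeRounds n
  | refl _ => rfl
  | symm _ _ h ih => exact (ih fun x hx => hw x ((Plactic.perm h).mem_iff.mp hx)).symm
  | trans _ _ _ h _ ih1 ih2 =>
    exact (ih1 hw).trans (ih2 fun x hx => hw x ((Plactic.perm h).mem_iff.mpr hx))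

theorem lt_of_mem_raiseFirst {m i : ℕ} (hi : i < m) : ∀ (k : ℕ) (w : List ℕ), (∀ x ∈ w, x < m) →
    ∀ x ∈ raiseFirst i k w, x < m
  | _, [], _ => by simp [raiseFirst]
  | k, a :: v, h => by
    intro x hx
    have hv : ∀ x ∈ v, x < m := fun x hx => h x (List.mem_cons_of_mem _ hx)
    simp only [raiseFirst] at hx
    split_ifs at hx <;> rcases List.mem_cons.mp hx with rfl | hx
    · exact hi
    · exact lt_of_mem_raiseFirst hi _ v hv x hx
    · exact h _ (by simp)
    · exact lt_of_mem_raiseFirst hi _ v hv x hx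

theorem lt_of_mem_sortPass {m : ℕ} {w : List ℕ} (hw : ∀ x ∈ w, x < m) :
    ∀ x ∈ sortPass m w, x < m := by
  unfold sortPass
  have hl : ∀ i ∈ List.range (m - 1), i < m := fun i hi => by
    have := List.mem_range.mp hi; omega
  generalize List.range (m - 1) = L at hl
  induction L generalizing w with
  | nil => exact hw
  | cons i l ih =>
    rw [List.foldl_cons]
    refine ih ?_ fun j hj => hl j (List.mem_cons_of_mem _ hj)
    split_ifs with hc
    · rw [sigmaWord_eq_raiseFirst i w hc.le]
      exact lt_of_mem_raiseFirst (hl i (by simp)) _ w hw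
    · exact hw

theorem lt_of_mem_dominantWord {m : ℕ} {w : List ℕ} (hw : ∀ x ∈ w, x < m) :
    ∀ x ∈ dominantWord m w, x < m := by
  have key (k : ℕ) : ∀ x ∈ (sortPass m)^[k] w, x < m := by
    induction k with
    | zero => exact hw
    | succ k ih =>
      rw [Function.iterate_succ_apply']
      exact lt_of_mem_sortPass ih
  exact key m

/-- Invariance is needed twice: sorting the evaluation preserves equivalence, and the labelling of
the sorted words gives equal sums. -/
theorem Plactic.wordCharge {m : ℕ} {w w' : List ℕ} (h : Plactic w w') (hw : ∀ x ∈ w, x < m) :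
    wordCharge m w = wordCharge m w' := by
  rw [MSymmetric.wordCharge, MSymmetric.wordCharge, ← h.perm.length_eq]
  exact (h.dominantWord m).chargeRounds _ (lt_of_mem_dominantWord hw)

/-! ## Words of columns -/

/-- The strictly decreasing word of the letters `x < m` with `P x`. -/
def colWord (m : ℕ) (P : ℕ → Bool) : List ℕ := (List.range m).reverse.filter P

/-- The concatenation of the words of a list of columns. -/
def colsWord (m : ℕ) (Ps : List (ℕ → Bool)) : List ℕ := Ps.flatMap (colWord m)

theorem mem_colWord {m : ℕ} {P : ℕ → Bool} {x : ℕ} : x ∈ colWord m P ↔ x < m ∧ P x = true := by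
  simp [colWord]

theorem nodup_colWord (m : ℕ) (P : ℕ → Bool) : (colWord m P).Nodup :=
  (List.nodup_reverse.mpr List.nodup_range).filter _

theorem count_colWord {m i : ℕ} (hi : i < m) (P : ℕ → Bool) :
    (colWord m P).count i = if P i then 1 else 0 := by
  split_ifs with h
  · exact List.count_eq_one_of_mem (nodup_colWord m P) (mem_colWord.mpr ⟨hi, h⟩)
  · exact List.count_eq_zero.mpr fun h' => h (mem_colWord.mp h').2

theorem count_colsWord {m i : ℕ} (hi : i < m) (Ps : List (ℕ → Bool)) :
    (colsWord m Ps).count i = Ps.countP (· i) := by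
  induction Ps with
  | nil => rfl
  | cons P Ps ih =>
    rw [colsWord, List.flatMap_cons, List.count_append, count_colWord hi, ← colsWord, ih,
      List.countP_cons, add_comm]

/-- The outer factors are chosen once for all columns that agree with `P` off `i` and `i + 1`, so
that they also serve the column in which these two letters are exchanged. -/
theorem colWord_split {m i : ℕ} (hi : i + 1 < m) (P : ℕ → Bool) : ∃ A C : List ℕ,
    (∀ x ∈ A, x ≠ i ∧ x ≠ i + 1) ∧ (∀ x ∈ C, x ≠ i ∧ x ≠ i + 1) ∧
    ∀ Q : ℕ → Bool, (∀ x, x ≠ i → x ≠ i + 1 → Q x = P x) → colWord m Q =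
      A ++ ((if Q (i + 1) then [i + 1] else []) ++ (if Q i then [i] else [])) ++ C := by
  obtain ⟨r, rfl⟩ := Nat.exists_eq_add_of_lt hi
  refine ⟨(((List.range r).map (fun x => i + 2 + x)).reverse).filter P,
    (List.range i).reverse.filter P, ?_, ?_, fun Q hQ => ?_⟩
  · simp; intro x _ _; omega
  · simp; intro x _ _; omega
  · have h1 : i + 1 + r + 1 = (i + 2) + r := by omega
    rw [colWord, h1, List.range_add, List.range_succ, List.range_succ]
    simp only [List.reverse_append, List.filter_append, List.append_assoc, List.reverse_cons,
      List.reverse_nil, List.nil_append]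
    congr 1
    · apply List.filter_congr
      intro x hx
      simp at hx
      obtain ⟨a, _, rfl⟩ := hx
      exact hQ _ (by omega) (by omega)
    · congr 1
      · cases h : Q (i + 1) <;> simp [h]
      · congr 1
        · cases h : Q i <;> simp [h]
        · apply List.filter_congr
          intro x hx
          simp at hx
          exact hQ _ (by omega) (by omega)

theorem unmatchedLow_append {i : ℕ} {A : List ℕ} (hA : ∀ x ∈ A, x ≠ i ∧ x ≠ i + 1) (v : List ℕ) :
    unmatchedLow i (A ++ v) = unmatchedLow i v := by
  induction A with
  | nil => rfl
  | cons a A ih =>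
    have ha := hA a (by simp)
    simp [unmatchedLow, ha.1, ha.2, ih fun x hx => hA x (List.mem_cons_of_mem _ hx)]

theorem raiseFirst_append {i : ℕ} {A : List ℕ} (hA : ∀ x ∈ A, x ≠ i ∧ x ≠ i + 1) (k : ℕ)
    (v : List ℕ) : raiseFirst i k (A ++ v) = A ++ raiseFirst i k v := by
  induction A with
  | nil => rfl
  | cons a A ih =>
    have ha := hA a (by simp)
    simp [raiseFirst, ha.2, ih fun x hx => hA x (List.mem_cons_of_mem _ hx)]

/-- The number of unmatched letters `i` of the word of a list of columns. -/
def colsLow (i : ℕ) : List (ℕ → Bool) → ℕ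
  | [] => 0
  | P :: Ps => if P i then (if P (i + 1) then colsLow i Ps else colsLow i Ps + 1)
      else if P (i + 1) then colsLow i Ps - 1 else colsLow i Ps

/-- The list of columns in which the first `k` unmatched letters `i + 1` are replaced by `i`. -/
def colsRaise (i : ℕ) : ℕ → List (ℕ → Bool) → List (ℕ → Bool)
  | _, [] => []
  | k, P :: Ps => if P (i + 1) = true ∧ P i = false ∧ colsLow i Ps = 0 ∧ 0 < k then
        (P ∘ Equiv.swap i (i + 1)) :: colsRaise i (k - 1) Ps
      else P :: colsRaise i k Ps

theorem unmatchedLow_colsWord {m i : ℕ} (hi : i + 1 < m) (Ps : List (ℕ → Bool)) :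
    unmatchedLow i (colsWord m Ps) = colsLow i Ps := by
  induction Ps with
  | nil => rfl
  | cons P Ps ih =>
    obtain ⟨A, C, hA, hC, h⟩ := colWord_split hi P
    rw [colsWord, List.flatMap_cons, ← colsWord, h P fun _ _ _ => rfl, List.append_assoc,
      List.append_assoc, unmatchedLow_append hA, colsLow]
    cases P i <;> cases P (i + 1) <;> simp [unmatchedLow, unmatchedLow_append hC, ih]

/-- In a column containing both letters they stand side by side as `i + 1, i` and are matched with
each other. An unmatched `i + 1` therefore lies in a column without `i`, and replacing it gives a
column again. -/
theorem raiseFirst_colsWord {m i : ℕ} (hi : i + 1 < m) : ∀ (Ps : List (ℕ → Bool)) (k : ℕ),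
    raiseFirst i k (colsWord m Ps) = colsWord m (colsRaise i k Ps)
  | [], k => by simp [colsWord, colsRaise, raiseFirst]
  | P :: Ps, k => by
    have ih := raiseFirst_colsWord hi Ps
    obtain ⟨A, C, hA, hC, h⟩ := colWord_split hi P
    have hl := unmatchedLow_colsWord hi Ps
    have h0 : colWord m P = _ := h P fun _ _ _ => rfl
    have h1 := h (P ∘ Equiv.swap i (i + 1)) fun x hx hx' => by
      simp [Equiv.swap_apply_of_ne_of_ne hx hx']
    simp only [colsWord] at hl ih
    rw [colsWord, List.flatMap_cons, h0, List.append_assoc, List.append_assoc,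
      raiseFirst_append hA, colsRaise]
    cases hPi : P i <;> cases hPi' : P (i + 1)
    · simp [raiseFirst_append hC, ih, colsWord, h0, hPi, hPi']
    · by_cases hc : colsLow i Ps = 0 ∧ 0 < k
      · simp [raiseFirst_append hC, unmatchedLow_append hC, ih, colsWord, h1, hPi, hPi', hc.1, hc.2,
          raiseFirst, hl]
      · simp [raiseFirst_append hC, unmatchedLow_append hC, ih, colsWord, h0, hPi, hPi', hc,
          raiseFirst, hl]
    · simp [raiseFirst_append hC, ih, colsWord, h0, hPi, hPi', raiseFirst]
    · simp [raiseFirst_append hC, ih, colsWord, h0, hPi, hPi', raiseFirst, unmatchedLow]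

/-- One step of the bubble sort of the evaluation of a list of columns. -/
def colsStep (Ps : List (ℕ → Bool)) (i : ℕ) : List (ℕ → Bool) :=
  if Ps.countP (· i) < Ps.countP (· (i + 1)) then
    colsRaise i (Ps.countP (· (i + 1)) - Ps.countP (· i)) Ps else Ps

/-- One pass of the bubble sort of the evaluation of a list of columns. -/
def colsPass (m : ℕ) (Ps : List (ℕ → Bool)) : List (ℕ → Bool) :=
  (List.range (m - 1)).foldl colsStep Ps

theorem sortPass_colsWord (m : ℕ) (Ps : List (ℕ → Bool)) :
    sortPass m (colsWord m Ps) = colsWord m (colsPass m Ps) := by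
  unfold sortPass colsPass
  have hl : ∀ i ∈ List.range (m - 1), i + 1 < m := fun i hi => by
    have := List.mem_range.mp hi; omega
  generalize List.range (m - 1) = L at hl
  induction L generalizing Ps with
  | nil => rfl
  | cons i l ih =>
    have hi := hl i (by simp)
    rw [List.foldl_cons, List.foldl_cons, ← ih _ fun j hj => hl j (List.mem_cons_of_mem _ hj)]
    congr 1
    rw [colsStep, ← count_colsWord (Nat.lt_of_succ_lt hi) Ps, ← count_colsWord hi Ps]
    split_ifs with hc
    · rw [sigmaWord_eq_raiseFirst i _ hc.le, raiseFirst_colsWord hi]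
    · rfl

theorem dominantWord_colsWord (m n : ℕ) (Ps : List (ℕ → Bool)) :
    (sortPass m)^[n] (colsWord m Ps) = colsWord m ((colsPass m)^[n] Ps) := by
  induction n with
  | zero => rfl
  | succ n ih => rw [Function.iterate_succ_apply', Function.iterate_succ_apply', ih,
      sortPass_colsWord]

/-! ### Insertion of a letter into all columns -/

/-- The column with the letter `x` inserted, the letters from `x` on being increased by one. -/
def insCol (x : ℕ) (P : ℕ → Bool) : ℕ → Bool :=
  fun l => if l < x then P l else if l = x then true else P (l - 1)

theorem colsLow_map {i i' : ℕ} {f : (ℕ → Bool) → ℕ → Bool} (h0 : ∀ P, f P i' = P i)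
    (h1 : ∀ P, f P (i' + 1) = P (i + 1)) (Ps : List (ℕ → Bool)) :
    colsLow i' (Ps.map f) = colsLow i Ps := by
  induction Ps with
  | nil => rfl
  | cons P Ps ih => simp [colsLow, h0, h1, ih]

/-- A sorting step only sees which columns contain the two letters concerned, so it commutes with
every map of columns that transports these two letters. -/
theorem colsStep_map {i i' : ℕ} {f : (ℕ → Bool) → ℕ → Bool} (h0 : ∀ P, f P i' = P i)
    (h1 : ∀ P, f P (i' + 1) = P (i + 1))
    (h2 : ∀ P, f P ∘ Equiv.swap i' (i' + 1) = f (P ∘ Equiv.swap i (i + 1)))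
    (Ps : List (ℕ → Bool)) : colsStep (Ps.map f) i' = (colsStep Ps i).map f := by
  have key (k : ℕ) : colsRaise i' k (Ps.map f) = (colsRaise i k Ps).map f := by
    induction Ps generalizing k with
    | nil => rfl
    | cons P Ps ih =>
      simp only [List.map_cons, colsRaise, h0, h1, colsLow_map h0 h1, ih, h2]
      split_ifs <;> simp
  simp only [colsStep, List.countP_map, Function.comp_def, h0, h1, key]
  split_ifs <;> rfl

theorem colsStep_insCol_of_lt {x i : ℕ} (h : i + 1 < x) (Ps : List (ℕ → Bool)) :
    colsStep (Ps.map (insCol x)) i = (colsStep Ps i).map (insCol x) := by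
  apply colsStep_map
  · intro P; simp [insCol]; omega
  · intro P; simp [insCol]; omega
  · intro P
    funext l
    simp only [insCol, Function.comp_apply, Equiv.swap_apply_def]
    grind

theorem colsStep_insCol_of_le {x i : ℕ} (h : x ≤ i) (Ps : List (ℕ → Bool)) :
    colsStep (Ps.map (insCol x)) (i + 1) = (colsStep Ps i).map (insCol x) := by
  apply colsStep_map
  · intro P
    rw [insCol, if_neg (by omega), if_neg (by omega), Nat.add_sub_cancel]
  · intro P
    rw [insCol, if_neg (by omega), if_neg (by omega), Nat.add_sub_cancel]
  · intro P
    funext l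
    simp only [insCol, Function.comp_apply, Equiv.swap_apply_def]
    grind

theorem colsStep_insCol_zero (Ps : List (ℕ → Bool)) :
    colsStep (Ps.map (insCol 0)) 0 = Ps.map (insCol 0) := by
  rw [colsStep, if_neg]
  rw [not_lt, List.countP_map, List.countP_map]
  apply List.countP_mono_left
  simp [insCol]

/-- The letter `x + 1` is in every column, so each `x` is matched within its own column, and the
unmatched letters are the `x + 1` of the columns without `x`. Their number is exactly the difference
of the multiplicities, so all of them become `x`, and now `x` is in every column. -/
theorem colsStep_insCol_succ (x : ℕ) (Ps : List (ℕ → Bool)) :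
    colsStep (Ps.map (insCol (x + 1))) x = Ps.map (insCol x) := by
  have hswap (P : ℕ → Bool) (hP : P x = false) :
      insCol (x + 1) P ∘ Equiv.swap x (x + 1) = insCol x P := by
    funext l
    simp only [insCol, Function.comp_apply, Equiv.swap_apply_def]
    grind
  have hid (P : ℕ → Bool) (hP : P x = true) : insCol (x + 1) P = insCol x P := by
    funext l
    simp only [insCol]
    grind
  have hlow (Ps : List (ℕ → Bool)) : colsLow x (Ps.map (insCol (x + 1))) = 0 := by
    induction Ps with
    | nil => rfl
    | cons P Ps ih => simp [colsLow, ih, insCol]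
  have hc1 : (Ps.map (insCol (x + 1))).countP (· (x + 1)) = Ps.length := by
    rw [List.countP_map, List.countP_eq_length]
    simp [insCol]
  have hc0 : (Ps.map (insCol (x + 1))).countP (· x) = Ps.countP (· x) := by
    rw [List.countP_map]
    congr 1
    funext P
    simp [insCol]
  have key (Ps : List (ℕ → Bool)) : colsRaise x (Ps.length - Ps.countP (· x))
      (Ps.map (insCol (x + 1))) = Ps.map (insCol x) := by
    induction Ps with
    | nil => rfl
    | cons P Ps ih =>
      have hle := List.countP_le_length (p := (· x)) (l := Ps)
      rw [List.map_cons, List.map_cons, colsRaise, List.length_cons, List.countP_cons]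
      cases hP : P x
      · have e : Ps.length + 1 - List.countP (· x) Ps - 1 = Ps.length - List.countP (· x) Ps := by
          omega
        rw [if_pos ⟨by simp [insCol], by simp [insCol, hP], hlow Ps, by simp; omega⟩]
        simp only [Bool.false_eq_true, if_false, add_zero]
        rw [e, ih, hswap P hP]
      · rw [if_neg (by simp [insCol, hP]), hid P hP]
        simp only [if_true]
        rw [Nat.add_sub_add_right, ih]
  rw [colsStep, hc0, hc1]
  split_ifs with h
  · exact key Ps
  · have h' : Ps.length - Ps.countP (· x) = 0 := by omega
    have := key Ps
    rw [h'] at this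
    rw [← this]
    have hz (Qs : List (ℕ → Bool)) : colsRaise x 0 Qs = Qs := by
      induction Qs with
      | nil => rfl
      | cons Q Qs ih => simp [colsRaise, ih]
    rw [hz]

theorem foldl_colsStep_insCol_of_le {x : ℕ} (n : ℕ) {y : ℕ} (h : x ≤ y) (Ps : List (ℕ → Bool)) :
    (List.range' (y + 1) n).foldl colsStep (Ps.map (insCol x)) =
      ((List.range' y n).foldl colsStep Ps).map (insCol x) := by
  induction n generalizing y Ps with
  | zero => rfl
  | succ n ih =>
    rw [List.range'_succ, List.range'_succ, List.foldl_cons, List.foldl_cons,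
      colsStep_insCol_of_le h, ih (by omega)]

theorem foldl_colsStep_insCol_of_lt {x : ℕ} {n : ℕ} (h : n < x) (Ps : List (ℕ → Bool)) :
    (List.range n).foldl colsStep (Ps.map (insCol x)) =
      ((List.range n).foldl colsStep Ps).map (insCol x) := by
  induction n with
  | zero => rfl
  | succ n ih =>
    rw [List.range_succ, List.foldl_append, List.foldl_append, ih (by omega)]
    exact colsStep_insCol_of_lt h _

/-- During a pass the steps below the full letter commute with the insertion, one step moves the
full letter down by one, and the later steps are the remaining steps of the smaller alphabet with
shifted index. A full letter `0` stays where it is, in agreement with truncated subtraction. -/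
theorem colsPass_insCol {m x : ℕ} (hx : x ≤ m) (Ps : List (ℕ → Bool)) :
    colsPass (m + 1) (Ps.map (insCol x)) = (colsPass m Ps).map (insCol (x - 1)) := by
  unfold colsPass
  rw [Nat.add_sub_cancel]
  rcases x with _ | x
  · rcases m with _ | m
    · rfl
    · rw [List.range_eq_range', List.range'_succ, List.foldl_cons, colsStep_insCol_zero,
        foldl_colsStep_insCol_of_le m (Nat.zero_le _), ← List.range_eq_range']
      simp
  · obtain ⟨r, rfl⟩ := Nat.exists_eq_add_of_le hx
    have e1 : List.range (x + 1 + r) = List.range x ++ x :: List.range' (x + 1) r := by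
      have := List.range'_append (s := 0) (m := x) (n := r + 1) (step := 1)
      simp only [Nat.zero_add, Nat.one_mul] at this
      rw [← List.range'_succ, List.range_eq_range', List.range_eq_range', this]
      congr 1; omega
    have e2 : List.range (x + 1 + r - 1) = List.range x ++ List.range' x r := by
      rw [List.range_eq_range', List.range_eq_range']
      have : x + 1 + r - 1 = x + r := by omega
      rw [this, ← List.range'_append]
      simp
    rw [e1, e2, List.foldl_append, List.foldl_cons, List.foldl_append,
      foldl_colsStep_insCol_of_lt (Nat.lt_succ_self x), colsStep_insCol_succ,
      foldl_colsStep_insCol_of_le r le_rfl]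
    simp

theorem iterate_colsPass_insCol {m x : ℕ} (hx : x ≤ m) (n : ℕ) (Ps : List (ℕ → Bool)) :
    (colsPass (m + 1))^[n] (Ps.map (insCol x)) = ((colsPass m)^[n] Ps).map (insCol (x - n)) := by
  induction n with
  | zero => rfl
  | succ n ih =>
    rw [Function.iterate_succ_apply', Function.iterate_succ_apply', ih, colsPass_insCol (by omega)]
    congr 2

/-! ### Bubble sort -/

theorem count_raiseFirst (i : ℕ) : ∀ (k : ℕ) (w : List ℕ),
    (raiseFirst i k w).count i = w.count i + min k (unmatchedHigh i w) ∧
    (raiseFirst i k w).count (i + 1) + min k (unmatchedHigh i w) = w.count (i + 1) ∧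
    ∀ j, j ≠ i → j ≠ i + 1 → (raiseFirst i k w).count j = w.count j
  | k, [] => by simp [raiseFirst, unmatchedHigh]
  | k, a :: v => by
    have h1 := count_raiseFirst i k v
    have h2 := count_raiseFirst i (k - 1) v
    simp only [raiseFirst, unmatchedHigh]
    refine ⟨?_, ?_, fun j hj hj' => ?_⟩
    · split_ifs <;> simp only [List.count_cons, beq_iff_eq] <;> split_ifs <;> omega
    · split_ifs <;> simp only [List.count_cons, beq_iff_eq] <;> split_ifs <;> omega
    · have e1 := h1.2.2 j hj hj'
      have e2 := h2.2.2 j hj hj'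
      split_ifs <;> simp only [List.count_cons, beq_iff_eq] <;> split_ifs <;> omega

theorem count_sigmaWord (i : ℕ) (w : List ℕ) (h : w.count i ≤ w.count (i + 1)) (j : ℕ) :
    (sigmaWord i w).count j = w.count (Equiv.swap i (i + 1) j) := by
  have hc := count_add_unmatchedLow i w
  obtain ⟨h1, h2, h3⟩ := count_raiseFirst i (w.count (i + 1) - w.count i) w
  rw [sigmaWord_eq_raiseFirst i w h]
  rcases eq_or_ne j i with rfl | hj
  · rw [Equiv.swap_apply_left]; omega
  rcases eq_or_ne j (i + 1) with rfl | hj'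
  · rw [Equiv.swap_apply_right]; omega
  · rw [Equiv.swap_apply_of_ne_of_ne hj hj', h3 j hj hj']

/-- From the letter `q` on, each letter occurs at most as often as each smaller one. -/
def SortedFrom (m q : ℕ) (w : List ℕ) : Prop :=
  ∀ i j, i < j → j < m → q ≤ j → w.count j ≤ w.count i

/-- As in bubble sort, the current position carries the least multiplicity met so far until it
reaches `q - 1`; from there on the evaluation is already sorted and no step acts. -/
theorem SortedFrom.sortPass {m q : ℕ} {w : List ℕ} (h : SortedFrom m q w) :
    SortedFrom m (q - 1) (sortPass m w) := by
  have key (p : ℕ) (hp : p ≤ m - 1) :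
      let v := (List.range p).foldl
        (fun v i => if v.count i < v.count (i + 1) then sigmaWord i v else v) w
      SortedFrom m q v ∧ ∀ i < min p (q - 1), v.count (min p (q - 1)) ≤ v.count i := by
    induction p with
    | zero => exact ⟨h, fun i hi => by omega⟩
    | succ p ih =>
      obtain ⟨h1, h2⟩ := ih (by omega)
      rw [List.range_succ]
      simp only [List.foldl_append, List.foldl_cons, List.foldl_nil]
      generalize (List.range p).foldl
        (fun v i => if v.count i < v.count (i + 1) then sigmaWord i v else v) w = v at h1 h2
      by_cases hc : v.count p < v.count (p + 1)
      · rw [if_pos hc]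
        have hpq : p + 1 < q := by
          by_contra hpq
          have := h1 p (p + 1) (by omega) (by omega) (by omega)
          omega
        have e := count_sigmaWord p v hc.le
        rw [Nat.min_eq_left (by omega)] at h2 ⊢
        constructor
        · intro i j hij hj hqj
          rw [e, e, Equiv.swap_apply_of_ne_of_ne (by omega) (by omega)]
          apply h1 _ _ _ hj hqj
          rw [Equiv.swap_apply_def]
          split_ifs <;> omega
        · intro i hi
          rw [e, e, Equiv.swap_apply_right]
          rcases eq_or_ne i p with rfl | hip
          · rw [Equiv.swap_apply_left]; omega
          · rw [Equiv.swap_apply_of_ne_of_ne hip (by omega)]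
            exact h2 i (by omega)
      · rw [if_neg hc]
        refine ⟨h1, fun i hi => ?_⟩
        rcases Nat.lt_or_ge p (q - 1) with hpq | hpq
        · rw [Nat.min_eq_left (by omega)] at h2 hi ⊢
          rcases eq_or_ne i p with rfl | hip
          · omega
          · have := h2 i (by omega)
            omega
        · rw [Nat.min_eq_right (by omega)] at h2 hi ⊢
          exact h2 i hi
  obtain ⟨h1, h2⟩ := key (m - 1) le_rfl
  intro i j hij hj hqj
  rcases Nat.lt_or_ge j q with hjq | hjq
  · obtain rfl : j = q - 1 := by omega
    rw [Nat.min_eq_right (by omega)] at h2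
    exact h2 i hij
  · exact h1 i j hij hj hjq

theorem sortedFrom_dominantWord (m : ℕ) (w : List ℕ) : SortedFrom m 0 (dominantWord m w) := by
  have key (k : ℕ) : SortedFrom m (m - k) ((sortPass m)^[k] w) := by
    induction k with
    | zero => intro i j _ hj hqj; omega
    | succ k ih =>
      rw [Function.iterate_succ_apply']
      exact ih.sortPass
  have := key m
  rwa [Nat.sub_self] at this

/-- Makes additional passes harmless, so that alphabets with `m` and `m + 1` letters can be compared
after the same number of passes. -/
theorem sortPass_dominantWord (m : ℕ) (w : List ℕ) :
    sortPass m (dominantWord m w) = dominantWord m w := by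
  have h := sortedFrom_dominantWord m w
  generalize dominantWord m w = v at h
  unfold sortPass
  have hl : ∀ i ∈ List.range (m - 1), i + 1 < m := fun i hi => by
    have := List.mem_range.mp hi; omega
  generalize List.range (m - 1) = L at hl
  induction L with
  | nil => rfl
  | cons i l ih =>
    have hi := hl i (by simp)
    rw [List.foldl_cons, if_neg (by simpa using h i (i + 1) (by omega) hi (by omega))]
    exact ih fun j hj => hl j (List.mem_cons_of_mem _ hj)

/-! ### Removal of the smallest letter -/

/-- The word in which the letters `0` are removed and the other ones are decreased by one. -/
def dropZeros (w : List ℕ) : List ℕ := (w.filter (· ≠ 0)).map (· - 1)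

theorem dropZeros_append (u v : List ℕ) : dropZeros (u ++ v) = dropZeros u ++ dropZeros v := by
  simp [dropZeros]

theorem dropZeros_cons_succ (x : ℕ) (v : List ℕ) :
    dropZeros ((x + 1) :: v) = x :: dropZeros v := by
  simp [dropZeros]

theorem dropZeros_cons_zero (v : List ℕ) : dropZeros (0 :: v) = dropZeros v := by
  simp [dropZeros]

theorem mem_dropZeros {x : ℕ} {w : List ℕ} : x ∈ dropZeros w ↔ x + 1 ∈ w := by
  induction w with
  | nil => simp [dropZeros]
  | cons a w ih =>
    rcases a with _ | a
    · rw [dropZeros_cons_zero, ih]; simp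
    · rw [dropZeros_cons_succ, List.mem_cons, List.mem_cons, ih]; simp

theorem count_dropZeros (x : ℕ) (w : List ℕ) : (dropZeros w).count x = w.count (x + 1) := by
  induction w with
  | nil => simp [dropZeros]
  | cons a w ih =>
    rcases a with _ | a
    · rw [dropZeros_cons_zero, ih]; simp
    · rw [dropZeros_cons_succ, List.count_cons, List.count_cons, ih]; simp

theorem chargeRound_dropZeros : ∀ (n x l : ℕ) (s r : List ℕ),
    chargeRound (List.range' x n) l (dropZeros s) (dropZeros r) =
      ((chargeRound (List.range' (x + 1) n) l s r).1,
        dropZeros (chargeRound (List.range' (x + 1) n) l s r).2)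
  | 0, x, l, s, r => by simp [chargeRound, dropZeros_append]
  | n + 1, x, l, s, r => by
    rw [List.range'_succ, List.range'_succ]
    by_cases hr : x + 1 ∈ r
    · obtain ⟨p, q, rfl, hp⟩ := List.eq_append_cons_of_mem hr
      rw [chargeRound_rest hp, dropZeros_append, dropZeros_cons_succ,
        chargeRound_rest (by rwa [mem_dropZeros]), ← dropZeros_append, chargeRound_dropZeros n]
    by_cases hs : x + 1 ∈ s
    · obtain ⟨p, q, rfl, hp⟩ := List.eq_append_cons_of_mem hs
      rw [chargeRound_seen hp hr, dropZeros_append, dropZeros_cons_succ,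
        chargeRound_seen (by rwa [mem_dropZeros]) (by rwa [mem_dropZeros]), ← dropZeros_append,
        chargeRound_dropZeros n]
    rw [chargeRound_none hs hr, chargeRound_none (by rwa [mem_dropZeros]) (by rwa [mem_dropZeros]),
      dropZeros_append]

theorem filter_chargeRound {f : ℕ → Bool} : ∀ {xs : List ℕ} (l : ℕ) (s r : List ℕ),
    (∀ x ∈ xs, f x = false) → (chargeRound xs l s r).2.filter f = (s ++ r).filter f
  | [], l, s, r, _ => by simp [chargeRound]
  | x :: xs, l, s, r, h => by
    have hx := h x (by simp)
    have ih (l : ℕ) (s r : List ℕ) := filter_chargeRound (xs := xs) l s r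
      fun y hy => h y (List.mem_cons_of_mem _ hy)
    by_cases hr : x ∈ r
    · obtain ⟨p, q, rfl, hp⟩ := List.eq_append_cons_of_mem hr
      rw [chargeRound_rest hp, ih]
      simp [hx]
    by_cases hs : x ∈ s
    · obtain ⟨p, q, rfl, hp⟩ := List.eq_append_cons_of_mem hs
      rw [chargeRound_seen hp hr, ih]
      simp [hx]
    rw [chargeRound_none hs hr]

theorem count_chargeRound {xs : List ℕ} {y : ℕ} (h : y ∉ xs) (l : ℕ) (s r : List ℕ) :
    (chargeRound xs l s r).2.count y = (s ++ r).count y := by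
  have := filter_chargeRound (f := (· == y)) (xs := xs) l s r
    fun x hx => by simpa using fun e : x = y => h (e ▸ hx)
  rw [List.count_eq_length_filter, List.count_eq_length_filter, this]

theorem chargeRounds_eq_zero {m : ℕ} {w : List ℕ} (h : m = 0 ∨ 0 ∉ w) (n : ℕ) :
    chargeRounds m n w = 0 := by
  have h1 : chargeRound (List.range m) 0 [] w = (0, w) := by
    rcases m with _ | m
    · simp [chargeRound]
    · rw [List.range_eq_range', List.range'_succ,
        chargeRound_none (by simp) (h.resolve_left (by omega))]
      simp
  induction n with
  | zero => rfl
  | succ n ih => simp [chargeRounds, h1, ih]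

/-- If the alphabet is nonempty, a round removes one letter `0` when there is one and does nothing
otherwise, so rounds beyond the number of zeros contribute nothing. -/
theorem chargeRounds_stable {m : ℕ} : ∀ (n n' : ℕ) (w : List ℕ), w.count 0 ≤ n → w.count 0 ≤ n' →
    chargeRounds m n w = chargeRounds m n' w := by
  have key (n : ℕ) : ∀ w : List ℕ, w.count 0 ≤ n → chargeRounds m (n + 1) w = chargeRounds m n w := by
    induction n with
    | zero =>
      intro w h
      have h0 : 0 ∉ w := List.count_eq_zero.mp (by omega)
      rw [chargeRounds_eq_zero (.inr h0), chargeRounds_eq_zero (.inr h0)]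
    | succ n ih =>
      intro w h
      rcases m with _ | m
      · rw [chargeRounds_eq_zero (.inl rfl), chargeRounds_eq_zero (.inl rfl)]
      by_cases h0 : 0 ∈ w
      · obtain ⟨p, q, rfl, hp⟩ := List.eq_append_cons_of_mem h0
        have e (k : ℕ) (u : List ℕ) : chargeRounds (m + 1) (k + 1) u =
          (chargeRound (List.range (m + 1)) 0 [] u).1 +
            chargeRounds (m + 1) k (chargeRound (List.range (m + 1)) 0 [] u).2 := rfl
        rw [e (n + 1), e n (p ++ 0 :: q), ih]
        rw [List.range_eq_range', List.range'_succ, chargeRound_rest hp,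
          count_chargeRound (by simp)]
        simp at h ⊢
        omega
      · rw [chargeRounds_eq_zero (.inr h0), chargeRounds_eq_zero (.inr h0)]
  have key' (w : List ℕ) (d : ℕ) : chargeRounds m (w.count 0 + d) w
      = chargeRounds m (w.count 0) w := by
    induction d with
    | zero => rfl
    | succ d ih => rw [← add_assoc, key _ w (by omega), ih]
  intro n n' w h h'
  obtain ⟨d, rfl⟩ := Nat.exists_eq_add_of_le h
  obtain ⟨d', rfl⟩ := Nat.exists_eq_add_of_le h'
  rw [key', key']

/-- Each prefix contains at most `b` more letters `1` than letters `0`. -/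
def Ballot : ℕ → List ℕ → Prop
  | _, [] => True
  | b, a :: v => if a = 0 then Ballot (b + 1) v else if a = 1 then 0 < b ∧ Ballot (b - 1) v
      else Ballot b v

theorem ballot_filter : ∀ (b : ℕ) (v : List ℕ), Ballot b (v.filter (· ≤ 1)) ↔ Ballot b v
  | _, [] => by simp
  | b, a :: v => by
    rcases a with _ | _ | a
    · simpa [Ballot] using ballot_filter (b + 1) v
    · simpa [Ballot] using fun _ => ballot_filter (b - 1) v
    · simpa [Ballot] using ballot_filter b v

theorem ballot_append {C : List ℕ} (hC : 1 ∉ C) : ∀ (b : ℕ) (v : List ℕ),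
    Ballot b (C ++ v) ↔ Ballot (b + C.count 0) v := by
  induction C with
  | nil => simp
  | cons a C ih =>
    intro b v
    have ih := ih fun h => hC (List.mem_cons_of_mem _ h)
    have ha : a ≠ 1 := fun h => hC (by simp [h])
    rcases eq_or_ne a 0 with rfl | h0
    · have e : b + (C.count 0 + 1) = b + 1 + C.count 0 := by omega
      simp [Ballot, ih, e]
    · simp [Ballot, ih, ha, h0]

/-- By the ballot condition the first `1` is preceded by a `0`, so the word is `A 0 C 1 D` with no
`0` in `A` and no `1` in `A` or `C`. The round takes these two letters with label `0` and continues
between `C` and `D`, exactly as the round of the word without zeros does after taking its first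
letter. When no `1` is left, both charges vanish. -/
theorem chargeRounds_dropZeros {m : ℕ} : ∀ (n n' : ℕ) (v : List ℕ), Ballot 0 v → v.count 0 ≤ n →
    v.count 1 ≤ n' → chargeRounds (m + 1) n v = chargeRounds m n' (dropZeros v) := by
  have hz (n : ℕ) : ∀ v : List ℕ, 1 ∉ v ∨ m = 0 → chargeRounds (m + 1) n v = 0 := by
    induction n with
    | zero => intro v _; rfl
    | succ n ih =>
      intro v h
      by_cases h0 : 0 ∈ v
      · obtain ⟨p, q, rfl, hp⟩ := List.eq_append_cons_of_mem h0
        have e : chargeRound (List.range (m + 1)) 0 [] (p ++ 0 :: q) = (0, p ++ q) := by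
          rw [List.range_eq_range', List.range'_succ, chargeRound_rest hp]
          rcases m with _ | m
          · simp [chargeRound]
          · simp at h
            rw [List.range'_succ, chargeRound_none (by simpa using h.1) (by simpa using h.2)]
            simp
        rw [chargeRounds]
        simp only [e, zero_add]
        exact ih _ (h.imp_left (by simp))
      · exact chargeRounds_eq_zero (.inr h0) _
  intro n
  induction n with
  | zero =>
    intro n' v hv h0 h1
    have h0 : 0 ∉ v := List.count_eq_zero.mp (by omega)
    have h1 : 1 ∉ v := fun h => by
      obtain ⟨p, q, rfl, hp⟩ := List.eq_append_cons_of_mem h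
      rw [ballot_append hp, List.count_eq_zero.mpr fun h' => h0 (by simp [h'])] at hv
      simp [Ballot] at hv
    rw [hz _ _ (.inl h1), chargeRounds_eq_zero (.inr (by rwa [mem_dropZeros]))]
  | succ n ih =>
    intro n' v hv h0 h1
    by_cases hm : m = 0
    · rw [hz _ _ (.inr hm), chargeRounds_eq_zero (.inl hm)]
    by_cases h1v : 1 ∈ v
    swap
    · rw [hz _ _ (.inl h1v), chargeRounds_eq_zero (.inr (by rwa [mem_dropZeros]))]
    obtain ⟨m, rfl⟩ := Nat.exists_eq_succ_of_ne_zero hm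
    obtain ⟨p, D, rfl, hp⟩ := List.eq_append_cons_of_mem h1v
    have hv' := hv
    rw [ballot_append hp, zero_add] at hv'
    simp only [Ballot, one_ne_zero, if_false, if_true] at hv'
    obtain ⟨A, C, rfl, hA⟩ := List.eq_append_cons_of_mem (List.count_pos_iff.mp hv'.1)
    have hA1 : 1 ∉ A := fun h => hp (by simp [h])
    have hC1 : 1 ∉ C := fun h => hp (by simp [h])
    obtain ⟨n', rfl⟩ : ∃ k, n' = k + 1 := ⟨n' - 1, by simp at h1; omega⟩
    have e1 : chargeRound (List.range (m + 1 + 1)) 0 [] (A ++ 0 :: C ++ 1 :: D) =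
        chargeRound (List.range' 2 m) 0 (A ++ C) D := by
      rw [List.append_assoc, List.cons_append, List.range_eq_range', List.range'_succ,
        chargeRound_rest hA, List.range'_succ, chargeRound_rest hC1]
      simp
    have e2 : chargeRound (List.range (m + 1)) 0 [] (dropZeros (A ++ 0 :: C ++ 1 :: D)) =
        chargeRound (List.range' 1 m) 0 (dropZeros (A ++ C)) (dropZeros D) := by
      have : dropZeros (A ++ 0 :: C ++ 1 :: D) = dropZeros (A ++ C) ++ 0 :: dropZeros D := by
        simp only [dropZeros_append, dropZeros_cons_zero]
        rw [← zero_add 1, dropZeros_cons_succ]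
      rw [this, List.range_eq_range', List.range'_succ, chargeRound_rest]
      · simp
      · rw [mem_dropZeros]; simp [hA1, hC1]
    rw [chargeRounds, chargeRounds]
    simp only [e1, e2, chargeRound_dropZeros]
    have c0 := count_chargeRound (xs := List.range' 2 m) (y := 0) (by simp) 0 (A ++ C) D
    have c1 := count_chargeRound (xs := List.range' 2 m) (y := 1) (by simp) 0 (A ++ C) D
    rw [ih n']
    -- The next word has lost its first `0` and its first `1`, in this order, and the remaining `0`
    -- and `1` have kept their order, so it is again a ballot word.
    · rw [← ballot_filter, filter_chargeRound _ _ _ (by simp; omega), ballot_filter,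
        ballot_append (by simp [hA1, hC1])]
      simpa [add_assoc] using hv'.2
    · rw [c0]; simp at h0 ⊢; omega
    · rw [c1]; simp at h1 ⊢; omega

/-! ### The charge of words of columns -/

theorem colWord_insCol_zero (m : ℕ) (P : ℕ → Bool) :
    colWord (m + 1) (insCol 0 P) = (colWord m P).map Nat.succ ++ [0] := by
  rw [colWord, List.range_succ_eq_map, List.reverse_cons, List.filter_append, ← List.map_reverse,
    List.filter_map, colWord]
  congr 1

theorem dropZeros_map_succ (w : List ℕ) : dropZeros (w.map Nat.succ) = w := by
  induction w with
  | nil => rfl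
  | cons a w ih => rw [List.map_cons, Nat.succ_eq_add_one, dropZeros_cons_succ, ih]

theorem dropZeros_reverse_colsWord (m : ℕ) (Ps : List (ℕ → Bool)) :
    dropZeros (colsWord (m + 1) (Ps.map (insCol 0))).reverse = (colsWord m Ps).reverse := by
  induction Ps with
  | nil => rfl
  | cons P Ps ih =>
    unfold colsWord at ih ⊢
    rw [List.map_cons, List.flatMap_cons, List.reverse_append, dropZeros_append, ih,
      List.flatMap_cons, List.reverse_append, colWord_insCol_zero, List.reverse_append]
    simp only [List.reverse_cons, List.reverse_nil, List.nil_append, List.cons_append]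
    rw [dropZeros_cons_zero, ← List.map_reverse, dropZeros_map_succ]

/-- Read backwards, each column starts with its letter `0`, so a letter `1` is always preceded by
the `0` of its own column. The suffix `u` stands for the columns read later. -/
theorem ballot_reverse_colsWord (m : ℕ) (Ps : List (ℕ → Bool)) (b : ℕ) (u : List ℕ)
    (hu : Ballot b u) : Ballot b ((colsWord (m + 1) (Ps.map (insCol 0))).reverse ++ u) := by
  have mono : ∀ (b : ℕ) (v : List ℕ), Ballot b v → Ballot (b + 1) v := by
    intro b v
    induction v generalizing b with
    | nil => simp [Ballot]
    | cons a v ih =>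
      simp only [Ballot]
      split_ifs
      · exact ih _
      · rintro ⟨h1, h2⟩
        refine ⟨by omega, ?_⟩
        have := ih _ h2
        rwa [show b - 1 + 1 = b + 1 - 1 by omega] at this
      · exact ih _
  induction Ps generalizing u with
  | nil => simpa [colsWord] using hu
  | cons P Ps ih =>
    rw [colsWord] at ih ⊢
    rw [List.map_cons, List.flatMap_cons, List.reverse_append, List.append_assoc]
    apply ih
    rw [colWord_insCol_zero, List.reverse_append, ← List.map_reverse]
    simp only [List.reverse_cons, List.reverse_nil, List.nil_append, List.cons_append, Ballot,
      if_true]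
    have hn : ((colWord m P).reverse.map Nat.succ).Nodup :=
      (List.nodup_reverse.mpr (nodup_colWord m P)).map Nat.succ_injective
    have h0 : 0 ∉ (colWord m P).reverse.map Nat.succ := by simp
    generalize (colWord m P).reverse.map Nat.succ = E at hn h0
    by_cases h1 : 1 ∈ E
    · obtain ⟨p, q, rfl, hp⟩ := List.eq_append_cons_of_mem h1
      have hq : 1 ∉ q := by
        rw [List.nodup_append, List.nodup_cons] at hn
        exact hn.2.1.1
      rw [List.append_assoc, ballot_append hp, List.count_eq_zero.mpr fun h => h0 (by simp [h])]
      simp only [List.cons_append, Ballot, one_ne_zero, if_false, if_true]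
      refine ⟨by omega, ?_⟩
      rw [ballot_append hq, List.count_eq_zero.mpr fun h => h0 (by simp [h])]
      simpa using hu
    · rw [ballot_append h1, List.count_eq_zero.mpr h0]
      exact mono _ _ hu

/-- Inserting a letter into all columns does not change the charge. -/
theorem wordCharge_insCol {m x : ℕ} (hx : x ≤ m) (Ps : List (ℕ → Bool)) :
    wordCharge (m + 1) (colsWord (m + 1) (Ps.map (insCol x))) = wordCharge m (colsWord m Ps) := by
  have perm {n : ℕ} {w : List ℕ} : (dominantWord n w).length = w.length := by
    have hs (v : List ℕ) : (sortPass n v).length = v.length := by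
      unfold sortPass
      induction List.range (n - 1) generalizing v with
      | nil => rfl
      | cons i l ih =>
        rw [List.foldl_cons, ih]
        split_ifs
        · simp [sigmaWord]
        · rfl
    have (k : ℕ) : ((sortPass n)^[k] w).length = w.length := by
      induction k with
      | zero => rfl
      | succ k ih => rw [Function.iterate_succ_apply', hs, ih]
    exact this n
  -- Since `x ≤ m`, the `m + 1` passes are enough to bring the inserted letter down to `0`.
  have e1 : dominantWord (m + 1) (colsWord (m + 1) (Ps.map (insCol x))) =
      colsWord (m + 1) (((colsPass m)^[m + 1] Ps).map (insCol 0)) := by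
    rw [dominantWord, dominantWord_colsWord, iterate_colsPass_insCol hx]
    congr 3
    omega
  -- One pass more than needed, in order to meet the same list of columns as in `e1`.
  have e2 : dominantWord m (colsWord m Ps) = colsWord m ((colsPass m)^[m + 1] Ps) := by
    rw [← dominantWord_colsWord, Function.iterate_succ_apply', ← dominantWord,
      sortPass_dominantWord]
  have l1 := perm (n := m + 1) (w := colsWord (m + 1) (Ps.map (insCol x)))
  have l2 := perm (n := m) (w := colsWord m Ps)
  rw [wordCharge, wordCharge, ← l1, ← l2, e1, e2]
  generalize (colsPass m)^[m + 1] Ps = Qs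
  have hd := dropZeros_reverse_colsWord m Qs
  have hb := ballot_reverse_colsWord m Qs 0 [] (by simp [Ballot])
  rw [List.append_nil] at hb
  rw [← hd]
  apply chargeRounds_dropZeros _ _ _ hb
  · rw [← List.length_reverse]; exact List.count_le_length
  · rw [← count_dropZeros, hd, ← List.length_reverse]
    exact List.count_le_length

/-! ### Appending a full column -/

theorem colsLow_append_full {i : ℕ} {F : ℕ → Bool} (hF : ∀ l, F l = true) (Ps : List (ℕ → Bool)) :
    colsLow i (Ps ++ [F]) = colsLow i Ps := by
  induction Ps with
  | nil => simp [colsLow, hF]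
  | cons P Ps ih => simp [colsLow, ih]

theorem colsStep_append_full {F : ℕ → Bool} (hF : ∀ l, F l = true) (Ps : List (ℕ → Bool)) (i : ℕ) :
    colsStep (Ps ++ [F]) i = colsStep Ps i ++ [F] := by
  have key (k : ℕ) : colsRaise i k (Ps ++ [F]) = colsRaise i k Ps ++ [F] := by
    induction Ps generalizing k with
    | nil => simp [colsRaise, hF]
    | cons P Ps ih =>
      simp only [List.cons_append, colsRaise, colsLow_append_full hF, ih]
      split_ifs <;> rfl
  simp only [colsStep, List.countP_append, key]
  simp only [List.countP_cons, hF, List.countP_nil, if_true, zero_add, Nat.add_sub_add_right,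
    add_lt_add_iff_right]
  split_ifs <;> rfl

theorem iterate_colsPass_append_full {F : ℕ → Bool} (hF : ∀ l, F l = true) (m n : ℕ)
    (Ps : List (ℕ → Bool)) : (colsPass m)^[n] (Ps ++ [F]) = (colsPass m)^[n] Ps ++ [F] := by
  have key (Ps : List (ℕ → Bool)) : colsPass m (Ps ++ [F]) = colsPass m Ps ++ [F] := by
    unfold colsPass
    induction List.range (m - 1) generalizing Ps with
    | nil => rfl
    | cons i l ih => rw [List.foldl_cons, List.foldl_cons, colsStep_append_full hF, ih]
  induction n with
  | zero => rfl
  | succ n ih => rw [Function.iterate_succ_apply', Function.iterate_succ_apply', ih, key]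

theorem chargeRound_range'_append (n x : ℕ) (v : List ℕ) :
    chargeRound (List.range' x n) 0 [] (List.range' x n ++ v) = (0, v) := by
  induction n generalizing x with
  | zero => simp [chargeRound]
  | succ n ih =>
    have := chargeRound_rest (x := x) (p := []) (by simp) (List.range' (x + 1) n) 0 []
      (List.range' (x + 1) n ++ v)
    rw [List.range'_succ, List.cons_append]
    rw [List.nil_append] at this
    rw [this, List.nil_append, ih, zero_add]

/-- A full column takes no part in the sorting, since it contains both letters of every step. Being
the last column, it is read first, as `0, 1, …, m - 1`, and the first round uses up precisely these
letters with label `0`. -/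
theorem wordCharge_append_full {F : ℕ → Bool} (hF : ∀ l, F l = true) (m : ℕ)
    (Ps : List (ℕ → Bool)) :
    wordCharge m (colsWord m (Ps ++ [F])) = wordCharge m (colsWord m Ps) := by
  rcases Nat.eq_zero_or_pos m with rfl | hm
  · rw [wordCharge, wordCharge, chargeRounds_eq_zero (.inl rfl), chargeRounds_eq_zero (.inl rfl)]
  have hw : colWord m F = (List.range m).reverse := by
    rw [colWord, List.filter_eq_self]
    exact fun x _ => hF x
  have hcount (n : ℕ) (Ps : List (ℕ → Bool)) (hn : (colsWord m Ps).length ≤ n) (k : ℕ) :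
      (colsWord m ((colsPass m)^[k] Ps)).length ≤ n := by
    have hs (v : List ℕ) : (sortPass m v).length = v.length := by
      unfold sortPass
      induction List.range (m - 1) generalizing v with
      | nil => rfl
      | cons i l ih =>
        rw [List.foldl_cons, ih]
        split_ifs
        · simp [sigmaWord]
        · rfl
    rw [← dominantWord_colsWord]
    induction k with
    | zero => exact hn
    | succ k ih => rwa [Function.iterate_succ_apply', hs]
  obtain ⟨n, hn⟩ : ∃ n, (colsWord m (Ps ++ [F])).length = n + 1 ∧ (colsWord m Ps).length ≤ n :=
    ⟨(colsWord m (Ps ++ [F])).length - 1, by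
      simp only [colsWord, List.flatMap_append, List.length_append, List.flatMap_cons, hw,
        List.length_reverse, List.length_range]
      constructor <;> omega⟩
  rw [wordCharge, wordCharge, hn.1, dominantWord, dominantWord, dominantWord_colsWord,
    dominantWord_colsWord, iterate_colsPass_append_full hF]
  have hc := hcount _ Ps le_rfl m
  have hc' := hcount _ Ps hn.2 m
  generalize (colsPass m)^[m] Ps = Qs at hc hc'
  have e : (colsWord m (Qs ++ [F])).reverse = List.range m ++ (colsWord m Qs).reverse := by
    simp [colsWord, hw]
  rw [e, chargeRounds]
  simp only [List.range_eq_range', chargeRound_range'_append, zero_add]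
  have hl := List.count_le_length (a := 0) (l := (colsWord m Qs).reverse)
  rw [List.length_reverse] at hl
  exact chargeRounds_stable _ _ _ (by omega) (by omega)

/-! ## Row words and column words -/

/-- The letter `x` travels to the left through the row by Knuth moves, each of which has as witness
the row entry just before the one crossed; that entry is larger than `x`. -/
theorem plactic_row_letter {x y : ℕ} (hxy : x < y) {ρ : List ℕ}
    (hρ : (y :: ρ).Pairwise (· ≤ ·)) : Plactic (y :: (ρ ++ [x])) (y :: x :: ρ) := by
  induction ρ generalizing y with
  | nil => exact .refl _
  | cons z ρ ih =>
    have hyz : y ≤ z := (List.pairwise_cons.mp hρ).1 z (by simp)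
    exact ((ih (by omega) (List.pairwise_cons.mp hρ).2).cons y).trans
      (.rel _ _ (.right _ _ _ _ hxy hyz))

/-- A hook with corner `y` may be read arm first or leg first. The first letter of the leg passes
the arm and becomes the corner of a smaller hook. -/
theorem plactic_row_column {d : List ℕ} : ∀ {y : ℕ} {ρ : List ℕ}, (y :: ρ).Pairwise (· ≤ ·) →
    (y :: d).Pairwise (· > ·) → Plactic (y :: (ρ ++ d)) (y :: (d ++ ρ)) := by
  induction d with
  | nil => intro y ρ _ _; simpa using Plactic.refl _
  | cons x d ih =>
    intro y ρ hρ hd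
    rw [List.pairwise_cons] at hρ hd
    have hxy : x < y := hd.1 x (by simp)
    have h1 := (plactic_row_letter hxy (List.pairwise_cons.mpr hρ)).append_right d
    have h2 : Plactic (x :: (ρ ++ d)) (x :: (d ++ ρ)) :=
      ih (List.pairwise_cons.mpr ⟨fun z hz => hxy.le.trans (hρ.1 z hz), hρ.2⟩) hd.2
    simp only [List.cons_append, List.append_assoc, List.nil_append] at h1
    exact h1.trans (h2.cons y)

/-- The entry in row `r` of a column, given by the row of its first entry and its list of entries
from top to bottom. -/
def colEntry (r : ℕ) (x : ℕ × List ℕ) : Option ℕ := if x.1 ≤ r then x.2[r - x.1]? else none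

/-- The row word and the column word of a skew tableau are plactically equivalent. -/
theorem plactic_rows_columns {cols : List (ℕ × List ℕ)}
    (h : cols.Pairwise fun x y => (∀ r u v, colEntry r x = some u → colEntry r y = some v → u ≤ v) ∧
      y.1 + y.2.length ≤ x.1 + x.2.length)
    (hD : ∀ x ∈ cols, x.2.Pairwise (· < ·)) {R : ℕ} (hR : ∀ x ∈ cols, x.1 + x.2.length ≤ R) :
    Plactic ((List.range R).reverse.flatMap fun r => cols.filterMap (colEntry r))
      (cols.flatMap fun x => x.2.reverse) := by
  induction cols with
  | nil => exact .of_eq (by simp [List.flatMap_eq_nil_iff])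
  | cons x cols ih =>
    rw [List.pairwise_cons] at h
    have hx : x.2.Pairwise (· < ·) := hD x (by simp)
    have hrows (r : ℕ) : (cols.filterMap (colEntry r)).Pairwise (· ≤ ·) := by
      rw [List.pairwise_filterMap]
      exact h.2.imp fun hxy u hu v hv => hxy.1 r u v hu hv
    -- The first column is split off from the top `R` rows. When a row is added at the bottom, its
    -- first entry, the rest of that row and the part of the first column above form a hook, and
    -- reading this hook leg first moves the row behind the column.
    have key (R : ℕ) : Plactic
        ((List.range R).reverse.flatMap fun r => (x :: cols).filterMap (colEntry r))
        ((x.2.take (R - x.1)).reverse ++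
          (List.range R).reverse.flatMap fun r => cols.filterMap (colEntry r)) := by
      induction R with
      | zero => simpa using Plactic.refl _
      | succ R ihR =>
        rw [List.range_succ, List.reverse_append, List.reverse_singleton, List.singleton_append,
          List.flatMap_cons, List.flatMap_cons]
        refine (ihR.append_left _).trans ?_
        rw [List.filterMap_cons]
        rcases Nat.lt_or_ge R x.1 with h1 | h1
        · have e1 : colEntry R x = none := by simp [colEntry]; omega
          have e2 : R - x.1 = 0 := by omega
          have e3 : R + 1 - x.1 = 0 := by omega
          simp only [e1, e2, e3]
          simpa using Plactic.refl _
        rcases Nat.lt_or_ge (R - x.1) x.2.length with h2 | h2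
        · have e1 : colEntry R x = some x.2[R - x.1] := by simp [colEntry, h1, h2]
          have e2 : R + 1 - x.1 = (R - x.1) + 1 := by omega
          rw [e2, List.take_add_one, List.reverse_append, List.getElem?_eq_getElem h2]
          simp only [e1, Option.toList_some, List.reverse_singleton, List.singleton_append]
          have hp : ((x.2.take (R - x.1 + 1)).reverse).Pairwise (· > ·) := by
            rw [List.pairwise_reverse]
            exact hx.sublist (List.take_sublist _ _)
          rw [List.take_add_one, List.reverse_append, List.getElem?_eq_getElem h2] at hp
          simp only [Option.toList_some, List.reverse_singleton, List.singleton_append] at hp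
          have := plactic_row_column (y := x.2[R - x.1]) (ρ := cols.filterMap (colEntry R))
            (List.pairwise_cons.mpr ⟨fun v hv => ?_, hrows R⟩) hp
          · simpa using this.append_right _
          · obtain ⟨y, hy, hyv⟩ := List.mem_filterMap.mp hv
            exact (h.1 y hy).1 R _ v e1 hyv
        -- The first column ends above row `R`. No column on its right reaches further down, so the
        -- row is empty.
        · have e1 : colEntry R x = none := by simp [colEntry, h2]
          have e2 : cols.filterMap (colEntry R) = [] := by
            rw [List.filterMap_eq_nil_iff]
            intro y hy
            have := (h.1 y hy).2
            rw [colEntry]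
            split_ifs
            · rw [List.getElem?_eq_none_iff]; omega
            · rfl
          rw [List.take_of_length_le h2, List.take_of_length_le (by omega)]
          simp only [e1, e2]
          simpa using Plactic.refl _
    refine (key R).trans ?_
    have := hR x (by simp)
    rw [List.take_of_length_le (by omega), List.flatMap_cons]
    exact (ih h.2 (fun y hy => hD y (List.mem_cons_of_mem _ hy))
      fun y hy => hR y (List.mem_cons_of_mem _ hy)).append_left _

/-- The letter `y` passes the larger letters of the column with the next, still not smaller letter
as witness, and passes the remaining ones with the letter just crossed as witness. Consequently a
word in letters of a column commutes with the column. -/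
theorem plactic_column_letter {y : ℕ} : ∀ {B : List ℕ}, B.Pairwise (· > ·) → y ∈ B →
    Plactic (y :: B) (B ++ [y]) := by
  have low {b : ℕ} (hb : b ≤ y) : ∀ {C : List ℕ}, (b :: C).Pairwise (· > ·) →
      Plactic (b :: y :: C) (b :: (C ++ [y])) := by
    intro C
    induction C generalizing b with
    | nil => intro _; exact .refl _
    | cons c C ih =>
      intro h
      rw [List.pairwise_cons] at h
      have hc : c < b := h.1 c (by simp)
      exact Plactic.trans (.rel _ _ (.right c b y _ hc hb)) ((ih (by omega) h.2).cons b)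
  intro B
  induction B with
  | nil => simp
  | cons b B ih =>
    intro hB hy
    have hB' := List.pairwise_cons.mp hB
    rcases List.mem_cons.mp hy with rfl | hyB
    · exact low le_rfl hB
    · have hyb : y < b := hB'.1 y hyB
      cases B with
      | nil => simp at hyB
      | cons c C =>
        have hcb : c < b := hB'.1 c (by simp)
        have hyc : y ≤ c := by
          rcases List.mem_cons.mp hyB with rfl | h
          · exact le_rfl
          · exact ((List.pairwise_cons.mp hB'.2).1 y h).le
        exact Plactic.trans (.rel _ _ (.left y c b _ hyc hcb)) ((ih hB'.2 hyB).cons b)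

theorem plactic_column_comm {B : List ℕ} (hB : B.Pairwise (· > ·)) {w : List ℕ}
    (hw : ∀ y ∈ w, y ∈ B) : Plactic (w ++ B) (B ++ w) := by
  induction w with
  | nil => simpa using Plactic.refl _
  | cons y w ih =>
    have h1 := (ih fun z hz => hw z (List.mem_cons_of_mem _ hz)).cons y
    have h2 := (plactic_column_letter hB (hw y (by simp))).append_right w
    simpa using h1.trans h2

/-- From right to left, each column `c ≥ p` keeps one letter `j` at its end. It then contains `j`,
so the other copies of `j` commute with it and pass on to the columns on its left. -/
theorem plactic_columns_letter (E : ℕ → List ℕ) (j p N : ℕ)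
    (h : ∀ c < N, p ≤ c → (E c ++ [j]).Pairwise (· > ·)) :
    Plactic ((List.range N).flatMap E ++ List.replicate (N - p) j)
      ((List.range N).flatMap fun c => if p ≤ c then E c ++ [j] else E c) := by
  induction N with
  | zero => simpa using Plactic.refl _
  | succ N ih =>
    have ih := ih fun c hc => h c (by omega)
    rw [List.range_succ, List.flatMap_append, List.flatMap_append, List.flatMap_singleton,
      List.flatMap_singleton]
    split_ifs with hp
    · have e : N + 1 - p = (N - p) + 1 := by omega
      rw [e, List.replicate_succ]
      have h1 : Plactic ((E N ++ [j]) ++ List.replicate (N - p) j)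
          (List.replicate (N - p) j ++ (E N ++ [j])) :=
        (plactic_column_comm (h N (by omega) hp) fun y hy => by
          simp [List.eq_of_mem_replicate hy]).symm
      have h2 := (h1.append_left ((List.range N).flatMap E)).trans
        (.trans (.of_eq (by simp)) (ih.append_right (E N ++ [j])))
      simpa using h2
    · have e : N + 1 - p = 0 := by omega
      have e' : N - p = 0 := by omega
      rw [e'] at ih
      rw [e]
      simpa using (ih.append_right (E N))

/-- The letters of a Yamanouchi word may be distributed over the columns on the right. -/
theorem plactic_columns_letters (p : ℕ → ℕ) (N : ℕ) : ∀ (ls : List ℕ) (E : ℕ → List ℕ),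
    (∀ c < N, (E c ++ ls.filter (p · ≤ c)).Pairwise (· > ·)) →
    Plactic ((List.range N).flatMap E ++ ls.flatMap fun l => List.replicate (N - p l) l)
      ((List.range N).flatMap fun c => E c ++ ls.filter (p · ≤ c))
  | [], E, _ => by simpa using Plactic.refl _
  | j :: ls, E, h => by
    have h1 := plactic_columns_letter E j (p j) N fun c hc hp => by
      have := h c hc
      rw [List.filter_cons_of_pos (by simpa using hp)] at this
      refine this.sublist ?_
      simp
    have e (c : ℕ) : (if p j ≤ c then E c ++ [j] else E c) ++ ls.filter (p · ≤ c) =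
        E c ++ (j :: ls).filter (p · ≤ c) := by
      split_ifs with hp <;> simp [hp]
    have h2 := plactic_columns_letters p N ls (fun c => if p j ≤ c then E c ++ [j] else E c)
      fun c hc => by rw [e]; exact h c hc
    simp only [e] at h2
    rw [List.flatMap_cons, ← List.append_assoc]
    exact (h1.append_right _).trans h2

/-! ## The complementary tableau -/

theorem lt_getD_iff_lt_countP {c : ℕ} : ∀ {s : List ℕ} (r : ℕ), s.Pairwise (· ≥ ·) →
    (c < s.getD r 0 ↔ r < s.countP (c < ·))
  | [], r, _ => by simp
  | a :: s, r, h => by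
    rw [List.pairwise_cons] at h
    have ih (r : ℕ) := lt_getD_iff_lt_countP (c := c) r h.2
    rw [List.countP_cons]
    by_cases hc : c < a
    · rcases r with _ | r
      · simp [hc]
      · simpa [hc] using ih r
    · have h0 : s.countP (c < ·) = 0 := by
        rw [List.countP_eq_zero]
        intro x hx
        have := h.1 x hx
        simp; omega
      rcases r with _ | r
      · simp [hc, h0]
      · have := ih r
        rw [h0] at this ⊢
        simpa [hc] using this

theorem lt_rowLen_iff (p : Multiset ℕ) (r c : ℕ) : c < rowLen p r ↔ r < colLen p c := by
  rw [rowLen, lt_getD_iff_lt_countP r (Multiset.pairwise_sort p _), colLen, ← Multiset.countP_eq_card_filter]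
  conv_rhs => rw [← Multiset.sort_eq p (· ≥ ·)]
  rw [Multiset.coe_countP]

theorem colLen_add (p q : Multiset ℕ) (c : ℕ) : colLen (p + q) c = colLen p c + colLen q c := by
  simp [colLen, Multiset.filter_add]

theorem colLen_anti (p : Multiset ℕ) {c c' : ℕ} (h : c ≤ c') : colLen p c' ≤ colLen p c :=
  Multiset.card_le_card (Multiset.monotone_filter_right p fun _ hx => by omega)

theorem colLen_le_card (p : Multiset ℕ) (c : ℕ) : colLen p c ≤ p.card :=
  Multiset.card_le_card (Multiset.filter_le _ p)

theorem rowLen_le_sum (p : Multiset ℕ) (r : ℕ) : rowLen p r ≤ p.sum := by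
  by_contra h
  rw [not_le, lt_rowLen_iff] at h
  obtain ⟨x, hx⟩ := Multiset.card_pos_iff_exists_mem.mp (Nat.lt_of_le_of_lt (Nat.zero_le _) h)
  rw [Multiset.mem_filter] at hx
  have := Multiset.single_le_sum (fun _ _ => Nat.zero_le _) x hx.1
  omega

theorem mem_skewCells {o p : Multiset ℕ} {r c : ℕ} :
    (r, c) ∈ skewCells o p ↔ colLen p c ≤ r ∧ r < colLen o c := by
  rw [skewCells, Finset.mem_filter, Finset.mem_product, Finset.mem_range, Finset.mem_range]
  have h1 := lt_rowLen_iff p r c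
  have h2 := lt_rowLen_iff o r c
  have h3 := colLen_le_card o c
  have h4 := rowLen_le_sum o r
  simp only
  omega

theorem colLen_total {m : ℕ} (L : MPartition m) (c : ℕ) :
    colLen L.total c = #{i | c < L.a i} + colLen L.lam c := by
  rw [MPartition.total, colLen_add]
  congr 1
  rw [colLen, Multiset.filter_map, Multiset.card_map]
  rfl

/-- In a strictly increasing column the entries below `k` are the topmost ones. Conditions on
entries thus become inequalities between numbers of entries. -/
theorem lt_add_card_filter_iff {a b k : ℕ} {g : ℕ → ℕ} (hg : ∀ r s, a ≤ r → r < s → s < b → g r < g s)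
    {r : ℕ} (h1 : a ≤ r) (h2 : r < b) : g r < k ↔ r < a + #{s ∈ Ico a b | g s < k} := by
  constructor
  · intro h
    have hs : Icc a r ⊆ {s ∈ Ico a b | g s < k} := fun s hs => by
      rw [Finset.mem_Icc] at hs
      rw [Finset.mem_filter, Finset.mem_Ico]
      refine ⟨⟨hs.1, by omega⟩, ?_⟩
      rcases hs.2.eq_or_lt with rfl | hlt
      · exact h
      · exact (hg s r hs.1 hlt h2).trans h
    have := Finset.card_le_card hs
    rw [Nat.card_Icc] at this
    omega
  · intro h
    by_contra hk
    have hs : ({s ∈ Ico a b | g s < k} : Finset ℕ) ⊆ Ico a r := fun s hs => by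
      rw [Finset.mem_filter, Finset.mem_Ico] at hs
      rw [Finset.mem_Ico]
      refine ⟨hs.1.1, ?_⟩
      by_contra hrs
      rcases (not_lt.mp hrs).eq_or_lt with rfl | hlt
      · exact hk hs.2
      · have := hg r s h1 hlt hs.1.2
        omega
    have := Finset.card_le_card hs
    rw [Nat.card_Ico] at this
    omega

open Classical in
/-- The set of the letters in column `c` of a filling. -/
def colLetters {m : ℕ} {L O : MPartition m} (T : Filling L O) (c : ℕ) : Finset (Fin m) :=
  {i | ∃ x, x.1.2 = c ∧ T x = i}

section
variable {m : ℕ} {L O : MPartition m} {T : Filling L O}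

theorem mem_colLetters {c : ℕ} {i : Fin m} : i ∈ colLetters T c ↔ ∃ x, x.1.2 = c ∧ T x = i := by
  simp [colLetters]

theorem mem_tableaux : T ∈ tableaux L O ↔ (∀ r, rowLen O.lam r ≤ rowLen L.total r) ∧
    (∀ x y, x.1.1 = y.1.1 → x.1.2 < y.1.2 → T x ≤ T y) ∧
    (∀ x y, x.1.2 = y.1.2 → x.1.1 < y.1.1 → T x < T y) ∧
    (∀ i : Fin m, #{x | T x = i} = O.a i) ∧ (∀ x, x.1.2 < L.a (T x)) := by
  classical
  unfold tableaux
  rw [Finset.mem_filter]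
  simp

theorem lt_of_mem_colLetters (hT : T ∈ tableaux L O) {c : ℕ} {i : Fin m}
    (hi : i ∈ colLetters T c) : c < L.a i := by
  obtain ⟨x, rfl, rfl⟩ := mem_colLetters.mp hi
  exact (mem_tableaux.mp hT).2.2.2.2 x

theorem colLen_le_total (hT : T ∈ tableaux L O) (c : ℕ) : colLen O.lam c ≤ colLen L.total c := by
  have h := (mem_tableaux.mp hT).1
  by_contra hc
  rw [not_le, ← lt_rowLen_iff] at hc
  have := hc.trans_le (h _)
  rw [lt_rowLen_iff] at this
  omega

open Classical in
/-- The letter in the cell `(r, c)` as a natural number, with value `0` outside of the diagram. -/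
def letterAt (T : Filling L O) (c r : ℕ) : ℕ :=
  if h : (r, c) ∈ skewCells L.total O.lam then (T ⟨(r, c), h⟩ : ℕ) else 0

theorem letterAt_eq {c r : ℕ} (h : (r, c) ∈ skewCells L.total O.lam) :
    letterAt T c r = (T ⟨(r, c), h⟩ : ℕ) := dif_pos h

theorem letterAt_strictMono (hT : T ∈ tableaux L O) (c r s : ℕ) (h1 : colLen O.lam c ≤ r)
    (hrs : r < s) (h2 : s < colLen L.total c) : letterAt T c r < letterAt T c s := by
  rw [letterAt_eq (mem_skewCells.mpr ⟨h1, by omega⟩),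
    letterAt_eq (mem_skewCells.mpr ⟨by omega, h2⟩)]
  exact (mem_tableaux.mp hT).2.2.1 _ _ rfl hrs

theorem image_letterAt (c : ℕ) : (Ico (colLen O.lam c) (colLen L.total c)).image (letterAt T c) =
    (colLetters T c).map Fin.valEmbedding := by
  ext l
  simp only [Finset.mem_image, Finset.mem_map, Finset.mem_Ico, mem_colLetters]
  constructor
  · rintro ⟨r, hr, rfl⟩
    exact ⟨_, ⟨⟨(r, c), mem_skewCells.mpr hr⟩, rfl, rfl⟩, (letterAt_eq _).symm⟩
  · rintro ⟨_, ⟨⟨⟨r, c'⟩, hx⟩, hc, rfl⟩, rfl⟩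
    obtain rfl : c' = c := hc
    exact ⟨r, mem_skewCells.mp hx, letterAt_eq hx⟩

theorem card_colLetters_lt (hT : T ∈ tableaux L O) (c k : ℕ) : #{i ∈ colLetters T c | i.1 < k} =
    #{r ∈ Ico (colLen O.lam c) (colLen L.total c) | letterAt T c r < k} := by
  have h1 : Set.InjOn (letterAt T c)
      ({r ∈ Ico (colLen O.lam c) (colLen L.total c) | letterAt T c r < k} : Finset ℕ) := by
    intro r hr s hs h
    rw [Finset.mem_coe, Finset.mem_filter, Finset.mem_Ico] at hr hs
    rcases lt_trichotomy r s with hlt | rfl | hlt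
    · have := letterAt_strictMono hT c r s hr.1.1 hlt hs.1.2
      omega
    · rfl
    · have := letterAt_strictMono hT c s r hs.1.1 hlt hr.1.2
      omega
  rw [← Finset.card_image_of_injOn h1, ← Finset.card_map Fin.valEmbedding]
  congr 1
  ext l
  have h := Finset.ext_iff.mp (image_letterAt (T := T) c) l
  simp only [Finset.mem_image, Finset.mem_map, Finset.mem_filter, Fin.valEmbedding_apply] at h ⊢
  constructor
  · rintro ⟨i, ⟨hi, hk⟩, rfl⟩
    obtain ⟨r, hr, hri⟩ := h.mpr ⟨i, hi, rfl⟩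
    exact ⟨r, ⟨hr, by omega⟩, hri⟩
  · rintro ⟨r, ⟨hr, hk⟩, rfl⟩
    obtain ⟨i, hi, hri⟩ := h.mp ⟨r, hr, rfl⟩
    exact ⟨i, ⟨hi, by omega⟩, hri⟩

theorem card_colLetters (hT : T ∈ tableaux L O) (c : ℕ) :
    #(colLetters T c) + colLen O.lam c = colLen L.total c := by
  have h := card_colLetters_lt hT c m
  rw [Finset.filter_true_of_mem fun i _ => i.2, Finset.filter_true_of_mem, Nat.card_Ico] at h
  · have := colLen_le_total hT c
    omega
  · intro r hr
    rw [letterAt_eq (mem_skewCells.mpr (Finset.mem_Ico.mp hr))]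
    exact Fin.is_lt _

/-- The inner shape together with the cells whose letter is less than `k` is again a Young diagram,
so its column lengths decrease. This expresses the row condition of `T` by letter sets of columns
alone. -/
theorem colThreshold_anti (hT : T ∈ tableaux L O) {c c' : ℕ} (hc : c ≤ c') (k : ℕ) :
    colLen O.lam c' + #{i ∈ colLetters T c' | i.1 < k} ≤
      colLen O.lam c + #{i ∈ colLetters T c | i.1 < k} := by
  rcases hc.eq_or_lt with rfl | hlt
  · exact le_rfl
  rw [card_colLetters_lt hT, card_colLetters_lt hT]
  by_contra h
  set r := colLen O.lam c + #{r ∈ Ico (colLen O.lam c) (colLen L.total c) | letterAt T c r < k}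
    with hr
  have h1 : #{r ∈ Ico (colLen O.lam c') (colLen L.total c') | letterAt T c' r < k} ≤
      colLen L.total c' - colLen O.lam c' := by
    rw [← Nat.card_Ico]
    exact Finset.card_filter_le _ _
  have h2 := colLen_anti O.lam hc
  have h3 := colLen_anti L.total hc
  have hx : (r, c) ∈ skewCells L.total O.lam := mem_skewCells.mpr ⟨by omega, by omega⟩
  have hx' : (r, c') ∈ skewCells L.total O.lam := mem_skewCells.mpr ⟨by omega, by omega⟩
  have h4 : letterAt T c' r < k :=
    (lt_add_card_filter_iff (letterAt_strictMono hT c') (by omega) (by omega)).mpr (by omega)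
  have h5 : letterAt T c r ≤ letterAt T c' r := by
    rw [letterAt_eq hx, letterAt_eq hx']
    exact (mem_tableaux.mp hT).2.1 _ _ rfl hlt
  have h6 := (lt_add_card_filter_iff (k := k) (letterAt_strictMono hT c) (r := r) (by omega)
    (by omega)).mp (by omega)
  omega

/-- For dominant `a` the letters allowed in a given column form an initial segment of the alphabet.
-/
theorem lt_apply_iff (hL : Antitone L.a) (c : ℕ) (i : Fin m) :
    c < L.a i ↔ i.1 < #{i | c < L.a i} := by
  constructor
  · intro h
    have hs : Finset.Iic i ⊆ ({i | c < L.a i} : Finset (Fin m)) := fun j hj => by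
      rw [Finset.mem_Iic] at hj
      simpa using h.trans_le (hL hj)
    have := Finset.card_le_card hs
    rw [Fin.card_Iic] at this
    omega
  · intro h
    by_contra hc
    have hs : ({i | c < L.a i} : Finset (Fin m)) ⊆ Finset.Iio i := fun j hj => by
      rw [Finset.mem_Iio]
      by_contra hij
      have h1 : c < L.a j := by simpa using hj
      exact hc (h1.trans_le (hL (not_lt.mp hij)))
    have := Finset.card_le_card hs
    rw [Fin.card_Iio] at this
    omega

/-- The number of entries with index at least `k` in column `c` of the complementary tableau. -/
theorem card_bar_add (hT : T ∈ tableaux L O) (hL : Antitone L.a) (c : ℕ) {k : ℕ} (hk : k ≤ m) :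
    colLen L.lam c + #{i | k ≤ i.1 ∧ c < L.a i ∧ i ∉ colLetters T c} + min #{i | c < L.a i} k =
      colLen O.lam c + #{i ∈ colLetters T c | i.1 < k} := by
  have h1 := card_colLetters hT c
  rw [colLen_total] at h1
  set U : Finset (Fin m) := {i | c < L.a i} with hU
  have hS : colLetters T c ⊆ U := fun i hi => by
    simpa [hU] using lt_of_mem_colLetters hT hi
  have e1 : #{i ∈ U | i.1 < k} = min #U k := by
    have : ({i ∈ U | i.1 < k} : Finset (Fin m)).map Fin.valEmbedding = Finset.range (min #U k) := by
      ext l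
      simp only [Finset.mem_map, Finset.mem_filter, Finset.mem_range, Fin.valEmbedding_apply]
      constructor
      · rintro ⟨i, ⟨hi, hik⟩, rfl⟩
        have := (lt_apply_iff hL c i).mp (by simpa [hU] using hi)
        exact lt_min this hik
      · intro hl
        have hlm : l < m := by omega
        refine ⟨⟨l, hlm⟩, ⟨?_, by simp; omega⟩, rfl⟩
        have := (lt_apply_iff hL c ⟨l, hlm⟩).mpr (show l < #U by omega)
        simpa [hU] using this
    rw [← Finset.card_map Fin.valEmbedding, this, Finset.card_range]
  have e2 : ({i | k ≤ i.1 ∧ c < L.a i ∧ i ∉ colLetters T c} : Finset (Fin m)) =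
      {i ∈ U | ¬ i.1 < k} \ {i ∈ colLetters T c | ¬ i.1 < k} := by
    ext i
    simp only [hU, Finset.mem_filter, Finset.mem_univ, true_and, Finset.mem_sdiff]
    constructor
    · rintro ⟨h1, h2, h3⟩
      exact ⟨⟨h2, by omega⟩, fun h => h3 h.1⟩
    · rintro ⟨⟨h1, h2⟩, h3⟩
      exact ⟨by omega, h1, fun h => h3 ⟨h, h2⟩⟩
  have e3 : ({i ∈ colLetters T c | ¬ i.1 < k} : Finset (Fin m)) ⊆ {i ∈ U | ¬ i.1 < k} :=
    Finset.filter_subset_filter _ hS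
  have e4 := Finset.card_filter_add_card_filter_not (s := U) (fun i => i.1 < k)
  have e5 := Finset.card_filter_add_card_filter_not (s := colLetters T c) (fun i => i.1 < k)
  have e6 := Finset.card_le_card e3
  rw [e2, Finset.card_sdiff_of_subset e3]
  omega

/-- This is the row condition for `T̄`, in whose alphabet the letters of large index are the small
ones. By `card_bar_add` it is the row condition for `T` as long as the column `c'` allows at least
`k` letters; otherwise column `c'` of `T̄` has no entry of index at least `k` and only the inner
shape `lam` counts. -/
theorem card_bar_anti (hT : T ∈ tableaux L O) (hL : Antitone L.a) {c c' : ℕ} (hc : c ≤ c') {k : ℕ}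
    (hk : k ≤ m) :
    colLen L.lam c' + #{i | k ≤ i.1 ∧ c' < L.a i ∧ i ∉ colLetters T c'} ≤
      colLen L.lam c + #{i | k ≤ i.1 ∧ c < L.a i ∧ i ∉ colLetters T c} := by
  have h1 := card_bar_add hT hL c hk
  have h2 := card_bar_add hT hL c' hk
  have h3 := colThreshold_anti hT hc k
  have h4 := colLen_anti L.lam hc
  rcases le_or_gt k #{i | c' < L.a i} with hk' | hk'
  · have : #{i | c' < L.a i} ≤ #{i | c < L.a i} := Finset.card_le_card fun i hi => by
      simp at hi ⊢; omega
    rw [min_eq_right hk'] at h2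
    rw [min_eq_right (by omega)] at h1
    omega
  · have : ({i | k ≤ i.1 ∧ c' < L.a i ∧ i ∉ colLetters T c'} : Finset (Fin m)) = ∅ := by
      rw [Finset.filter_eq_empty_iff]
      rintro i _ ⟨h5, h6, _⟩
      have := (lt_apply_iff hL c' i).mp h6
      omega
    rw [this, Finset.card_empty]
    omega

end

/-! ## The word of the complementary tableau in columns -/

theorem getElem?_filter_range (Q : ℕ → Bool) (n k u : ℕ) :
    ((List.range n).filter Q)[k]? = some u ↔
      u < n ∧ Q u = true ∧ ((List.range u).filter Q).length = k := by
  induction n with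
  | zero => simp
  | succ n ih =>
    rw [List.range_succ, List.filter_append]
    have hmono {u v : ℕ} (h : u ≤ v) :
        ((List.range u).filter Q).length ≤ ((List.range v).filter Q).length :=
      ((List.range_sublist.mpr h).filter Q).length_le
    rcases Nat.lt_or_ge k ((List.range n).filter Q).length with hk | hk
    · rw [List.getElem?_append_left hk, ih]
      constructor
      · rintro ⟨h1, h2⟩; exact ⟨by omega, h2⟩
      · rintro ⟨h1, h2, h3⟩
        refine ⟨?_, h2, h3⟩
        rcases Nat.lt_succ_iff_lt_or_eq.mp h1 with h | rfl
        · exact h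
        · omega
    · rw [List.getElem?_append_right hk]
      constructor
      · intro h
        by_cases hQ : Q n = true
        · rw [List.filter_cons_of_pos hQ, List.filter_nil, List.getElem?_singleton] at h
          split_ifs at h with h0
          obtain rfl : n = u := by simpa using h
          exact ⟨by omega, hQ, by omega⟩
        · rw [List.filter_cons_of_neg hQ] at h
          simp at h
      · rintro ⟨h1, h2, h3⟩
        rcases Nat.lt_succ_iff_lt_or_eq.mp h1 with h | rfl
        · exfalso
          have := hmono (show u + 1 ≤ n from h)
          rw [List.range_succ, List.filter_append, List.length_append,
            List.filter_cons_of_pos h2] at this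
          simp at this
          omega
        · rw [List.filter_cons_of_pos h2, h3]
          simp

theorem map_rev_finRange (m : ℕ) :
    (List.finRange m).map (fun i => (Fin.rev i : ℕ)) = (List.range m).reverse := by
  apply List.ext_getElem
  · simp
  · intro i h1 h2
    simp at h1 h2 ⊢
    omega

theorem filter_append_filter_not {P : ℕ → Bool} : ∀ {ls : List ℕ},
    ls.Pairwise (fun x y => P y = true → P x = true) → ls.filter P ++ ls.filter (fun x => !P x) = ls
  | [], _ => rfl
  | a :: ls, h => by
    rw [List.pairwise_cons] at h
    cases ha : P a
    · have h0 : ls.filter P = [] := by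
        rw [List.filter_eq_nil_iff]
        intro x hx hP
        rw [h.1 x hx hP] at ha
        cases ha
      have := filter_append_filter_not h.2
      rw [h0] at this
      simpa [ha, h0] using this
    · simpa [ha] using filter_append_filter_not h.2

/-- The entry of a composition which belongs to a letter of the reversed alphabet. -/
def revEntry {m : ℕ} (a : Fin m → ℕ) (l : ℕ) : ℕ := if h : l < m then a (Fin.rev ⟨l, h⟩) else 0

theorem revEntry_rev {m : ℕ} (a : Fin m → ℕ) (i : Fin m) : revEntry a (Fin.rev i : ℕ) = a i := by
  rw [revEntry, dif_pos (Fin.is_lt _), Fin.eta, Fin.rev_rev]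

theorem revEntry_mono {m : ℕ} {a : Fin m → ℕ} (ha : Antitone a) {l l' : ℕ} (h : l ≤ l')
    (hl : l' < m) : revEntry a l ≤ revEntry a l' := by
  rw [revEntry, revEntry, dif_pos hl, dif_pos (by omega)]
  apply ha
  rw [Fin.rev_le_rev]
  exact h

section
variable {m : ℕ} {L O : MPartition m} {T : Filling L O}

open Classical in
/-- The complement of column `c` of a filling, in the reversed alphabet. -/
def compCol (T : Filling L O) (c : ℕ) : ℕ → Bool :=
  fun l => decide (∀ i ∈ colLetters T c, (Fin.rev i : ℕ) ≠ l)

open Classical in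
/-- The column of the complementary tableau, in the reversed alphabet. -/
def barCol (T : Filling L O) (c : ℕ) : ℕ → Bool :=
  fun l => decide (c < revEntry L.a l ∧ ∀ i ∈ colLetters T c, (Fin.rev i : ℕ) ≠ l)

theorem map_barColumn (T : Filling L O) (c : ℕ) :
    (barColumn T c).map (fun i => (Fin.rev i : ℕ)) = (List.range m).filter (barCol T c) := by
  have h : (List.range m) = ((List.finRange m).reverse).map (fun i => (Fin.rev i : ℕ)) := by
    rw [List.map_reverse, map_rev_finRange, List.reverse_reverse]
  rw [h, List.filter_map, barColumn]
  congr 1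
  apply List.filter_congr
  intro i _
  rw [Function.comp_apply, barCol, decide_eq_decide, revEntry_rev]
  refine and_congr_right fun _ => ⟨fun h j hj e => ?_, fun h x hx e => ?_⟩
  · obtain ⟨x, hx, rfl⟩ := mem_colLetters.mp hj
    exact h x hx (Fin.rev_injective (Fin.ext e))
  · exact h i (mem_colLetters.mpr ⟨x, hx, e⟩) rfl

theorem length_filter_barCol (T : Filling L O) (c : ℕ) {u : ℕ} (hu : u ≤ m) :
    ((List.range u).filter (barCol T c)).length =
      #{i : Fin m | m - u ≤ i.1 ∧ c < L.a i ∧ i ∉ colLetters T c} := by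
  rw [← List.toFinset_card_of_nodup (List.nodup_range.filter _),
    ← Finset.card_map (Fin.revPerm.toEmbedding.trans Fin.valEmbedding)]
  congr 1
  ext l
  simp only [List.mem_toFinset, List.mem_filter, List.mem_range, Finset.mem_map, Finset.mem_filter,
    Finset.mem_univ, true_and, barCol, decide_eq_true_eq, Function.Embedding.trans_apply,
    Equiv.coe_toEmbedding, Fin.revPerm_apply, Fin.valEmbedding_apply]
  constructor
  · rintro ⟨hl, h1, h2⟩
    have hlm : l < m := by omega
    refine ⟨Fin.rev ⟨l, hlm⟩, ⟨?_, ?_, fun h => h2 _ h (by simp)⟩, by simp⟩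
    · simp; omega
    · rwa [revEntry, dif_pos hlm] at h1
  · rintro ⟨i, ⟨h1, h2, h3⟩, rfl⟩
    refine ⟨by rw [Fin.val_rev]; omega, by rwa [revEntry_rev], fun j hj e => h3 ?_⟩
    rwa [← Fin.rev_injective (Fin.ext e)]

theorem add_length_barCol (hT : T ∈ tableaux L O) (hL : Antitone L.a) (c : ℕ) :
    colLen L.lam c + ((List.range m).filter (barCol T c)).length = colLen O.lam c := by
  have := card_bar_add hT hL c (Nat.zero_le m)
  rw [length_filter_barCol T c le_rfl, Nat.sub_self]
  simpa using this

/-- Puts the word into the form required by `plactic_rows_columns`: a row may run over all columns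
below `M`, since columns without a cell in that row contribute nothing. -/
theorem map_barWord (hT : T ∈ tableaux L O) (hL : Antitone L.a) (M : ℕ)
    (hM : L.lam.sum + O.lam.sum ≤ M) : (barWord T).map (fun i => (Fin.rev i : ℕ)) =
      (List.range O.lam.card).reverse.flatMap fun r =>
        ((List.range M).map fun c => (colLen L.lam c, (List.range m).filter (barCol T c))).filterMap
          (colEntry r) := by
  rw [barWord, List.map_flatMap]
  congr 1
  funext r
  rw [List.map_filterMap, List.filterMap_map]
  have h1 := rowLen_le_sum L.lam r
  have h2 := rowLen_le_sum O.lam r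
  set p := rowLen L.lam r with hp
  set q := rowLen O.lam r - p with hq
  have e1 : List.range M = List.range' 0 p ++ (List.range' p q ++ List.range' (p + q) (M - p - q)) := by
    have e2 := List.range'_append (s := p) (m := q) (n := M - p - q) (step := 1)
    have e3 := List.range'_append (s := 0) (m := p) (n := q + (M - p - q)) (step := 1)
    simp only [Nat.one_mul, Nat.zero_add] at e2 e3
    rw [e2, e3, List.range_eq_range']
    congr 1
    omega
  have n1 (c : ℕ) (hc : ¬ (p ≤ c ∧ c < p + q)) :
      (colEntry r ∘ fun c => (colLen L.lam c, (List.range m).filter (barCol T c))) c = none := by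
    rw [Function.comp_apply, colEntry]
    split_ifs with h
    · rw [List.getElem?_eq_none_iff]
      have h3 := add_length_barCol hT hL c
      have h4 := lt_rowLen_iff L.lam r c
      have h5 := lt_rowLen_iff O.lam r c
      simp only at h ⊢
      omega
    · rfl
  have n2 : (List.range' 0 p).filterMap (colEntry r ∘
      fun c => (colLen L.lam c, (List.range m).filter (barCol T c))) = [] :=
    List.filterMap_eq_nil_iff.mpr fun c hc => n1 c (by simp at hc; omega)
  have n3 : (List.range' (p + q) (M - p - q)).filterMap (colEntry r ∘
      fun c => (colLen L.lam c, (List.range m).filter (barCol T c))) = [] :=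
    List.filterMap_eq_nil_iff.mpr fun c hc => n1 c (by simp at hc; omega)
  rw [e1, List.filterMap_append, List.filterMap_append, n2, n3, List.nil_append, List.append_nil]
  apply List.filterMap_congr
  intro c hc
  have h4 := lt_rowLen_iff L.lam r c
  have h6 : p ≤ c := by simp at hc; omega
  rw [Function.comp_apply, colEntry, if_pos (by simp only; omega), ← map_barColumn,
    List.getElem?_map]

/-- `T̄` is a skew tableau in the reversed alphabet: its rows increase weakly by `card_bar_anti`,
and its columns end where those of the partition of `O` end, so row reading may be replaced by
column reading. -/
theorem plactic_barWord (hT : T ∈ tableaux L O) (hL : Antitone L.a) :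
    Plactic ((barWord T).map fun i => (Fin.rev i : ℕ))
      ((List.range (univ.sup L.a)).flatMap fun c => colWord m (barCol T c)) := by
  set N := univ.sup L.a with hN
  -- The bound covers the whole diagram and has `N` as a summand, so that the columns from `N` on,
  -- which are empty in `T̄`, can be split off at the end.
  rw [map_barWord hT hL (N + (L.lam.sum + O.lam.sum)) (by omega)]
  refine (plactic_rows_columns ?_ ?_ ?_).trans (.of_eq ?_)
  · rw [List.pairwise_map]
    refine List.Pairwise.imp ?_ (List.pairwise_lt_range (n := N + (L.lam.sum + O.lam.sum)))
    intro c c' hc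
    refine ⟨fun r u v hu hv => ?_, ?_⟩
    · simp only [colEntry] at hu hv
      split_ifs at hu hv with h1 h2
      rw [getElem?_filter_range] at hu hv
      by_contra hvu
      -- Index at least `m - (v + 1)` means reversed letter at most `v`. If `v < u`, these letters
      -- would fill column `c'` down to row `r` but column `c` only above row `r`.
      have h3 := card_bar_anti hT hL hc.le (k := m - (v + 1)) (by omega)
      have e1 := length_filter_barCol T c (u := v + 1) (by omega)
      have e2 := length_filter_barCol T c' (u := v + 1) (by omega)
      have e3 : ((List.range (v + 1)).filter (barCol T c')).length =
          ((List.range v).filter (barCol T c')).length + 1 := by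
        rw [List.range_succ, List.filter_append, List.length_append,
          List.filter_cons_of_pos hv.2.1]
        simp
      have e4 : ((List.range (v + 1)).filter (barCol T c)).length ≤
          ((List.range u).filter (barCol T c)).length :=
        ((List.range_sublist.mpr (by omega)).filter _).length_le
      omega
    · simp only
      rw [add_length_barCol hT hL, add_length_barCol hT hL]
      exact colLen_anti _ hc.le
  · intro x hx
    obtain ⟨c, _, rfl⟩ := List.mem_map.mp hx
    exact List.pairwise_lt_range.filter _
  · intro x hx
    obtain ⟨c, _, rfl⟩ := List.mem_map.mp hx
    simp only
    rw [add_length_barCol hT hL]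
    exact colLen_le_card _ _
  · rw [List.flatMap_map, List.range_add, List.flatMap_append]
    simp only [← List.filter_reverse]
    rw [show (fun c => colWord m (barCol T c)) = fun c => (List.range m).reverse.filter (barCol T c)
      from rfl]
    rw [List.flatMap_map]
    convert List.append_nil _ using 2
    rw [List.flatMap_eq_nil_iff]
    intro c _
    rw [List.filter_eq_nil_iff]
    intro l hl
    simp only [barCol, decide_eq_true_eq, not_and]
    intro h
    exfalso
    have hlm : l < m := by simpa using hl
    rw [revEntry, dif_pos hlm] at h
    have := Finset.le_sup (f := L.a) (Finset.mem_univ (Fin.rev ⟨l, hlm⟩))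
    omega

/-- The word of the complementary tableau followed by the word `u` is plactically equivalent to the
word of the complements of the columns. -/
theorem plactic_barWord_append_uWord (hT : T ∈ tableaux L O) (hL : Antitone L.a) :
    Plactic ((barWord T ++ uWord L.a).map fun i => (Fin.rev i : ℕ))
      (colsWord m ((List.range (univ.sup L.a)).map (compCol T))) := by
  set N := univ.sup L.a with hN
  -- The letters of `u_a` assigned to column `c` are those with `a_i ≤ c`. By dominance they are the
  -- smallest in the reversed alphabet, and none of them is in column `c` of `T`; so they complete
  -- the column of `T̄` to the complement of the column of `T`, in decreasing order.
  have key (c : ℕ) : colWord m (barCol T c) ++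
      (List.range m).reverse.filter (fun l => decide (revEntry L.a l ≤ c)) =
        colWord m (compCol T c) := by
    have h := filter_append_filter_not (P := fun l => decide (c < revEntry L.a l))
      (ls := (List.range m).reverse) (by
        rw [List.pairwise_reverse]
        refine List.Pairwise.imp_of_mem ?_ List.pairwise_lt_range
        intro x y hx hy hxy h
        simp only [List.mem_range, decide_eq_true_eq] at hx hy h ⊢
        exact h.trans_le (revEntry_mono hL hxy.le hy))
    conv_rhs => rw [colWord, ← h, List.filter_append, List.filter_filter, List.filter_filter]
    congr 1
    · rw [colWord]
      apply List.filter_congr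
      intro l _
      simp [barCol, compCol, Bool.and_comm]
    · apply List.filter_congr
      intro l hl
      have hlm : l < m := by simpa using hl
      by_cases h1 : revEntry L.a l ≤ c
      · simp only [h1, decide_true, compCol, not_lt.mpr h1, decide_false, Bool.not_false,
          Bool.and_true]
        symm
        rw [decide_eq_true_eq]
        rintro i hi rfl
        rw [revEntry_rev] at h1
        have := lt_of_mem_colLetters hT hi
        omega
      · simp [h1, not_le.mp h1]
  rw [List.map_append]
  refine ((plactic_barWord hT hL).append_right _).trans ?_
  have hu : (uWord L.a).map (fun i => (Fin.rev i : ℕ)) =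
      (List.range m).reverse.flatMap fun l => List.replicate (N - revEntry L.a l) l := by
    rw [uWord, List.map_flatMap, ← map_rev_finRange, List.flatMap_map]
    congr 1
    funext i
    rw [List.map_replicate, revEntry_rev]
  rw [hu]
  refine (plactic_columns_letters (revEntry L.a) N _ _ fun c hc => ?_).trans (.of_eq ?_)
  · rw [key, colWord]
    exact (List.pairwise_reverse.mpr List.pairwise_lt_range).filter _
  · rw [colsWord, List.flatMap_map]
    congr 1
    funext c
    exact key c

/-- In this form the charge depends on `T` only through the letter sets of its columns, and neither
`lam` nor the shape of `T̄` is visible any more. -/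
theorem barCharge_eq (hT : T ∈ tableaux L O) (hL : Antitone L.a) :
    barCharge (barWord T ++ uWord L.a) =
      wordCharge m (colsWord m ((List.range (univ.sup L.a)).map (compCol T))) := by
  rw [barCharge]
  apply (plactic_barWord_append_uWord hT hL).wordCharge
  intro x hx
  obtain ⟨i, _, rfl⟩ := List.mem_map.mp hx
  exact Fin.is_lt _

end

/-! ## Inserting an empty letter into tableaux -/

theorem rowLen_congr {p q : Multiset ℕ} (h : ∀ c, colLen p c = colLen q c) (r : ℕ) :
    rowLen p r = rowLen q r :=
  eq_of_forall_lt_iff fun c => by rw [lt_rowLen_iff, lt_rowLen_iff, h]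

theorem skewCells_congr {p q o : Multiset ℕ} (h : ∀ c, colLen p c = colLen q c) :
    skewCells p o = skewCells q o := by
  ext ⟨r, c⟩
  rw [mem_skewCells, mem_skewCells, h]

theorem wordCharge_colsWord_range {m : ℕ} {f : ℕ → ℕ → Bool} {N : ℕ}
    (hf : ∀ c, N ≤ c → ∀ l, f c l = true) {M : ℕ} (hM : N ≤ M) :
    wordCharge m (colsWord m ((List.range M).map f)) =
      wordCharge m (colsWord m ((List.range N).map f)) := by
  induction M, hM using Nat.le_induction with
  | base => rfl
  | succ M hM ih =>
    rw [List.range_succ, List.map_append, List.map_singleton, wordCharge_append_full (hf M hM), ih]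

section
variable {m : ℕ} {L O : MPartition m} {L' O' : MPartition (m + 1)} {j : Fin (m + 1)}

/-- The filling with the letters renamed so that the letter `j` does not occur. -/
def liftFilling (j : Fin (m + 1)) (h : skewCells L'.total O'.lam = skewCells L.total O.lam)
    (T : Filling L O) : Filling L' O' := fun x => j.succAbove (T ⟨x.1, h.le x.2⟩)

theorem liftFilling_mem_iff (h : ∀ c, colLen L'.total c = colLen L.total c)
    (hO : O'.lam = O.lam) (hL : ∀ i, L'.a (j.succAbove i) = L.a i) (hj : O'.a j = 0)
    (hb : ∀ i, O'.a (j.succAbove i) = O.a i)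
    (hc : skewCells L'.total O'.lam = skewCells L.total O.lam) (T : Filling L O) :
    liftFilling j hc T ∈ tableaux L' O' ↔ T ∈ tableaux L O := by
  have h3 (i : Fin (m + 1)) : #{x | liftFilling j hc T x = i} = #{x | j.succAbove (T x) = i} := by
    refine Finset.card_bij' (fun x _ => ⟨x.1, hc.le x.2⟩) (fun x _ => ⟨x.1, hc.ge x.2⟩) ?_ ?_ ?_ ?_
    · exact fun x hx => Finset.mem_filter.mpr ⟨Finset.mem_univ _, (Finset.mem_filter.mp hx).2⟩
    · exact fun x hx => Finset.mem_filter.mpr ⟨Finset.mem_univ _, (Finset.mem_filter.mp hx).2⟩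
    · intro x _
      rfl
    · intro x _
      rfl
  rw [mem_tableaux, mem_tableaux]
  refine and_congr (forall_congr' fun r => by rw [rowLen_congr h, hO]) (and_congr ?_ (and_congr ?_
    (and_congr ?_ ?_)))
  · refine ⟨fun H x y hx hy => ?_, fun H x y hx hy => ?_⟩
    · exact (Fin.strictMono_succAbove j).le_iff_le.mp
        (H ⟨x.1, hc.ge x.2⟩ ⟨y.1, hc.ge y.2⟩ hx hy)
    · exact (Fin.strictMono_succAbove j).le_iff_le.mpr (H _ _ hx hy)
  · refine ⟨fun H x y hx hy => ?_, fun H x y hx hy => ?_⟩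
    · exact (Fin.strictMono_succAbove j).lt_iff_lt.mp
        (H ⟨x.1, hc.ge x.2⟩ ⟨y.1, hc.ge y.2⟩ hx hy)
    · exact (Fin.strictMono_succAbove j).lt_iff_lt.mpr (H _ _ hx hy)
  · refine ⟨fun H i => ?_, fun H i => ?_⟩
    · rw [← hb, ← H, h3]
      simp
    · rw [h3]
      rcases Fin.eq_self_or_eq_succAbove j i with rfl | ⟨i, rfl⟩
      · rw [hj]
        simp [Fin.succAbove_ne]
      · rw [hb, ← H]
        simp
  · refine ⟨fun H x => ?_, fun H x => ?_⟩
    · rw [← hL]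
      exact H ⟨x.1, hc.ge x.2⟩
    · rw [liftFilling, hL]
      exact H ⟨x.1, hc.le x.2⟩

/-- The unused letter `j` lies in the complement of every column, and the reversal of an alphabet of
`m + 1` letters sends it to `m - j`. -/
theorem compCol_liftFilling (hc : skewCells L'.total O'.lam = skewCells L.total O.lam)
    (T : Filling L O) (c : ℕ) :
    compCol (liftFilling j hc T) c = insCol (m - j) (compCol T c) := by
  have hmem (i : Fin (m + 1)) :
      i ∈ colLetters (liftFilling j hc T) c ↔ ∃ i' ∈ colLetters T c, j.succAbove i' = i := by
    simp only [mem_colLetters]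
    constructor
    · rintro ⟨x, hx, rfl⟩
      exact ⟨_, ⟨⟨x.1, hc.le x.2⟩, hx, rfl⟩, rfl⟩
    · rintro ⟨_, ⟨x, hx, rfl⟩, rfl⟩
      exact ⟨⟨x.1, hc.ge x.2⟩, hx, rfl⟩
  have hsa (i : Fin m) : ((j.succAbove i : Fin (m + 1)) : ℕ) = if i.1 < j.1 then i.1 else i.1 + 1 := by
    simp only [Fin.succAbove, Fin.lt_def, Fin.val_castSucc]
    split_ifs <;> simp
  funext l
  have key (Q : ℕ → Prop) (e : ∀ i : Fin m, (Fin.rev (j.succAbove i) : ℕ) = l ↔ Q i) :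
      compCol (liftFilling j hc T) c l = true ↔ ∀ i ∈ colLetters T c, ¬ Q i := by
    simp only [compCol, decide_eq_true_eq, hmem]
    constructor
    · intro h i hi hQ
      exact h _ ⟨i, hi, rfl⟩ ((e i).mpr hQ)
    · rintro h _ ⟨i, hi, rfl⟩ hl
      exact h i hi ((e i).mp hl)
  have hrev (i : Fin m) : (Fin.rev i : ℕ) = m - (i + 1) := Fin.val_rev i
  rw [insCol, Bool.eq_iff_iff]
  split_ifs with h1 h2
  · rw [key (fun i => m - (i + 1) = l)]
    · simp only [compCol, decide_eq_true_eq, hrev, ne_eq]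
    · intro i
      rw [Fin.val_rev, hsa]
      split_ifs <;> omega
  · rw [key (fun _ => False)]
    · simp
    · intro i
      rw [Fin.val_rev, hsa]
      split_ifs <;> simp <;> omega
  · rw [key (fun i => m - (i + 1) = l - 1)]
    · simp only [compCol, decide_eq_true_eq, hrev, ne_eq]
    · intro i
      rw [Fin.val_rev, hsa]
      split_ifs <;> omega

/-- The new entry may enlarge the maximum of the composition and so add columns, but these lie
beyond all letters of `T` and are full. Full final columns and a letter inserted everywhere both
leave the charge unchanged. -/
theorem barCharge_liftFilling (hL : ∀ i, L'.a (j.succAbove i) = L.a i) (hd : Antitone L.a)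
    (hd' : Antitone L'.a) (hc : skewCells L'.total O'.lam = skewCells L.total O.lam)
    {T : Filling L O} (hT : T ∈ tableaux L O) (hT' : liftFilling j hc T ∈ tableaux L' O') :
    barCharge (barWord (liftFilling j hc T) ++ uWord L'.a) =
      barCharge (barWord T ++ uWord L.a) := by
  rw [barCharge_eq hT' hd', barCharge_eq hT hd]
  have e : compCol (liftFilling j hc T) = fun c => insCol (m - j) (compCol T c) :=
    funext (compCol_liftFilling hc T)
  rw [e, ← wordCharge_insCol (Nat.sub_le m j), List.map_map]
  apply wordCharge_colsWord_range
  · intro c hN l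
    have hcol : colLetters T c = ∅ := by
      rw [Finset.eq_empty_iff_forall_notMem]
      intro i hi
      have h1 := lt_of_mem_colLetters hT hi
      have h2 := Finset.le_sup (f := L.a) (Finset.mem_univ i)
      omega
    have h1 (l : ℕ) : compCol T c l = true := by simp [compCol, hcol]
    rw [insCol]
    split_ifs
    · exact h1 _
    · rfl
    · exact h1 _
  · refine Finset.sup_le fun i _ => ?_
    rw [← hL]
    exact Finset.le_sup (f := L'.a) (Finset.mem_univ _)

/-- The combinatorial core. Moving the part `a_j` from the composition into the partition keeps the
outer shape, and if `b_j = 0` the fillings correspond to each other by renaming letters. -/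
theorem sum_tableaux_insert (h : ∀ c, colLen L'.total c = colLen L.total c)
    (hO : O'.lam = O.lam) (hL : ∀ i, L'.a (j.succAbove i) = L.a i) (hj : O'.a j = 0)
    (hb : ∀ i, O'.a (j.succAbove i) = O.a i) (hd : Antitone L.a) (hd' : Antitone L'.a) :
    ∑ T ∈ tableaux L' O', tt ^ barCharge (barWord T ++ uWord L'.a) =
      ∑ T ∈ tableaux L O, tt ^ barCharge (barWord T ++ uWord L.a) := by
  have hc : skewCells L'.total O'.lam = skewCells L.total O.lam := by
    rw [hO, skewCells_congr h]
  have hmem := liftFilling_mem_iff h hO hL hj hb hc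
  symm
  refine Finset.sum_bij (fun T _ => liftFilling j hc T) (fun T hT => (hmem T).mpr hT) ?_ ?_ ?_
  · intro T _ T' _ e
    funext x
    have := congrFun e ⟨x.1, hc.ge x.2⟩
    exact Fin.succAbove_right_injective this
  · intro T' hT'
    have hne (x) : T' x ≠ j := by
      intro hx
      have := (mem_tableaux.mp hT').2.2.2.1 j
      rw [hj, Finset.card_eq_zero, Finset.filter_eq_empty_iff] at this
      exact this (Finset.mem_univ x) hx
    choose S hS using fun x => Fin.exists_succAbove_eq (hne x)
    refine ⟨fun x => S ⟨x.1, hc.ge x.2⟩, ?_, ?_⟩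
    · rw [← hmem]
      convert hT'
      funext x
      exact hS x
    · funext x
      exact hS x
  · intro T hT
    rw [barCharge_liftFilling hL hd hd' hc hT ((hmem T).mpr hT)]

end

/-! ## The Hecke algebra -/

/-- The constant power series `t`. -/
noncomputable def tC : PS := MvPowerSeries.C tt

theorem tt_smul (f : PS) : tt • f = tC * f := MvPowerSeries.smul_eq_C_mul _ _

theorem tt_ne_zero : tt ≠ 0 := by
  rw [tt, Ne, FaithfulSMul.algebraMap_eq_zero_iff]
  exact MvPolynomial.X_ne_zero 1

theorem exchange_X (i j : ℕ) :
    exchange i (MvPowerSeries.X j) = MvPowerSeries.X (Equiv.swap i (i + 1) j) :=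
  renameEquiv_X _ _

theorem exchange_X_left (i : ℕ) : exchange i (MvPowerSeries.X i) = MvPowerSeries.X (i + 1) := by
  rw [exchange_X, Equiv.swap_apply_left]

theorem exchange_X_right (i : ℕ) : exchange i (MvPowerSeries.X (i + 1)) = MvPowerSeries.X i := by
  rw [exchange_X, Equiv.swap_apply_right]

theorem exchange_X_of_ne {i j : ℕ} (h1 : j ≠ i) (h2 : j ≠ i + 1) :
    exchange i (MvPowerSeries.X j) = MvPowerSeries.X j := by
  rw [exchange_X, Equiv.swap_apply_of_ne_of_ne h1 h2]

theorem exchange_tC (i : ℕ) : exchange i tC = tC := AlgEquiv.commutes (exchange i) tt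

theorem exchange_exchange (i : ℕ) (f : PS) : exchange i (exchange i f) = f := by
  rw [exchange, ← AlgEquiv.trans_apply, MvPowerSeries.renameEquiv_trans]
  simp

theorem exchange_braid (i : ℕ) (f : PS) :
    exchange i (exchange (i + 1) (exchange i f)) =
      exchange (i + 1) (exchange i (exchange (i + 1) f)) := by
  simp only [exchange, ← AlgEquiv.trans_apply, MvPowerSeries.renameEquiv_trans]
  congr 2
  ext j
  simp only [Equiv.trans_apply, Equiv.swap_apply_def]
  grind

theorem exchange_comm {i j : ℕ} (h : i + 1 < j) (f : PS) :
    exchange i (exchange j f) = exchange j (exchange i f) := by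
  simp only [exchange, ← AlgEquiv.trans_apply, MvPowerSeries.renameEquiv_trans]
  congr 2
  ext k
  simp only [Equiv.trans_apply, Equiv.swap_apply_def]
  grind

/-- The Hecke operator `T_i` on all power series. -/
noncomputable def heckeOp (i : ℕ) (f : PS) : PS :=
  tC * f + (tC * MvPowerSeries.X i - MvPowerSeries.X (i + 1)) * divDiff i f

theorem coe_heckeT {m i : ℕ} (hi : i + 1 < m) (f : R m) :
    (heckeT m i hi f : PS) = heckeOp i f := by
  simp only [heckeT, LinearMap.coe_mk, AddHom.coe_mk, Subalgebra.coe_add, Subalgebra.coe_mul,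
    Subalgebra.coe_sub, Subalgebra.coe_smul, heckeOp, tt_smul]

/-- The form of the definition without denominators. Identities between Hecke operators are verified
after multiplication by differences of variables, which are not zero divisors. -/
theorem X_sub_X_mul_heckeOp (i : ℕ) (f : PS) :
    (MvPowerSeries.X i - MvPowerSeries.X (i + 1)) * heckeOp i f =
      (1 - tC) * MvPowerSeries.X (i + 1) * f +
        (tC * MvPowerSeries.X i - MvPowerSeries.X (i + 1)) * exchange i f := by
  have h := X_sub_X_mul_divDiff i f
  rw [heckeOp]
  linear_combination (tC * MvPowerSeries.X i - MvPowerSeries.X (i + 1)) * h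

theorem X_sub_X_ne_zero' {i j : ℕ} (h : i ≠ j) :
    (MvPowerSeries.X i - MvPowerSeries.X j : PS) ≠ 0 := by
  rw [sub_ne_zero]
  exact fun e => h (MvPowerSeries.X_inj.mp e)

theorem heckeOp_mul_of_exchange_eq {i : ℕ} {g : PS} (hg : exchange i g = g) (f : PS) :
    heckeOp i (f * g) = heckeOp i f * g := by
  apply mul_left_cancel₀ (X_sub_X_ne_zero i)
  have h := X_sub_X_mul_heckeOp i f
  rw [X_sub_X_mul_heckeOp, map_mul, hg]
  linear_combination -g * h

theorem heckeOp_of_exchange_eq {i : ℕ} {g : PS} (hg : exchange i g = g) :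
    heckeOp i g = tC * g := by
  apply mul_left_cancel₀ (X_sub_X_ne_zero i)
  rw [X_sub_X_mul_heckeOp, hg]
  ring

theorem heckeOp_tC_mul (i : ℕ) (f : PS) : heckeOp i (tC * f) = tC * heckeOp i f := by
  rw [mul_comm, heckeOp_mul_of_exchange_eq (exchange_tC i), mul_comm]

theorem heckeOp_add (i : ℕ) (f g : PS) : heckeOp i (f + g) = heckeOp i f + heckeOp i g := by
  rw [heckeOp, heckeOp, heckeOp, divDiff_add]
  ring

/-- The relation `T_i x_i = t x_{i+1} T_i⁻¹`, since `T_i - (t - 1) = t T_i⁻¹` by the quadratic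
relation. -/
theorem heckeOp_X_mul (i : ℕ) (g : PS) : heckeOp i (MvPowerSeries.X i * g) =
    MvPowerSeries.X (i + 1) * (heckeOp i g - (tC - 1) * g) := by
  apply mul_left_cancel₀ (X_sub_X_ne_zero i)
  have h := X_sub_X_mul_heckeOp i g
  rw [X_sub_X_mul_heckeOp, map_mul, exchange_X_left]
  linear_combination -(MvPowerSeries.X (i + 1)) * h

theorem exchange_heckeOp (i : ℕ) (f : PS) :
    (MvPowerSeries.X (i + 1) - MvPowerSeries.X i) * exchange i (heckeOp i f) =
      (1 - tC) * MvPowerSeries.X i * exchange i f +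
        (tC * MvPowerSeries.X (i + 1) - MvPowerSeries.X i) * f := by
  have h := congrArg (exchange i) (X_sub_X_mul_heckeOp i f)
  simpa only [map_mul, map_add, map_sub, map_one, exchange_X_left, exchange_X_right, exchange_tC,
    exchange_exchange] using h

theorem heckeOp_heckeOp (i : ℕ) (f : PS) :
    heckeOp i (heckeOp i f) = (tC - 1) * heckeOp i f + tC * f := by
  apply mul_left_cancel₀ (X_sub_X_ne_zero i)
  apply mul_left_cancel₀ (X_sub_X_ne_zero i)
  have h1 := X_sub_X_mul_heckeOp i f
  have h2 := exchange_heckeOp i f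
  rw [X_sub_X_mul_heckeOp]
  linear_combination ((1 - tC) * MvPowerSeries.X (i + 1) -
    (tC - 1) * (MvPowerSeries.X i - MvPowerSeries.X (i + 1))) * h1
    - (tC * MvPowerSeries.X i - MvPowerSeries.X (i + 1)) * h2

theorem heckeOp_comm {i j : ℕ} (h : i + 1 < j) (f : PS) :
    heckeOp i (heckeOp j f) = heckeOp j (heckeOp i f) := by
  apply mul_left_cancel₀ (X_sub_X_ne_zero i)
  apply mul_left_cancel₀ (X_sub_X_ne_zero j)
  have h1 := congrArg (exchange i) (X_sub_X_mul_heckeOp j f)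
  have h2 := congrArg (exchange j) (X_sub_X_mul_heckeOp i f)
  simp only [map_mul, map_add, map_sub, map_one, exchange_tC, exchange_comm h,
    exchange_X_of_ne (i := i) (j := j) (by omega) (by omega),
    exchange_X_of_ne (i := i) (j := j + 1) (by omega) (by omega),
    exchange_X_of_ne (i := j) (j := i) (by omega) (by omega),
    exchange_X_of_ne (i := j) (j := i + 1) (by omega) (by omega)] at h1 h2
  have h3 := X_sub_X_mul_heckeOp j f
  have h4 := X_sub_X_mul_heckeOp i f
  have h5 := X_sub_X_mul_heckeOp j (heckeOp i f)
  have h6 := X_sub_X_mul_heckeOp i (heckeOp j f)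
  linear_combination (MvPowerSeries.X j - MvPowerSeries.X (j + 1)) * h6
    - (MvPowerSeries.X i - MvPowerSeries.X (i + 1)) * h5
    + (1 - tC) * MvPowerSeries.X (i + 1) * h3
    + (tC * MvPowerSeries.X i - MvPowerSeries.X (i + 1)) * h1
    - (1 - tC) * MvPowerSeries.X (j + 1) * h4
    - (tC * MvPowerSeries.X j - MvPowerSeries.X (j + 1)) * h2

/-- In the fraction field both sides are combinations, with rational coefficients in three variables
and `t`, of the images of `f` under the six permutations of these variables. After the braid
relation of the exchanges, it is an identity of rational functions. -/
theorem heckeOp_braid (i : ℕ) (f : PS) :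
    heckeOp i (heckeOp (i + 1) (heckeOp i f)) =
      heckeOp (i + 1) (heckeOp i (heckeOp (i + 1) f)) := by
  have T0 := X_sub_X_mul_heckeOp i
  have T1 := X_sub_X_mul_heckeOp (i + 1)
  have x00 := exchange_X_left i
  have x01 := exchange_X_right i
  have x02 := exchange_X_of_ne (i := i) (j := i + 1 + 1) (by omega) (by omega)
  have x10 := exchange_X_of_ne (i := i + 1) (j := i) (by omega) (by omega)
  have x11 := exchange_X_left (i + 1)
  have x12 := exchange_X_right (i + 1)
  have c0 := exchange_tC i
  have c1 := exchange_tC (i + 1)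
  have q0 := exchange_exchange i
  have q1 := exchange_exchange (i + 1)
  have br := exchange_braid i f
  have hxy := X_sub_X_ne_zero' (show i ≠ i + 1 by omega)
  have hyz := X_sub_X_ne_zero' (show i + 1 ≠ i + 1 + 1 by omega)
  have hxz := X_sub_X_ne_zero' (show i ≠ i + 1 + 1 by omega)
  generalize (MvPowerSeries.X i : PS) = x at *
  generalize (MvPowerSeries.X (i + 1) : PS) = y at *
  generalize (MvPowerSeries.X (i + 1 + 1) : PS) = z at *
  have a1 := T0 f
  have a2 := congrArg (exchange i) a1
  have a3 := congrArg (exchange (i + 1)) a1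
  have a4 := congrArg (exchange i) a3
  have b1 := T1 f
  have b2 := congrArg (exchange (i + 1)) b1
  have b3 := congrArg (exchange i) b1
  have b4 := congrArg (exchange (i + 1)) b3
  have a5 := T1 (heckeOp i f)
  have a6 := congrArg (exchange i) a5
  have b5 := T0 (heckeOp (i + 1) f)
  have b6 := congrArg (exchange (i + 1)) b5
  have a7 := T0 (heckeOp (i + 1) (heckeOp i f))
  have b7 := T1 (heckeOp i (heckeOp (i + 1) f))
  simp only [map_mul, map_add, map_sub, map_one, c0, c1, x00, x01, x02, x10, x11, x12, q0, q1]
    at a2 a3 a4 b2 b3 b4 a6 b6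
  have inj := IsFractionRing.injective PS (FractionRing PS)
  have ne {u : PS} (h : u ≠ 0) : algebraMap PS (FractionRing PS) u ≠ 0 := by
    rwa [Ne, FaithfulSMul.algebraMap_eq_zero_iff]
  apply inj
  have solve {u v w : PS} (h : u ≠ 0) (e : u * v = w) : algebraMap PS (FractionRing PS) v =
      algebraMap PS (FractionRing PS) w / algebraMap PS (FractionRing PS) u := by
    rw [eq_div_iff (ne h), mul_comm, ← map_mul, e]
  have hyx : y - x ≠ 0 := sub_ne_zero.mpr (sub_ne_zero.mp hxy).symm
  have hzy : z - y ≠ 0 := sub_ne_zero.mpr (sub_ne_zero.mp hyz).symm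
  rw [solve hxy a7, solve hyz b7]
  simp only [map_mul, map_add, map_sub, map_one]
  rw [solve hyz a5, solve hxz a6, solve hxy b5, solve hxz b6]
  simp only [map_mul, map_add, map_sub, map_one]
  rw [solve hxy a1, solve hyx a2, solve hxz a3, solve hyz a4, solve hyz b1, solve hzy b2,
    solve hxz b3, solve hxy b4]
  replace hxy := ne hxy
  replace hyz := ne hyz
  replace hxz := ne hxz
  replace hyx := ne hyx
  replace hzy := ne hzy
  rw [br]
  simp only [map_mul, map_add, map_sub, map_one] at hxy hyz hxz hyx hzy ⊢
  generalize algebraMap PS (FractionRing PS) x = X at *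
  generalize algebraMap PS (FractionRing PS) y = Y at *
  generalize algebraMap PS (FractionRing PS) z = Z at *
  generalize algebraMap PS (FractionRing PS) tC = t at *
  generalize algebraMap PS (FractionRing PS) f = f0
  generalize algebraMap PS (FractionRing PS) (exchange i f) = f1
  generalize algebraMap PS (FractionRing PS) (exchange (i + 1) f) = f2
  generalize algebraMap PS (FractionRing PS) (exchange i (exchange (i + 1) f)) = f3
  generalize algebraMap PS (FractionRing PS) (exchange (i + 1) (exchange i f)) = f4
  generalize algebraMap PS (FractionRing PS) (exchange (i + 1) (exchange i (exchange (i + 1) f))) = f5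
  clear a1 a2 a3 a4 a5 a6 a7 b1 b2 b3 b4 b5 b6 b7 br solve ne inj T0 T1 q0 q1 c0 c1 x00 x01 x02 x10 x11 x12
  have e1 : Y - X = -(X - Y) := by ring
  have e2 : Z - Y = -(Y - Z) := by ring
  rw [e1, e2]
  field_simp
  ring

/-! ## Hecke operators on non-symmetric Hall–Littlewood polynomials -/

theorem swapEntries_left {m : ℕ} (a : Fin m → ℕ) (i : ℕ) (hi : i + 1 < m) :
    swapEntries a i hi ⟨i, Nat.lt_of_succ_lt hi⟩ = a ⟨i + 1, hi⟩ := by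
  simp [swapEntries]

theorem swapEntries_right {m : ℕ} (a : Fin m → ℕ) (i : ℕ) (hi : i + 1 < m) :
    swapEntries a i hi ⟨i + 1, hi⟩ = a ⟨i, Nat.lt_of_succ_lt hi⟩ := by
  simp [swapEntries]

theorem swapEntries_of_ne {m : ℕ} (a : Fin m → ℕ) {i j : ℕ} (hi : i + 1 < m) (hj : j < m)
    (h1 : j ≠ i) (h2 : j ≠ i + 1) : swapEntries a i hi ⟨j, hj⟩ = a ⟨j, hj⟩ := by
  rw [swapEntries, Function.comp_apply, Equiv.swap_apply_of_ne_of_ne] <;> simpa [Fin.ext_iff]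

theorem swapEntries_swapEntries {m : ℕ} (a : Fin m → ℕ) (i : ℕ) (hi : i + 1 < m) :
    swapEntries (swapEntries a i hi) i hi = a := by
  funext j
  simp [swapEntries]

theorem swapEntries_eq_self {m : ℕ} (a : Fin m → ℕ) (i : ℕ) (hi : i + 1 < m)
    (h : a ⟨i, Nat.lt_of_succ_lt hi⟩ = a ⟨i + 1, hi⟩) : swapEntries a i hi = a := by
  funext j
  simp only [swapEntries, Function.comp_apply, Equiv.swap_apply_def]
  split_ifs with h1 h2
  · rw [h1, h]
  · rw [h2, h]
  · rfl

theorem swapEntries_comm {m : ℕ} (a : Fin m → ℕ) {i j : ℕ} (hi : i + 1 < m) (hj : j + 1 < m)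
    (h : i + 1 < j) :
    swapEntries (swapEntries a i hi) j hj = swapEntries (swapEntries a j hj) i hi := by
  funext k
  simp only [swapEntries, Function.comp_apply]
  congr 1
  simp only [Equiv.swap_apply_def, Fin.ext_iff]
  grind

theorem swapEntries_braid {m : ℕ} (a : Fin m → ℕ) {i : ℕ} (hi : i + 1 < m) (hj : i + 1 + 1 < m) :
    swapEntries (swapEntries (swapEntries a i hi) (i + 1) hj) i hi =
      swapEntries (swapEntries (swapEntries a (i + 1) hj) i hi) (i + 1) hj := by
  funext k
  simp only [swapEntries, Function.comp_apply]
  congr 1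
  simp only [Equiv.swap_apply_def, Fin.ext_iff]
  grind

theorem hallLittlewood_find {m : ℕ} (a : Fin m → ℕ) {i : ℕ} (hi : HasAscent a i) :
    ∃ k, ∃ hk : k + 1 < m, a ⟨k, Nat.lt_of_succ_lt hk⟩ < a ⟨k + 1, hk⟩ ∧ k ≤ i ∧
      (hallLittlewood m a : PS) = heckeOp k (hallLittlewood m (swapEntries a k hk)) := by
  classical
  have h : ∃ i, HasAscent a i := ⟨i, hi⟩
  refine ⟨Nat.find h, (Nat.find_spec h).fst, (Nat.find_spec h).snd, Nat.find_min' h hi, ?_⟩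
  rw [hallLittlewood, dif_pos h, coe_heckeT]

/-- The defining relation of the non-symmetric Hall–Littlewood polynomials at any ascent. -/
theorem hallLittlewood_ascent {m : ℕ} (a : Fin m → ℕ) {i : ℕ} (hi : i + 1 < m)
    (h : a ⟨i, Nat.lt_of_succ_lt hi⟩ < a ⟨i + 1, hi⟩) :
    (hallLittlewood m a : PS) = heckeOp i (hallLittlewood m (swapEntries a i hi)) := by
  induction hn : inv a using Nat.strong_induction_on generalizing a i with
  | _ n ih =>
  obtain ⟨k, hk, h1, h2, h3⟩ := hallLittlewood_find a ⟨hi, h⟩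
  rcases h2.eq_or_lt with rfl | h2
  · exact h3
  have ik := inv_swapEntries_lt a k hk h1
  have ii := inv_swapEntries_lt a i hi h
  rw [h3]
  -- Confluence of two reductions. Distant ascents commute; adjacent ones give `a_k < a_{k+1} <
  -- a_{k+2}`, and both reductions continue to the same composition by the braid relation.
  rcases Nat.lt_or_ge (k + 1) i with h4 | h4
  · rw [ih _ (hn ▸ ik) (swapEntries a k hk) hi (by
      rwa [swapEntries_of_ne _ _ _ (by omega) (by omega),
        swapEntries_of_ne _ _ _ (by omega) (by omega)]) rfl,
      ih _ (hn ▸ ii) (swapEntries a i hi) hk (by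
      rwa [swapEntries_of_ne _ _ _ (by omega) (by omega),
        swapEntries_of_ne _ _ _ (by omega) (by omega)]) rfl,
      heckeOp_comm h4, swapEntries_comm a hk hi h4]
  · obtain rfl : i = k + 1 := by omega
    have g1 : swapEntries a k hk ⟨k + 1, by omega⟩ < swapEntries a k hk ⟨k + 1 + 1, hi⟩ := by
      rw [swapEntries_right, swapEntries_of_ne _ _ _ (by omega) (by omega)]
      exact h1.trans h
    have g2 : swapEntries a (k + 1) hi ⟨k, by omega⟩ < swapEntries a (k + 1) hi ⟨k + 1, hk⟩ := by
      rw [swapEntries_left, swapEntries_of_ne _ _ _ (by omega) (by omega)]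
      exact h1.trans h
    have j1 := inv_swapEntries_lt _ _ _ g1
    have j2 := inv_swapEntries_lt _ _ _ g2
    rw [ih _ (hn ▸ ik) _ hi g1 rfl, ih _ (hn ▸ ii) _ hk g2 rfl,
      ih _ (by omega) (swapEntries (swapEntries a k hk) (k + 1) hi) hk (by
        rw [swapEntries_of_ne _ _ _ (by omega) (by omega), swapEntries_left, swapEntries_left,
          swapEntries_of_ne _ _ _ (by omega) (by omega)]
        exact h) rfl,
      ih _ (by omega) (swapEntries (swapEntries a (k + 1) hi) k hk) hi (by
        rw [swapEntries_right, swapEntries_of_ne _ _ _ (by omega) (by omega),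
          swapEntries_of_ne _ _ _ (by omega) (by omega), swapEntries_right]
        exact h1) rfl,
      heckeOp_braid, swapEntries_braid]

theorem hallLittlewood_of_not_ascent {m : ℕ} (a : Fin m → ℕ) (h : ¬ ∃ i, HasAscent a i) :
    (hallLittlewood m a : PS) = ∏ j : Fin m, (MvPowerSeries.X (j : ℕ) : PS) ^ a j := by
  rw [hallLittlewood, dif_neg h]
  simp

theorem exchange_prod_X_pow {m i : ℕ} (hi : i + 1 < m) (a : Fin m → ℕ) :
    exchange i (∏ j : Fin m, (MvPowerSeries.X (j : ℕ) : PS) ^ a j) =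
      ∏ j : Fin m, (MvPowerSeries.X (j : ℕ) : PS) ^ swapEntries a i hi j := by
  rw [map_prod, ← Equiv.prod_comp (Equiv.swap (⟨i, by omega⟩ : Fin m) ⟨i + 1, hi⟩)]
  refine Finset.prod_congr rfl fun j _ => ?_
  rw [map_pow, exchange_X, swapEntries, Function.comp_apply]
  congr 2
  simp only [Equiv.swap_apply_def, Fin.ext_iff]
  split_ifs <;> simp_all

/-- If `a` is dominant the monomial is symmetric in the two variables. Otherwise an ascent is
removed: if it is not adjacent the operators commute, and if it is adjacent the braid relation moves
the pair of equal entries by one place, where induction applies. -/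
theorem heckeOp_hallLittlewood_of_eq {m : ℕ} (a : Fin m → ℕ) {i : ℕ} (hi : i + 1 < m)
    (h : a ⟨i, Nat.lt_of_succ_lt hi⟩ = a ⟨i + 1, hi⟩) :
    heckeOp i (hallLittlewood m a) = tC * hallLittlewood m a := by
  induction hn : inv a using Nat.strong_induction_on generalizing a i with
  | _ n ih =>
  by_cases hd : ∃ k, HasAscent a k
  · obtain ⟨k, hk, h1⟩ := hd
    have ik := inv_swapEntries_lt a k hk h1
    have hki : k ≠ i := by
      rintro rfl
      exact h1.ne h
    rw [hallLittlewood_ascent a hk h1]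
    rcases Nat.lt_or_ge (k + 1) i with h4 | h4
    · rw [← heckeOp_comm h4, ih _ (hn ▸ ik) _ hi (by
        rwa [swapEntries_of_ne _ _ _ (by omega) (by omega),
          swapEntries_of_ne _ _ _ (by omega) (by omega)]) rfl, heckeOp_tC_mul]
    rcases Nat.lt_or_ge (i + 1) k with h5 | h5
    · rw [heckeOp_comm h5, ih _ (hn ▸ ik) _ hi (by
        rwa [swapEntries_of_ne _ _ _ (by omega) (by omega),
          swapEntries_of_ne _ _ _ (by omega) (by omega)]) rfl, heckeOp_tC_mul]
    rcases lt_or_gt_of_ne hki with h6 | h6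
    · obtain rfl : i = k + 1 := by omega
      have g1 : swapEntries a k hk ⟨k + 1, by omega⟩ < swapEntries a k hk ⟨k + 1 + 1, hi⟩ := by
        rw [swapEntries_right, swapEntries_of_ne _ _ _ (by omega) (by omega)]
        exact h1.trans_eq h
      have j1 := inv_swapEntries_lt _ _ _ g1
      rw [hallLittlewood_ascent _ hi g1, ← heckeOp_braid, ih _ (by omega) _ hk (by
        rw [swapEntries_of_ne _ _ _ (by omega) (by omega), swapEntries_left, swapEntries_left,
          swapEntries_of_ne _ _ _ (by omega) (by omega)]
        exact h) rfl, heckeOp_tC_mul, heckeOp_tC_mul]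
    · obtain rfl : k = i + 1 := by omega
      have g1 : swapEntries a (i + 1) hk ⟨i, by omega⟩ < swapEntries a (i + 1) hk ⟨i + 1, hi⟩ := by
        rw [swapEntries_left, swapEntries_of_ne _ _ _ (by omega) (by omega)]
        exact h.trans_lt h1
      have j1 := inv_swapEntries_lt _ _ _ g1
      rw [hallLittlewood_ascent _ hi g1, heckeOp_braid, ih _ (by omega) _ hk (by
        rw [swapEntries_right, swapEntries_of_ne _ _ _ (by omega) (by omega),
          swapEntries_of_ne _ _ _ (by omega) (by omega), swapEntries_right]
        exact h) rfl, heckeOp_tC_mul, heckeOp_tC_mul]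
  · rw [hallLittlewood_of_not_ascent a hd]
    apply heckeOp_of_exchange_eq
    rw [exchange_prod_X_pow hi, swapEntries_eq_self a i hi h]

theorem heckeOp_hallLittlewood_of_gt {m : ℕ} (a : Fin m → ℕ) {i : ℕ} (hi : i + 1 < m)
    (h : a ⟨i + 1, hi⟩ < a ⟨i, Nat.lt_of_succ_lt hi⟩) :
    heckeOp i (hallLittlewood m a) = hallLittlewood m (swapEntries a i hi) := by
  rw [hallLittlewood_ascent (swapEntries a i hi) hi
    (by rwa [swapEntries_left, swapEntries_right]), swapEntries_swapEntries]

theorem heckeOp_hallLittlewood_of_lt {m : ℕ} (a : Fin m → ℕ) {i : ℕ} (hi : i + 1 < m)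
    (h : a ⟨i, Nat.lt_of_succ_lt hi⟩ < a ⟨i + 1, hi⟩) :
    heckeOp i (hallLittlewood m a) =
      (tC - 1) * hallLittlewood m a + tC * hallLittlewood m (swapEntries a i hi) := by
  conv_lhs => rw [hallLittlewood_ascent a hi h, heckeOp_heckeOp, ← hallLittlewood_ascent a hi h]

/-! ### The Hecke operators on the functions `k_L` -/

theorem exchange_of_mem_R_zero {f : PS} (hf : f ∈ R 0) (i : ℕ) : exchange i f = f :=
  hf.2 _ fun _ hj => absurd hj (Nat.not_lt_zero _)

theorem swap_swap {m : ℕ} (L : MPartition m) {i : ℕ} (hi : i + 1 < m) :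
    (L.swap i hi).swap i hi = L :=
  MPartition.ext (swapEntries_swapEntries L.a i hi) rfl

theorem coe_k {m : ℕ} (L : MPartition m) :
    (k L : PS) = hallLittlewood m L.a * classicalSchur L.lam := rfl

theorem heckeT_k_of_eq {m : ℕ} (L : MPartition m) {i : ℕ} (hi : i + 1 < m)
    (h : L.a ⟨i, Nat.lt_of_succ_lt hi⟩ = L.a ⟨i + 1, hi⟩) : heckeT m i hi (k L) = tt • k L := by
  apply Subtype.ext
  rw [coe_heckeT, Subalgebra.coe_smul, tt_smul, coe_k,
    heckeOp_mul_of_exchange_eq (exchange_of_mem_R_zero (Subtype.prop _) i),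
    heckeOp_hallLittlewood_of_eq L.a hi h, mul_assoc]

theorem heckeT_k_of_gt {m : ℕ} (L : MPartition m) {i : ℕ} (hi : i + 1 < m)
    (h : L.a ⟨i + 1, hi⟩ < L.a ⟨i, Nat.lt_of_succ_lt hi⟩) :
    heckeT m i hi (k L) = k (L.swap i hi) := by
  apply Subtype.ext
  rw [coe_heckeT, coe_k, heckeOp_mul_of_exchange_eq (exchange_of_mem_R_zero (Subtype.prop _) i),
    heckeOp_hallLittlewood_of_gt L.a hi h, coe_k]
  rfl

theorem heckeT_k_of_lt {m : ℕ} (L : MPartition m) {i : ℕ} (hi : i + 1 < m)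
    (h : L.a ⟨i, Nat.lt_of_succ_lt hi⟩ < L.a ⟨i + 1, hi⟩) :
    heckeT m i hi (k L) = (tt - 1) • k L + tt • k (L.swap i hi) := by
  apply Subtype.ext
  rw [coe_heckeT, Subalgebra.coe_add, Subalgebra.coe_smul, Subalgebra.coe_smul, sub_smul, one_smul,
    tt_smul, tt_smul, coe_k, heckeOp_mul_of_exchange_eq (exchange_of_mem_R_zero (Subtype.prop _) i),
    heckeOp_hallLittlewood_of_lt L.a hi h, coe_k]
  change _ = _ + tC * (↑(hallLittlewood m (swapEntries L.a i hi)) * ↑(classicalSchur L.lam))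
  ring

/-! ## Monomials and non-symmetric Hall–Littlewood polynomials -/

theorem heckeOp_X_pow (i r : ℕ) : heckeOp i (MvPowerSeries.X i ^ (r + 1)) =
    MvPowerSeries.X (i + 1) ^ (r + 1) + (1 - tC) *
      ∑ k ∈ range r, MvPowerSeries.X i ^ (k + 1) * MvPowerSeries.X (i + 1) ^ (r - k) := by
  induction r with
  | zero =>
    have h1 : heckeOp i 1 = tC * 1 := heckeOp_of_exchange_eq (map_one _)
    have h2 := heckeOp_X_mul i 1
    rw [h1] at h2
    simp only [zero_add, pow_one, range_zero, sum_empty, mul_zero, add_zero]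
    rw [mul_one] at h2
    rw [h2]
    ring
  | succ r ih =>
    rw [pow_succ', heckeOp_X_mul, ih, Finset.sum_range_succ]
    have : ∑ k ∈ range r, (MvPowerSeries.X i : PS) ^ (k + 1) * MvPowerSeries.X (i + 1) ^ (r + 1 - k)
        = MvPowerSeries.X (i + 1) *
          ∑ k ∈ range r, MvPowerSeries.X i ^ (k + 1) * MvPowerSeries.X (i + 1) ^ (r - k) := by
      rw [Finset.mul_sum]
      refine Finset.sum_congr rfl fun k hk => ?_
      have := Finset.mem_range.mp hk
      rw [Nat.succ_sub this.le, pow_succ _ (r - k)]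
      ring
    rw [this, show r + 1 - r = 1 by omega]
    ring

/-- Apart from the exchanged monomial, all terms have exponents strictly between `q` and `p` with
the same sum, hence a smaller sum of squares. This is the measure for which the `H_a` are
triangular. -/
theorem heckeOp_monomial_sub_mem (W : Submodule Qqt PS) (i : ℕ) {g : PS} (hg : exchange i g = g)
    {p q : ℕ} (hpq : q < p)
    (hW : ∀ u v, u + v = p + q → u ^ 2 + v ^ 2 < p ^ 2 + q ^ 2 →
      MvPowerSeries.X i ^ u * MvPowerSeries.X (i + 1) ^ v * g ∈ W) :
    heckeOp i (MvPowerSeries.X i ^ p * MvPowerSeries.X (i + 1) ^ q * g) -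
      MvPowerSeries.X i ^ q * MvPowerSeries.X (i + 1) ^ p * g ∈ W := by
  obtain ⟨r, rfl⟩ := Nat.exists_eq_add_of_lt hpq
  have e1 : (MvPowerSeries.X i : PS) ^ (q + r + 1) * MvPowerSeries.X (i + 1) ^ q * g =
      MvPowerSeries.X i ^ (r + 1) * ((MvPowerSeries.X i * MvPowerSeries.X (i + 1)) ^ q * g) := by
    rw [mul_pow]
    ring
  have e2 : exchange i ((MvPowerSeries.X i * MvPowerSeries.X (i + 1)) ^ q * g) =
      (MvPowerSeries.X i * MvPowerSeries.X (i + 1)) ^ q * g := by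
    rw [map_mul, map_pow, map_mul, exchange_X_left, exchange_X_right, hg, mul_comm]
    ring
  have e3 : (1 - tC : PS) * (∑ k ∈ range r,
        MvPowerSeries.X i ^ (k + 1) * MvPowerSeries.X (i + 1) ^ (r - k)) *
      ((MvPowerSeries.X i * MvPowerSeries.X (i + 1)) ^ q * g) = (1 - tt) • ∑ k ∈ range r,
        MvPowerSeries.X i ^ (q + k + 1) * MvPowerSeries.X (i + 1) ^ (q + (r - k)) * g := by
    rw [sub_smul, one_smul, tt_smul, ← one_sub_mul, mul_assoc, Finset.sum_mul]
    congr 1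
    refine Finset.sum_congr rfl fun k _ => ?_
    rw [mul_pow]
    ring
  rw [e1, heckeOp_mul_of_exchange_eq e2, heckeOp_X_pow, add_mul, e3]
  have e4 : (MvPowerSeries.X (i + 1) : PS) ^ (r + 1) *
      ((MvPowerSeries.X i * MvPowerSeries.X (i + 1)) ^ q * g) =
      MvPowerSeries.X i ^ q * MvPowerSeries.X (i + 1) ^ (q + r + 1) * g := by
    rw [mul_pow]
    ring
  rw [e4, add_sub_cancel_left]
  refine W.smul_mem _ (W.sum_mem fun k hk => hW _ _ ?_ ?_)
  · have := Finset.mem_range.mp hk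
    omega
  · have := Finset.mem_range.mp hk
    obtain ⟨s, rfl⟩ := Nat.exists_eq_add_of_lt this
    rw [show k + s + 1 - k = s + 1 by omega]
    -- The two sums of squares differ by `2 (k + 1) (s + 1)`.
    nlinarith [Nat.zero_le (k * s)]

theorem heckeOp_monomial_mem (W : Submodule Qqt PS) (i : ℕ) {g : PS} (hg : exchange i g = g)
    (p q : ℕ) (hW : ∀ u v, u + v = p + q → u ^ 2 + v ^ 2 ≤ p ^ 2 + q ^ 2 →
      MvPowerSeries.X i ^ u * MvPowerSeries.X (i + 1) ^ v * g ∈ W) :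
    heckeOp i (MvPowerSeries.X i ^ p * MvPowerSeries.X (i + 1) ^ q * g) ∈ W := by
  have key {p q : ℕ} (h : q < p) (hW : ∀ u v, u + v = p + q → u ^ 2 + v ^ 2 ≤ p ^ 2 + q ^ 2 →
      MvPowerSeries.X i ^ u * MvPowerSeries.X (i + 1) ^ v * g ∈ W) :
      heckeOp i (MvPowerSeries.X i ^ p * MvPowerSeries.X (i + 1) ^ q * g) ∈ W := by
    have h1 := heckeOp_monomial_sub_mem W i hg h fun u v e h => hW u v e h.le
    have h2 := hW q p (add_comm _ _) (add_comm _ _).le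
    simpa using W.add_mem h1 h2
  have hswap (u v : ℕ) : exchange i (MvPowerSeries.X i ^ u * MvPowerSeries.X (i + 1) ^ v * g) =
      MvPowerSeries.X i ^ v * MvPowerSeries.X (i + 1) ^ u * g := by
    rw [map_mul, map_mul, map_pow, map_pow, exchange_X_left, exchange_X_right, hg]
    ring
  rcases lt_trichotomy p q with h | rfl | h
  -- For `p < q` the monomial plus its exchange is symmetric, so the operator multiplies the sum by
  -- `t`; this reduces to the exchanged monomial, whose first exponent is the larger one.
  · have h1 := key h fun u v e h => hW u v (by omega) (by omega)
    have h2 := heckeOp_of_exchange_eq (i := i)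
      (g := MvPowerSeries.X i ^ q * MvPowerSeries.X (i + 1) ^ p * g +
        MvPowerSeries.X i ^ p * MvPowerSeries.X (i + 1) ^ q * g)
      (by rw [map_add, hswap, hswap, add_comm])
    rw [heckeOp_add, ← eq_sub_iff_add_eq'] at h2
    rw [h2, ← tt_smul]
    exact W.sub_mem (W.smul_mem _ (W.add_mem (hW _ _ (by omega) (by omega))
      (hW _ _ rfl le_rfl))) h1
  · rw [heckeOp_of_exchange_eq (hswap _ _), ← tt_smul]
    exact W.smul_mem _ (hW _ _ rfl le_rfl)
  · exact key h hW

/-- The monomial `x^a` in the variables `x_1, …, x_m`. -/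
noncomputable def xPow {m : ℕ} (a : Fin m → ℕ) : PS := ∏ j : Fin m, MvPowerSeries.X (j : ℕ) ^ a j

/-- The span of the monomials `x^b` of degree `n` with `∑ b_i² < N`. -/
noncomputable def xPowSpan (m n N : ℕ) : Submodule Qqt PS :=
  Submodule.span Qqt {f | ∃ b : Fin m → ℕ, ∑ i, b i = n ∧ ∑ i, b i ^ 2 < N ∧ f = xPow b}

theorem xPow_mem {m n N : ℕ} {b : Fin m → ℕ} (h1 : ∑ i, b i = n) (h2 : ∑ i, b i ^ 2 < N) :
    xPow b ∈ xPowSpan m n N := Submodule.subset_span ⟨b, h1, h2, rfl⟩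

theorem exists_xPow_eq {m i : ℕ} (hi : i + 1 < m) (b : Fin m → ℕ) : ∃ g : PS, exchange i g = g ∧
    xPow b = MvPowerSeries.X i ^ b ⟨i, by omega⟩ * MvPowerSeries.X (i + 1) ^ b ⟨i + 1, hi⟩ * g ∧
    ∀ u v, ∃ c : Fin m → ℕ, c ⟨i, by omega⟩ = u ∧ c ⟨i + 1, hi⟩ = v ∧
      xPow c = MvPowerSeries.X i ^ u * MvPowerSeries.X (i + 1) ^ v * g ∧
      (∑ j, c j) + b ⟨i, by omega⟩ + b ⟨i + 1, hi⟩ = ∑ j, b j + u + v ∧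
      (∑ j, c j ^ 2) + b ⟨i, by omega⟩ ^ 2 + b ⟨i + 1, hi⟩ ^ 2 = ∑ j, b j ^ 2 + u ^ 2 + v ^ 2 := by
  set x : Fin m := ⟨i, by omega⟩ with hx
  set y : Fin m := ⟨i + 1, hi⟩ with hy
  have hxy : y ≠ x := by simp [hx, hy]
  have split {M : Type} [CommMonoid M] (f : Fin m → M) :
      ∏ j, f j = f x * f y * ∏ j ∈ (univ.erase x).erase y, f j := by
    rw [← Finset.mul_prod_erase univ f (Finset.mem_univ x),
      ← Finset.mul_prod_erase (univ.erase x) f (Finset.mem_erase.mpr ⟨hxy, Finset.mem_univ y⟩),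
      mul_assoc]
  have splitAdd (f : Fin m → ℕ) :
      ∑ j, f j = f x + f y + ∑ j ∈ (univ.erase x).erase y, f j := by
    rw [← Finset.add_sum_erase univ f (Finset.mem_univ x),
      ← Finset.add_sum_erase (univ.erase x) f (Finset.mem_erase.mpr ⟨hxy, Finset.mem_univ y⟩),
      add_assoc]
  refine ⟨∏ j ∈ (univ.erase x).erase y, MvPowerSeries.X (j : ℕ) ^ b j, ?_, ?_, fun u v => ?_⟩
  · rw [map_prod]
    refine Finset.prod_congr rfl fun j hj => ?_
    simp only [Finset.mem_erase, hx, hy, ne_eq, Fin.ext_iff] at hj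
    rw [map_pow, exchange_X_of_ne hj.2.1 hj.1]
  · exact split _
  · have hc (j) (hj : j ∈ (univ.erase x).erase y) :
        Function.update (Function.update b x u) y v j = b j := by
      simp only [Finset.mem_erase] at hj
      rw [Function.update_of_ne hj.1, Function.update_of_ne hj.2.1]
    have hcx : Function.update (Function.update b x u) y v x = u := by
      rw [Function.update_of_ne hxy.symm, Function.update_self]
    have hcy : Function.update (Function.update b x u) y v y = v := Function.update_self _ _ _
    refine ⟨Function.update (Function.update b x u) y v, hcx, hcy, ?_, ?_, ?_⟩
    · rw [xPow, split, hcx, hcy]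
      congr 1
      exact Finset.prod_congr rfl fun j hj => by rw [hc j hj]
    · rw [splitAdd, splitAdd b, hcx, hcy, Finset.sum_congr rfl hc]
      ring
    · rw [splitAdd, splitAdd (fun j => b j ^ 2), hcx, hcy,
        Finset.sum_congr rfl fun j hj => by rw [hc j hj]]
      ring

theorem heckeOp_mem_xPowSpan {m n N i : ℕ} (hi : i + 1 < m) {f : PS} (hf : f ∈ xPowSpan m n N) :
    heckeOp i f ∈ xPowSpan m n N := by
  induction hf using Submodule.span_induction with
  | mem f hf =>
    obtain ⟨b, h1, h2, rfl⟩ := hf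
    obtain ⟨g, hg, e, h⟩ := exists_xPow_eq hi b
    rw [e]
    refine heckeOp_monomial_mem _ i hg _ _ fun u v h3 h4 => ?_
    obtain ⟨c, -, -, hc1, hc2, hc3⟩ := h u v
    rw [← hc1]
    exact xPow_mem (by omega) (by omega)
  | zero =>
    rw [heckeOp_of_exchange_eq (map_zero _), mul_zero]
    exact zero_mem _
  | add f g _ _ hf hg =>
    rw [heckeOp_add]
    exact add_mem hf hg
  | smul c f _ hf =>
    have : heckeOp i (c • f) = c • heckeOp i f := by
      rw [MvPowerSeries.smul_eq_C_mul, MvPowerSeries.smul_eq_C_mul, mul_comm,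
        heckeOp_mul_of_exchange_eq (show exchange i (MvPowerSeries.C c) = MvPowerSeries.C c from
          AlgEquiv.commutes (exchange i) c), mul_comm]
    rw [this]
    exact Submodule.smul_mem _ _ hf

theorem sum_swapEntries {m i : ℕ} (hi : i + 1 < m) (a : Fin m → ℕ) (F : ℕ → ℕ) :
    ∑ j, F (swapEntries a i hi j) = ∑ j, F (a j) :=
  Equiv.sum_comp (Equiv.swap (⟨i, by omega⟩ : Fin m) ⟨i + 1, hi⟩) fun j => F (a j)

/-- Unitriangularity of the `H_a` in the monomials. At each ascent, the operator exchanges the two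
exponents in the leading monomial up to terms with smaller sum of squares, and it preserves the span
of those terms. -/
theorem hallLittlewood_sub_xPow_mem {m : ℕ} (a : Fin m → ℕ) :
    (hallLittlewood m a : PS) - xPow a ∈ xPowSpan m (∑ i, a i) (∑ i, a i ^ 2) := by
  induction hn : inv a using Nat.strong_induction_on generalizing a with
  | _ n ih =>
  by_cases hd : ∃ k, HasAscent a k
  · obtain ⟨i, hi, h⟩ := hd
    have h1 := ih _ (hn ▸ inv_swapEntries_lt a i hi h) (swapEntries a i hi) rfl
    rw [sum_swapEntries hi a (fun x => x), sum_swapEntries hi a (fun x => x ^ 2)] at h1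
    have h2 := heckeOp_mem_xPowSpan hi h1
    have h3 : heckeOp i (xPow (swapEntries a i hi)) - xPow a ∈
        xPowSpan m (∑ i, a i) (∑ i, a i ^ 2) := by
      obtain ⟨g, hg, e, hc⟩ := exists_xPow_eq hi (swapEntries a i hi)
      have e' : xPow a = MvPowerSeries.X i ^ a ⟨i, by omega⟩ *
          MvPowerSeries.X (i + 1) ^ a ⟨i + 1, hi⟩ * g := by
        have h4 := exchange_prod_X_pow hi (swapEntries a i hi)
        rw [swapEntries_swapEntries] at h4
        change exchange i (xPow _) = xPow a at h4
        rw [← h4, e, map_mul, map_mul, map_pow, map_pow, exchange_X_left, exchange_X_right, hg,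
          swapEntries_left, swapEntries_right]
        ring
      rw [e, e', swapEntries_left, swapEntries_right]
      rw [swapEntries_left, swapEntries_right, sum_swapEntries hi a (fun x => x),
        sum_swapEntries hi a (fun x => x ^ 2)] at hc
      refine heckeOp_monomial_sub_mem _ i hg h fun u v h5 h6 => ?_
      obtain ⟨c, -, -, hc1, hc2, hc3⟩ := hc u v
      rw [← hc1]
      exact xPow_mem (by omega) (by omega)
    rw [hallLittlewood_ascent a hi h]
    have h4 := heckeOp_add i ((hallLittlewood m (swapEntries a i hi) : PS) -
      xPow (swapEntries a i hi)) (xPow (swapEntries a i hi))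
    rw [sub_add_cancel] at h4
    rw [h4, add_sub_assoc]
    exact add_mem h2 h3
  · rw [hallLittlewood_of_not_ascent a hd, xPow, sub_self]
    exact zero_mem _

theorem xPow_mem_span_hallLittlewood {m : ℕ} (a : Fin m → ℕ) : xPow a ∈ Submodule.span Qqt
    {f : PS | ∃ b : Fin m → ℕ, ∑ i, b i = ∑ i, a i ∧ f = hallLittlewood m b} := by
  induction hn : ∑ i, a i ^ 2 using Nat.strong_induction_on generalizing a with
  | _ n ih =>
  have h1 := hallLittlewood_sub_xPow_mem a
  have h2 : (hallLittlewood m a : PS) ∈ Submodule.span Qqt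
      {f : PS | ∃ b : Fin m → ℕ, ∑ i, b i = ∑ i, a i ∧ f = hallLittlewood m b} :=
    Submodule.subset_span ⟨a, rfl, rfl⟩
  have h3 : xPowSpan m (∑ i, a i) (∑ i, a i ^ 2) ≤ Submodule.span Qqt
      {f : PS | ∃ b : Fin m → ℕ, ∑ i, b i = ∑ i, a i ∧ f = hallLittlewood m b} := by
    refine Submodule.span_le.mpr ?_
    rintro _ ⟨b, hb1, hb2, rfl⟩
    have := ih _ (hn ▸ hb2) b rfl
    rwa [hb1] at this
  simpa using sub_mem h2 (h3 h1)

/-! ## Spanning sets of the ring of symmetric functions -/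

theorem completeHom_zero : completeHom 0 = 1 := by
  apply Subtype.ext
  ext d
  change MvPowerSeries.coeff d (completeHomSeries 0) = MvPowerSeries.coeff d (1 : PS)
  rw [coeff_completeHomSeries, MvPowerSeries.coeff_one]
  simp only [Finsupp.degree_eq_zero_iff]

/-- The product `h_μ` of complete homogeneous symmetric functions. -/
noncomputable def homProd (μ : Multiset ℕ) : R 0 := (μ.map completeHom).prod

theorem homProd_filter (μ : Multiset ℕ) : homProd (μ.filter (· ≠ 0)) = homProd μ := by
  induction μ using Multiset.induction_on with
  | empty => rfl
  | cons x μ ih =>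
    by_cases hx : x = 0
    · rw [Multiset.filter_cons_of_neg (p := (· ≠ 0)) _ (by simpa using hx), ih, homProd, homProd,
        Multiset.map_cons, Multiset.prod_cons, hx, completeHom_zero, one_mul]
    · rw [Multiset.filter_cons_of_pos (p := (· ≠ 0)) _ hx, homProd, homProd, Multiset.map_cons,
        Multiset.prod_cons, Multiset.map_cons, Multiset.prod_cons]
      exact congrArg _ ih

theorem map_rowLen (μ : Multiset ℕ) :
    (univ : Finset (Fin μ.card)).val.map (fun i : Fin μ.card => rowLen μ i) = μ := by
  conv_rhs => rw [← Multiset.sort_eq μ (· ≥ ·)]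
  rw [Fin.univ_val_map]
  congr 1
  apply List.ext_getElem
  · simp
  · intro i h1 h2
    simp [rowLen]

theorem sum_rowLen (μ : Multiset ℕ) (F : ℕ → ℕ) :
    ∑ i : Fin μ.card, F (rowLen μ i) = (μ.map F).sum := by
  conv_rhs => rw [← map_rowLen μ, Multiset.map_map]
  rfl

theorem rowLen_anti (μ : Multiset ℕ) : Antitone (rowLen μ) := by
  intro r s h
  by_contra hlt
  rw [not_le, lt_rowLen_iff] at hlt
  have := (lt_rowLen_iff μ r (rowLen μ r)).mpr (by omega)
  omega

/-- With `c_i = r_i - i` the squares are `(c_{σ i} + i)²`, so only `∑ i c_{σ i}` depends on `σ`. As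
`c` is strictly decreasing, the rearrangement inequality makes this sum minimal at the identity
only. -/
theorem sum_sq_lt_of_perm {n : ℕ} {r : Fin n → ℤ} (hr : Antitone r) {σ : Equiv.Perm (Fin n)}
    (hσ : σ ≠ 1) : ∑ i, r i ^ 2 < ∑ i : Fin n, (r (σ i) - (σ i : ℤ) + (i : ℤ)) ^ 2 := by
  set c : Fin n → ℤ := fun i => r i - (i : ℤ) with hc
  have hanti : StrictAnti c := fun i j h => by
    have := hr h.le
    have : (i : ℤ) < (j : ℤ) := by exact_mod_cast h
    simp only [hc]
    omega
  have h1 : Antivary (fun i : Fin n => (i : ℤ)) c := by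
    intro i j h
    have := hanti.lt_iff_gt.mp h
    exact Int.ofNat_le.mpr (show (j : ℕ) ≤ i from this.le)
  have h2 : ∑ i : Fin n, (i : ℤ) * c i < ∑ i : Fin n, (i : ℤ) * c (σ i) := by
    refine h1.sum_smul_lt_sum_smul_comp_perm_iff.mpr fun h => ?_
    apply hσ
    have hm : Monotone σ := by
      intro i j hij
      by_contra hlt
      have h3 := h (i := i) (j := j) (hanti (not_le.mp hlt))
      have : j ≤ i := Int.ofNat_le.mp h3
      exact hlt (by rw [le_antisymm hij this])
    have hs : StrictMono σ := hm.strictMono_of_injective σ.injective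
    ext i
    have := congrFun ((hs.range_inj strictMono_id).mp (by simp)) i
    simp [this]
  have h3 : ∑ i, c (σ i) ^ 2 = ∑ i, c i ^ 2 := Equiv.sum_comp σ fun i => c i ^ 2
  have e1 : ∑ i, r i ^ 2 = ∑ i, c i ^ 2 + 2 * ∑ i : Fin n, (i : ℤ) * c i + ∑ i : Fin n, (i : ℤ) ^ 2 := by
    rw [Finset.mul_sum, ← Finset.sum_add_distrib, ← Finset.sum_add_distrib]
    exact Finset.sum_congr rfl fun i _ => by simp only [hc]; ring
  have e2 : ∑ i : Fin n, (r (σ i) - (σ i : ℤ) + (i : ℤ)) ^ 2 =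
      ∑ i, c (σ i) ^ 2 + 2 * ∑ i : Fin n, (i : ℤ) * c (σ i) + ∑ i : Fin n, (i : ℤ) ^ 2 := by
    rw [Finset.mul_sum, ← Finset.sum_add_distrib, ← Finset.sum_add_distrib]
    exact Finset.sum_congr rfl fun i _ => by simp only [hc]; ring
  omega

/-- The expansion of a Schur function in the products of complete homogeneous functions. -/
theorem classicalSchur_sub_homProd_mem (μ : Multiset ℕ) :
    classicalSchur μ - homProd μ ∈ Submodule.span Qqt {f : R 0 | ∃ ν : Multiset ℕ,
      ν.sum = μ.sum ∧ (μ.map (· ^ 2)).sum < (ν.map (· ^ 2)).sum ∧ f = homProd ν} := by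
  rw [classicalSchur, Matrix.det_apply, ← Finset.add_sum_erase univ _ (Finset.mem_univ 1)]
  have h1 : ∏ i : Fin μ.card, (Matrix.of fun i j : Fin μ.card =>
      completeHomInt ((rowLen μ i : ℤ) - (i : ℤ) + (j : ℤ))) ((1 : Equiv.Perm (Fin μ.card)) i) i =
      homProd μ := by
    conv_rhs => rw [homProd, ← map_rowLen μ, Multiset.map_map]
    refine Finset.prod_congr rfl fun i _ => ?_
    simp [completeHomInt]
  rw [h1, Equiv.Perm.sign_one, one_smul, add_sub_cancel_left]
  refine Submodule.sum_mem _ fun σ hσ => ?_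
  suffices h : ∏ i : Fin μ.card, (Matrix.of fun i j : Fin μ.card =>
      completeHomInt ((rowLen μ i : ℤ) - (i : ℤ) + (j : ℤ))) (σ i) i ∈
      Submodule.span Qqt {f : R 0 | ∃ ν : Multiset ℕ,
        ν.sum = μ.sum ∧ (μ.map (· ^ 2)).sum < (ν.map (· ^ 2)).sum ∧ f = homProd ν} by
    rcases Int.units_eq_one_or (Equiv.Perm.sign σ) with hs | hs
    · rwa [hs, one_smul]
    · rw [hs, Units.neg_smul, one_smul]
      exact neg_mem h
  simp only [Matrix.of_apply]
  by_cases hneg : ∃ i : Fin μ.card, (rowLen μ (σ i) : ℤ) - (σ i : ℤ) + (i : ℤ) < 0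
  · obtain ⟨i, hi⟩ := hneg
    rw [Finset.prod_eq_zero (Finset.mem_univ i)]
    · exact zero_mem _
    · rw [completeHomInt, if_neg (by omega)]
  · push Not at hneg
    set v : Fin μ.card → ℕ := fun i => ((rowLen μ (σ i) : ℤ) - (σ i : ℤ) + (i : ℤ)).toNat with hv
    have hv' (i) : (v i : ℤ) = (rowLen μ (σ i) : ℤ) - (σ i : ℤ) + (i : ℤ) :=
      Int.toNat_of_nonneg (hneg i)
    refine Submodule.subset_span ⟨univ.val.map v, ?_, ?_, ?_⟩
    · have h2 : ∑ i, (v i : ℤ) = ∑ i : Fin μ.card, (rowLen μ i : ℤ) := by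
        simp only [hv', Finset.sum_add_distrib, Finset.sum_sub_distrib]
        rw [Equiv.sum_comp σ (fun i => (rowLen μ i : ℤ)), Equiv.sum_comp σ (fun i => ((i : ℕ) : ℤ))]
        ring
      have h3 := sum_rowLen μ (fun x => x)
      rw [Multiset.map_id'] at h3
      rw [← h3]
      exact_mod_cast h2
    · rw [Multiset.map_map, ← sum_rowLen μ (· ^ 2)]
      have h2 := sum_sq_lt_of_perm (r := fun i : Fin μ.card => (rowLen μ i : ℤ)) (σ := σ)
        (fun i j h => Int.ofNat_le.mpr (rowLen_anti μ (show (i : ℕ) ≤ j from h)))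
        (Finset.mem_erase.mp hσ).1
      simp only [← hv'] at h2
      exact_mod_cast h2
    · rw [homProd, Multiset.map_map]
      refine Finset.prod_congr rfl fun i _ => ?_
      rw [completeHomInt, if_pos (hneg i), Function.comp_apply]

/-- The span of the Schur functions of degree `n`. -/
noncomputable def schurSpan (n : ℕ) : Submodule Qqt PS :=
  Submodule.span Qqt {f | ∃ μ : Multiset ℕ, 0 ∉ μ ∧ μ.sum = n ∧ f = classicalSchur μ}

/-- The span of the products of complete homogeneous functions of degree `n`. -/
noncomputable def homSpan (n : ℕ) : Submodule Qqt PS :=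
  Submodule.span Qqt {f | ∃ μ : Multiset ℕ, μ.sum = n ∧ f = homProd μ}

theorem sum_sq_le (μ : Multiset ℕ) : (μ.map (· ^ 2)).sum ≤ μ.sum ^ 2 := by
  induction μ using Multiset.induction_on with
  | empty => simp
  | cons x μ ih =>
    rw [Multiset.map_cons, Multiset.sum_cons, Multiset.sum_cons]
    nlinarith [Nat.zero_le (x * μ.sum)]

theorem sum_filter_ne_zero (μ : Multiset ℕ) : (μ.filter (· ≠ 0)).sum = μ.sum := by
  induction μ using Multiset.induction_on with
  | empty => rfl
  | cons x μ ih =>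
    by_cases hx : x = 0
    · rw [Multiset.filter_cons_of_neg (p := (· ≠ 0)) _ (by simpa using hx), ih, Multiset.sum_cons,
        hx, zero_add]
    · rw [Multiset.filter_cons_of_pos (p := (· ≠ 0)) _ hx, Multiset.sum_cons, Multiset.sum_cons, ih]

/-- Inverts the Jacobi–Trudi expansion: the correction terms have a larger sum of squares, and this
sum is bounded by the square of the degree. -/
theorem homProd_mem_schurSpan (μ : Multiset ℕ) : (homProd μ : PS) ∈ schurSpan μ.sum := by
  induction hn : μ.sum ^ 2 - (μ.map (· ^ 2)).sum using Nat.strong_induction_on generalizing μ with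
  | _ n ih =>
  have h0 : (((μ.filter (· ≠ 0))).map (· ^ 2)).sum = (μ.map (· ^ 2)).sum := by
    clear ih hn
    induction μ using Multiset.induction_on with
    | empty => rfl
    | cons x μ ih =>
      by_cases hx : x = 0
      · rw [Multiset.filter_cons_of_neg (p := (· ≠ 0)) _ (by simpa using hx), ih, Multiset.map_cons,
          Multiset.sum_cons, hx]
        simp
      · rw [Multiset.filter_cons_of_pos (p := (· ≠ 0)) _ hx, Multiset.map_cons, Multiset.sum_cons,
          Multiset.map_cons, Multiset.sum_cons, ih]
  have hs := sum_filter_ne_zero μ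
  rw [← homProd_filter, ← hs]
  have h1 := classicalSchur_sub_homProd_mem (μ.filter (· ≠ 0))
  have h2 : (classicalSchur (μ.filter (· ≠ 0)) : PS) ∈ schurSpan (μ.filter (· ≠ 0)).sum :=
    Submodule.subset_span ⟨_, by simp, rfl, rfl⟩
  have h3 : Submodule.span Qqt {f : R 0 | ∃ ν : Multiset ℕ,
      ν.sum = (μ.filter (· ≠ 0)).sum ∧
        ((μ.filter (· ≠ 0)).map (· ^ 2)).sum < (ν.map (· ^ 2)).sum ∧ f = homProd ν} ≤
      (schurSpan (μ.filter (· ≠ 0)).sum).comap (R 0).val.toLinearMap := by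
    refine Submodule.span_le.mpr ?_
    rintro _ ⟨ν, e, hlt, rfl⟩
    have := ih _ (by
      have := sum_sq_le ν
      rw [e, hs] at this
      rw [h0] at hlt
      rw [← hn, e, hs]
      omega) ν rfl
    rwa [e] at this
  have h4 := h3 h1
  simpa using sub_mem h2 h4

theorem homSpan_le_schurSpan (n : ℕ) : homSpan n ≤ schurSpan n := by
  refine Submodule.span_le.mpr ?_
  rintro _ ⟨μ, rfl, rfl⟩
  exact homProd_mem_schurSpan μ

theorem mul_mem_homSpan {i j : ℕ} {f g : PS} (hf : f ∈ homSpan i) (hg : g ∈ homSpan j) :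
    f * g ∈ homSpan (i + j) := by
  have h := Submodule.mul_mem_mul hf hg
  rw [homSpan, homSpan, Submodule.span_mul_span] at h
  refine Submodule.span_mono ?_ h
  rintro _ ⟨_, ⟨μ, rfl, rfl⟩, _, ⟨ν, rfl, rfl⟩, rfl⟩
  refine ⟨μ + ν, Multiset.sum_add _ _, ?_⟩
  simp [homProd]

/-- The elementary symmetric function `e_n` in `x_1, x_2, …`. -/
noncomputable def elemSeries (n : ℕ) : PS :=
  open Classical in fun d => if (∀ j, d j ≤ 1) ∧ d.degree = n then 1 else 0

theorem coeff_elemSeries (n : ℕ) (d : ℕ →₀ ℕ) [Decidable ((∀ j, d j ≤ 1) ∧ d.degree = n)] :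
    MvPowerSeries.coeff d (elemSeries n) = if (∀ j, d j ≤ 1) ∧ d.degree = n then 1 else 0 := by
  change elemSeries n d = _
  simp only [elemSeries]
  congr

/-- The ways to write `x^d` as a squarefree monomial times another monomial correspond to the
subsets of the support of `d`, and the alternating number of subsets of a nonempty set is zero. -/
theorem sum_neg_one_pow_elemSeries {n : ℕ} (hn : n ≠ 0) :
    ∑ p ∈ antidiagonal n, (-1 : PS) ^ p.1 * (elemSeries p.1 * completeHomSeries p.2) = 0 := by
  classical
  ext d
  have hC (k : ℕ) (f : PS) : MvPowerSeries.coeff d ((-1 : PS) ^ k * f) =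
      (-1) ^ k * MvPowerSeries.coeff d f := by
    rcases Nat.even_or_odd k with h | h <;> simp [h.neg_one_pow]
  rw [map_sum, map_zero]
  simp only [hC, MvPowerSeries.coeff_mul, coeff_elemSeries, coeff_completeHomSeries, Finset.mul_sum]
  rw [Finset.sum_comm]
  by_cases hd : d.degree = n
  · have h1 : ∀ q ∈ antidiagonal d, ∑ p ∈ antidiagonal n, (-1 : Qqt) ^ p.1 *
        ((if (∀ j, q.1 j ≤ 1) ∧ q.1.degree = p.1 then 1 else 0) *
          (if q.2.degree = p.2 then 1 else 0)) =
        if ∀ j, q.1 j ≤ 1 then (-1) ^ q.1.degree else 0 := by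
      intro q hq
      rw [Finset.HasAntidiagonal.mem_antidiagonal] at hq
      have hq' : q.1.degree + q.2.degree = n := by rw [← hd, ← hq, map_add]
      rw [Finset.sum_eq_single (q.1.degree, q.2.degree)]
      · simp
      · intro p _ hp
        by_cases h1 : q.1.degree = p.1
        · rw [if_neg (c := q.2.degree = p.2), mul_zero, mul_zero]
          exact fun h2 => hp (Prod.ext h1.symm h2.symm)
        · rw [if_neg (by tauto), zero_mul, mul_zero]
      · intro h
        exact absurd (Finset.HasAntidiagonal.mem_antidiagonal.mpr hq') h
    rw [Finset.sum_congr rfl h1, ← Finset.sum_filter]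
    have h2 : d.support.Nonempty := by
      rw [Finsupp.support_nonempty_iff]
      rintro rfl
      exact hn (by simpa using hd.symm)
    have h3 := Finset.sum_powerset_neg_one_pow_card_of_nonempty h2
    have h4 : ∑ S ∈ d.support.powerset, (-1 : Qqt) ^ #S = 0 := by exact_mod_cast congrArg (Int.cast (R := Qqt)) h3
    rw [← h4]
    refine Finset.sum_bij' (fun q _ => q.1.support)
      (fun S _ => (Finsupp.indicator S fun _ _ => 1, d - Finsupp.indicator S fun _ _ => 1)) ?_ ?_ ?_ ?_ ?_
    · intro q hq
      rw [Finset.mem_filter, Finset.HasAntidiagonal.mem_antidiagonal] at hq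
      rw [Finset.mem_powerset, ← hq.1]
      exact Finsupp.support_mono le_self_add
    · intro S hS
      rw [Finset.mem_powerset] at hS
      rw [Finset.mem_filter, Finset.HasAntidiagonal.mem_antidiagonal]
      refine ⟨add_tsub_cancel_of_le fun j => ?_, fun j => ?_⟩
      · rw [Finsupp.indicator_apply]
        split_ifs with h
        · exact Nat.one_le_iff_ne_zero.mpr (Finsupp.mem_support_iff.mp (hS h))
        · exact Nat.zero_le _
      · rw [Finsupp.indicator_apply]
        split_ifs <;> simp
    · intro q hq
      rw [Finset.mem_filter, Finset.HasAntidiagonal.mem_antidiagonal] at hq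
      have : (Finsupp.indicator q.1.support fun _ _ => 1) = q.1 := by
        ext j
        rw [Finsupp.indicator_apply]
        have := hq.2 j
        split_ifs with h
        · have := Finsupp.mem_support_iff.mp h
          omega
        · have := Finsupp.notMem_support_iff.mp h
          omega
      simp only [this]
      exact Prod.ext rfl (by rw [← hq.1, add_tsub_cancel_left])
    · intro S _
      ext j
      simp [Finsupp.indicator_apply]
    · intro q hq
      rw [Finset.mem_filter] at hq
      congr 1
      rw [Finsupp.degree_apply, Finset.card_eq_sum_ones]
      refine Finset.sum_congr rfl fun j hj => ?_
      have := Finsupp.mem_support_iff.mp hj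
      have := hq.2 j
      omega
  · refine Finset.sum_eq_zero fun q hq => Finset.sum_eq_zero fun p hp => ?_
    rw [Finset.HasAntidiagonal.mem_antidiagonal] at hq hp
    by_cases h1 : q.1.degree = p.1
    · rw [if_neg (c := q.2.degree = p.2), mul_zero, mul_zero]
      intro h2
      exact hd (by rw [← hq, map_add, h1, h2, hp])
    · rw [if_neg (by tauto), zero_mul, mul_zero]

theorem completeHomSeries_mem_homSpan (n : ℕ) : completeHomSeries n ∈ homSpan n :=
  Submodule.subset_span ⟨{n}, by simp, by simp [homProd, completeHom]⟩

theorem elemSeries_mem_homSpan (n : ℕ) : elemSeries n ∈ homSpan n := by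
  induction n using Nat.strong_induction_on with
  | _ n ih =>
  rcases Nat.eq_zero_or_pos n with rfl | hn
  · have : elemSeries 0 = completeHomSeries 0 := by
      classical
      ext d
      rw [coeff_elemSeries, coeff_completeHomSeries]
      congr 1
      rw [eq_iff_iff, and_iff_right_iff_imp]
      intro h
      rw [Finsupp.degree_eq_zero_iff] at h
      simp [h]
    rw [this]
    exact completeHomSeries_mem_homSpan 0
  · have h := sum_neg_one_pow_elemSeries hn.ne'
    have h0 : completeHomSeries 0 = 1 := congrArg Subtype.val completeHom_zero
    rw [← Finset.add_sum_erase _ _ (show (n, 0) ∈ antidiagonal n by simp), h0, mul_one] at h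
    have h1 : (-1 : PS) ^ n * elemSeries n ∈ homSpan n := by
      rw [eq_neg_of_add_eq_zero_left h]
      refine neg_mem (Submodule.sum_mem _ fun p hp => ?_)
      rw [Finset.mem_erase, Finset.HasAntidiagonal.mem_antidiagonal] at hp
      have hlt : p.1 < n := by
        have : p.2 ≠ 0 := fun h2 => hp.1 (Prod.ext (by simp; omega) h2)
        omega
      have h2 := mul_mem_homSpan (ih _ hlt) (completeHomSeries_mem_homSpan p.2)
      rw [hp.2] at h2
      rcases Nat.even_or_odd p.1 with h | h
      · simpa [h.neg_one_pow] using h2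
      · simpa [h.neg_one_pow] using neg_mem h2
    rcases Nat.even_or_odd n with h | h
    · simpa [h.neg_one_pow] using h1
    · simpa [h.neg_one_pow] using h1

/-- The product `e_μ` of elementary symmetric functions. -/
noncomputable def elemProd (μ : Multiset ℕ) : PS := (μ.map elemSeries).prod

/-- The `e_μ` serve as test functions: their initial monomials are explicit, so linear independence
is easily seen for them and then carried over to Schur functions by counting. -/
theorem elemProd_mem_schurSpan (μ : Multiset ℕ) : elemProd μ ∈ schurSpan μ.sum := by
  apply homSpan_le_schurSpan
  induction μ using Multiset.induction_on with
  | empty => exact Submodule.subset_span ⟨0, rfl, by simp [homProd, elemProd]⟩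
  | cons x μ ih =>
    rw [elemProd, Multiset.map_cons, Multiset.prod_cons, Multiset.sum_cons]
    exact mul_mem_homSpan (elemSeries_mem_homSpan x) ih

/-! ## Homogeneous power series -/

/-- The power series which are homogeneous of degree `n`. -/
noncomputable def homogeneous (n : ℕ) : Submodule Qqt PS where
  carrier := {f | ∀ d : ℕ →₀ ℕ, d.degree ≠ n → MvPowerSeries.coeff d f = 0}
  add_mem' hf hg d hd := by rw [map_add, hf d hd, hg d hd, add_zero]
  zero_mem' _ _ := map_zero _
  smul_mem' c f hf d hd := by rw [map_smul, hf d hd, smul_zero]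

theorem mul_mem_homogeneous {i j : ℕ} {f g : PS} (hf : f ∈ homogeneous i)
    (hg : g ∈ homogeneous j) : f * g ∈ homogeneous (i + j) := by
  intro d hd
  rw [MvPowerSeries.coeff_mul]
  refine Finset.sum_eq_zero fun p hp => ?_
  rw [Finset.HasAntidiagonal.mem_antidiagonal] at hp
  have h : p.1.degree + p.2.degree = d.degree := by rw [← hp, map_add]
  by_cases h1 : p.1.degree = i
  · rw [hg _ (by omega), mul_zero]
  · rw [hf _ h1, zero_mul]

theorem monomial_mem_homogeneous (d : ℕ →₀ ℕ) (c : Qqt) :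
    MvPowerSeries.monomial d c ∈ homogeneous d.degree := by
  intro e he
  rw [MvPowerSeries.coeff_monomial_ne]
  rintro rfl
  exact he rfl

theorem xPow_eq_monomial {m : ℕ} (a : Fin m → ℕ) :
    xPow a = MvPowerSeries.monomial (∑ j : Fin m, Finsupp.single (j : ℕ) (a j)) 1 := by
  rw [xPow]
  simp only [MvPowerSeries.X_pow_eq]
  generalize (univ : Finset (Fin m)) = s
  classical
  induction s using Finset.induction_on with
  | empty => rfl
  | insert j s hj ih =>
    rw [Finset.prod_insert hj, Finset.sum_insert hj, ih, MvPowerSeries.monomial_mul_monomial,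
      one_mul]

theorem xPow_mem_homogeneous {m : ℕ} (a : Fin m → ℕ) : xPow a ∈ homogeneous (∑ i, a i) := by
  have h := monomial_mem_homogeneous (∑ j : Fin m, Finsupp.single (j : ℕ) (a j)) 1
  rw [← xPow_eq_monomial, map_sum] at h
  simpa using h

theorem hallLittlewood_mem_homogeneous {m : ℕ} (a : Fin m → ℕ) :
    (hallLittlewood m a : PS) ∈ homogeneous (∑ i, a i) := by
  have h : xPowSpan m (∑ i, a i) (∑ i, a i ^ 2) ≤ homogeneous (∑ i, a i) := by
    refine Submodule.span_le.mpr ?_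
    rintro _ ⟨b, hb, -, rfl⟩
    rw [← hb]
    exact xPow_mem_homogeneous b
  simpa using add_mem (h (hallLittlewood_sub_xPow_mem a)) (xPow_mem_homogeneous a)

theorem homProd_mem_homogeneous (μ : Multiset ℕ) : (homProd μ : PS) ∈ homogeneous μ.sum := by
  induction μ using Multiset.induction_on with
  | empty =>
    have := monomial_mem_homogeneous 0 1
    simpa [homProd] using this
  | cons x μ ih =>
    rw [homProd, Multiset.map_cons, Multiset.prod_cons, Multiset.sum_cons]
    refine mul_mem_homogeneous (fun d hd => ?_) ih
    exact if_neg hd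

theorem classicalSchur_mem_homogeneous (μ : Multiset ℕ) :
    (classicalSchur μ : PS) ∈ homogeneous μ.sum := by
  have h : Submodule.span Qqt {f : R 0 | ∃ ν : Multiset ℕ,
      ν.sum = μ.sum ∧ (μ.map (· ^ 2)).sum < (ν.map (· ^ 2)).sum ∧ f = homProd ν} ≤
      (homogeneous μ.sum).comap (R 0).val.toLinearMap := by
    refine Submodule.span_le.mpr ?_
    rintro _ ⟨ν, e, -, rfl⟩
    have := homProd_mem_homogeneous ν
    rwa [e] at this
  have h1 := h (classicalSchur_sub_homProd_mem μ)
  simpa using add_mem h1 (homProd_mem_homogeneous μ)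

theorem k_mem_homogeneous {m : ℕ} (L : MPartition m) : (k L : PS) ∈ homogeneous L.degree :=
  mul_mem_homogeneous (hallLittlewood_mem_homogeneous L.a) (classicalSchur_mem_homogeneous L.lam)

/-! ## Initial monomials -/

/-- The monomial with exponent `α` occurs in `f` with coefficient `1`, and all other monomials
which occur have a larger weight. -/
def IsInitial (w : ℕ → ℕ) (f : PS) (α : ℕ →₀ ℕ) : Prop :=
  MvPowerSeries.coeff α f = 1 ∧
    ∀ d, MvPowerSeries.coeff d f ≠ 0 → d = α ∨ Finsupp.weight w α < Finsupp.weight w d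

theorem IsInitial.mul {w : ℕ → ℕ} {f g : PS} {α β : ℕ →₀ ℕ} (hf : IsInitial w f α)
    (hg : IsInitial w g β) : IsInitial w (f * g) (α + β) := by
  have key (p q : ℕ →₀ ℕ) (h1 : MvPowerSeries.coeff p f ≠ 0) (h2 : MvPowerSeries.coeff q g ≠ 0) :
      (p = α ∧ q = β) ∨ Finsupp.weight w (α + β) < Finsupp.weight w (p + q) := by
    rw [map_add, map_add]
    rcases hf.2 p h1 with rfl | h3 <;> rcases hg.2 q h2 with rfl | h4
    · exact .inl ⟨rfl, rfl⟩
    · right; omega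
    · right; omega
    · right; omega
  constructor
  · rw [MvPowerSeries.coeff_mul, Finset.sum_eq_single (α, β), hf.1, hg.1, one_mul]
    · intro p hp hne
      rw [Finset.HasAntidiagonal.mem_antidiagonal] at hp
      by_contra h
      rcases key p.1 p.2 (left_ne_zero_of_mul h) (right_ne_zero_of_mul h) with h1 | h1
      · exact hne (Prod.ext h1.1 h1.2)
      · rw [hp] at h1
        exact lt_irrefl _ h1
    · exact fun h => (h (by rw [Finset.HasAntidiagonal.mem_antidiagonal])).elim
  · intro d hd
    rw [MvPowerSeries.coeff_mul] at hd
    obtain ⟨p, hp, h⟩ := Finset.exists_ne_zero_of_sum_ne_zero hd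
    rw [Finset.HasAntidiagonal.mem_antidiagonal] at hp
    rw [← hp]
    rcases key p.1 p.2 (left_ne_zero_of_mul h) (right_ne_zero_of_mul h) with h1 | h1
    · exact .inl (by rw [h1.1, h1.2])
    · exact .inr h1

theorem isInitial_monomial (w : ℕ → ℕ) (α : ℕ →₀ ℕ) :
    IsInitial w (MvPowerSeries.monomial α 1) α := by
  refine ⟨MvPowerSeries.coeff_monomial_same _ _, fun d hd => .inl ?_⟩
  by_contra h
  exact hd (MvPowerSeries.coeff_monomial_ne h _)

/-- The matrix of coefficients is unitriangular for the order by weight: in a relation, an index of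
least weight with nonzero coefficient is seen alone at its own initial monomial. -/
theorem linearIndependent_of_isInitial {ι : Type*} [Fintype ι] {w : ℕ → ℕ} {f : ι → PS}
    {α : ι → ℕ →₀ ℕ} (hα : Function.Injective α) (h : ∀ i, IsInitial w (f i) (α i)) :
    LinearIndependent Qqt fun i i' => MvPowerSeries.coeff (α i') (f i) := by
  classical
  rw [Fintype.linearIndependent_iff]
  intro g hg
  by_contra! hne
  obtain ⟨i0, hi0⟩ := hne
  obtain ⟨i, hi, hmin⟩ := Finset.exists_min_image ({i | g i ≠ 0} : Finset ι)
    (fun i => Finsupp.weight w (α i)) ⟨i0, by simpa using hi0⟩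
  have h1 := congrFun hg i
  rw [Finset.sum_apply, Finset.sum_eq_single i] at h1
  · rw [Pi.smul_apply, (h i).1, smul_eq_mul, mul_one] at h1
    exact (Finset.mem_filter.mp hi).2 h1
  · intro j _ hji
    rw [Pi.smul_apply, smul_eq_mul]
    by_contra hc
    have h2 := hmin j (by simpa using left_ne_zero_of_mul hc)
    rcases (h j).2 _ (right_ne_zero_of_mul hc) with h3 | h3
    · exact hji (hα h3.symm)
    · omega
  · intro h
    exact absurd (Finset.mem_univ i) h

/-- The exponent of the initial monomial of `e_n`. -/
noncomputable def columnExp (m n : ℕ) : ℕ →₀ ℕ := ∑ r ∈ range n, Finsupp.single (m + r) 1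

theorem columnExp_apply (m n j : ℕ) : columnExp m n j = if m ≤ j ∧ j < m + n then 1 else 0 := by
  rw [columnExp, Finsupp.finsetSum_apply]
  simp only [Finsupp.single_apply]
  split_ifs with h
  · rw [Finset.sum_eq_single (j - m)]
    · rw [if_pos (by omega)]
    · intro b _ hb
      rw [if_neg (by omega)]
    · intro hj
      exact absurd (Finset.mem_range.mpr (by omega)) hj
  · refine Finset.sum_eq_zero fun r hr => if_neg ?_
    have := Finset.mem_range.mp hr
    omega

theorem degree_columnExp (m n : ℕ) : (columnExp m n).degree = n := by
  simp [columnExp]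

/-- A weight for which `x_{m+1} x_{m+2} ⋯` are the lightest variables. -/
def tailWeight (m D j : ℕ) : ℕ := if j < m then D else j - m

/-- The variables of the initial monomial have the weights `0, …, n - 1`, and all other variables
have weight at least `n`; for the first `m` variables this is the assumption `n ≤ D`. A squarefree
monomial of degree `n` can therefore only become heavier by using another variable. -/
theorem isInitial_elemSeries (m : ℕ) {n D : ℕ} (hn : n ≤ D) :
    IsInitial (tailWeight m D) (elemSeries n) (columnExp m n) := by
  classical
  constructor
  · rw [coeff_elemSeries, if_pos]
    refine ⟨fun j => ?_, degree_columnExp m n⟩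
    rw [columnExp_apply]
    split_ifs <;> simp
  · intro d hd
    rw [coeff_elemSeries] at hd
    obtain ⟨h1, h2⟩ : (∀ j, d j ≤ 1) ∧ d.degree = n := by
      by_contra h
      exact hd (if_neg h)
    have hind (c : ℕ →₀ ℕ) (hc : ∀ j, c j ≤ 1) : (∀ j ∈ c.support, c j = 1) := fun j hj => by
      have := hc j
      have := Finsupp.mem_support_iff.mp hj
      omega
    have hc (j) : columnExp m n j ≤ 1 := by
      rw [columnExp_apply]
      split_ifs <;> simp
    have hw (c : ℕ →₀ ℕ) (hc : ∀ j, c j ≤ 1) :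
        Finsupp.weight (tailWeight m D) c = ∑ j ∈ c.support, tailWeight m D j := by
      rw [Finsupp.weight_apply, Finsupp.sum]
      refine Finset.sum_congr rfl fun j hj => ?_
      rw [hind c hc j hj, one_smul]
    have hdeg (c : ℕ →₀ ℕ) (hc : ∀ j, c j ≤ 1) : c.degree = #c.support := by
      rw [Finsupp.degree_apply, Finset.card_eq_sum_ones]
      exact Finset.sum_congr rfl (hind c hc)
    have hE (j) : j ∈ (columnExp m n).support ↔ m ≤ j ∧ j < m + n := by
      rw [Finsupp.mem_support_iff, columnExp_apply]
      split_ifs with h <;> simp [h]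
    set S := d.support with hS
    set E := (columnExp m n).support with hE'
    have hcard : #S = #E := by rw [← hdeg _ h1, ← hdeg _ hc, h2, degree_columnExp]
    rcases Finset.eq_empty_or_nonempty (S \ E) with he | hne
    · left
      have hSE : S = E := Finset.eq_of_subset_of_card_le (Finset.sdiff_eq_empty_iff_subset.mp he)
        hcard.ge
      ext j
      by_cases hj : j ∈ S
      · rw [hind d h1 j hj, hind _ hc j (hSE.le hj)]
      · rw [Finsupp.notMem_support_iff.mp hj,
          Finsupp.notMem_support_iff.mp fun h => hj (hSE.ge h)]
    · right
      rw [hw _ h1, hw _ hc]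
      have e1 := Finset.sum_inter_add_sum_sdiff S E (tailWeight m D)
      have e2 := Finset.sum_inter_add_sum_sdiff E S (tailWeight m D)
      rw [Finset.inter_comm] at e2
      have e3 := Finset.card_sdiff_comm hcard
      have e4 := Finset.card_nsmul_le_sum (S \ E) (tailWeight m D) n fun j hj => by
        rw [Finset.mem_sdiff, hE] at hj
        rw [tailWeight]
        split_ifs <;> omega
      have e5 := Finset.sum_le_card_nsmul (E \ S) (tailWeight m D) (n - 1) fun j hj => by
        rw [Finset.mem_sdiff, hE] at hj
        rw [tailWeight]
        split_ifs <;> omega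
      have e6 : 0 < #(E \ S) := e3 ▸ Finset.card_pos.mpr hne
      have e7 : 0 < n := by
        obtain ⟨j, hj⟩ := Finset.card_pos.mp e6
        rw [Finset.mem_sdiff, hE] at hj
        omega
      rw [smul_eq_mul, e3] at e4
      rw [smul_eq_mul] at e5
      have e8 : #(E \ S) * (n - 1) < #(E \ S) * n := Nat.mul_lt_mul_of_pos_left (by omega) e6
      change #(E \ S) * n ≤ ∑ j ∈ S \ E, tailWeight m D j at e4
      change ∑ j ∈ E \ S, tailWeight m D j ≤ #(E \ S) * (n - 1) at e5
      change ∑ j ∈ E, tailWeight m D j < ∑ j ∈ S, tailWeight m D j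
      omega

/-! ### Leading exponents -/

namespace MPartition
variable {m : ℕ}

/-- The exponent of the initial monomial of `x^a e_lam`. -/
noncomputable def leadExp (L : MPartition m) : ℕ →₀ ℕ :=
  ∑ j : Fin m, Finsupp.single (j : ℕ) (L.a j) + (L.lam.map (columnExp m)).sum

theorem sum_single_apply (a : Fin m → ℕ) (j : ℕ) :
    (∑ i : Fin m, Finsupp.single (i : ℕ) (a i)) j = if h : j < m then a ⟨j, h⟩ else 0 := by
  rw [Finsupp.finsetSum_apply]
  simp only [Finsupp.single_apply]
  split_ifs with h
  · rw [Finset.sum_eq_single ⟨j, h⟩]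
    · simp
    · intro b _ hb
      rw [if_neg fun e => hb (Fin.ext e)]
    · intro hj
      exact absurd (Finset.mem_univ _) hj
  · refine Finset.sum_eq_zero fun r _ => if_neg ?_
    have := r.2
    omega

theorem sum_columnExp_apply (lam : Multiset ℕ) (j : ℕ) :
    (lam.map (columnExp m)).sum j = if j < m then 0 else colLen lam (j - m) := by
  induction lam using Multiset.induction_on with
  | empty => simp [colLen]
  | cons x lam ih =>
    rw [Multiset.map_cons, Multiset.sum_cons, Finsupp.add_apply, ih, columnExp_apply, colLen, colLen,
      Multiset.filter_cons, Multiset.card_add]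
    split_ifs <;> first | rfl | omega

theorem leadExp_apply_lt (L : MPartition m) {j : ℕ} (hj : j < m) : L.leadExp j = L.a ⟨j, hj⟩ := by
  rw [leadExp, Finsupp.add_apply, sum_single_apply, sum_columnExp_apply, dif_pos hj, if_pos hj,
    add_zero]

theorem leadExp_apply_add (L : MPartition m) (r : ℕ) : L.leadExp (m + r) = colLen L.lam r := by
  rw [leadExp, Finsupp.add_apply, sum_single_apply, sum_columnExp_apply, dif_neg (by omega),
    if_neg (by omega), zero_add, Nat.add_sub_cancel_left]

theorem degree_leadExp (L : MPartition m) : L.leadExp.degree = L.degree := by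
  rw [leadExp, map_add, map_sum, map_multiset_sum, Multiset.map_map, degree]
  simp [degree_columnExp]

theorem count_eq_colLen_sub (p : Multiset ℕ) (c : ℕ) :
    p.count (c + 1) + colLen p (c + 1) = colLen p c := by
  induction p using Multiset.induction_on with
  | empty => rfl
  | cons x p ih =>
    rw [colLen, colLen, Multiset.filter_cons, Multiset.filter_cons, Multiset.count_cons,
      Multiset.card_add, Multiset.card_add, ← colLen, ← colLen, ← ih]
    split_ifs <;> simp <;> omega

theorem eq_of_colLen_eq {p q : Multiset ℕ} (hp : 0 ∉ p) (hq : 0 ∉ q)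
    (h : ∀ c, colLen p c = colLen q c) : p = q := by
  ext c
  rcases c with _ | c
  · rw [Multiset.count_eq_zero_of_notMem hp, Multiset.count_eq_zero_of_notMem hq]
  · have h1 := count_eq_colLen_sub p c
    have h2 := count_eq_colLen_sub q c
    rw [h, h] at h1
    omega

theorem leadExp_injective : Function.Injective (leadExp (m := m)) := by
  intro L O h
  refine MPartition.ext (funext fun j => ?_) (eq_of_colLen_eq L.pos O.pos fun c => ?_)
  · have := DFunLike.congr_fun h (j : ℕ)
    rwa [leadExp_apply_lt _ j.2, leadExp_apply_lt _ j.2] at this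
  · have := DFunLike.congr_fun h (m + c)
    rwa [leadExp_apply_add, leadExp_apply_add] at this

/-- The tail of a leading exponent is the conjugate of `lam`. Conversely a decreasing tail is a
partition, and its conjugate has the part `c + 1` with multiplicity `d (m + c) - d (m + c + 1)`. -/
theorem exists_leadExp_eq (d : ℕ →₀ ℕ) (hd : ∀ j, m ≤ j → d (j + 1) ≤ d j) :
    ∃ L : MPartition m, L.leadExp = d := by
  obtain ⟨N, hN⟩ : ∃ N, ∀ j, N ≤ j → d j = 0 := by
    refine ⟨d.support.sup id + 1, fun j hj => ?_⟩
    by_contra h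
    have := Finset.le_sup (f := id) (Finsupp.mem_support_iff.mpr h)
    simp only [id] at this
    omega
  set lam : ℕ → Multiset ℕ := fun n =>
    ∑ c ∈ range n, Multiset.replicate (d (m + c) - d (m + c + 1)) (c + 1) with hlam
  have hcol (n r : ℕ) : colLen (lam n) r + (if r ≤ n then d (m + n) else 0) =
      if r ≤ n then d (m + r) else 0 := by
    induction n with
    | zero =>
      have : colLen (lam 0) r = 0 := by simp [hlam, colLen]
      rw [this]
      split_ifs with h
      · rw [Nat.le_zero.mp h, zero_add]
      · rfl
    | succ n ih =>
      have h1 := hd (m + n) (by omega)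
      have h2 : colLen (lam (n + 1)) r =
          colLen (lam n) r + if r < n + 1 then d (m + n) - d (m + n + 1) else 0 := by
        simp only [hlam]
        rw [Finset.sum_range_succ, colLen_add]
        congr 1
        rw [colLen]
        split_ifs with h
        · rw [Multiset.filter_eq_self.mpr, Multiset.card_replicate]
          intro x hx
          rwa [Multiset.eq_of_mem_replicate hx]
        · rw [Multiset.filter_eq_nil.mpr, Multiset.card_zero]
          intro x hx
          rwa [Multiset.eq_of_mem_replicate hx]
      rw [h2]
      rw [← add_assoc m n 1]
      rcases Nat.lt_or_ge r (n + 1) with h | h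
      · rw [if_pos (by omega)] at ih ⊢
        rw [if_pos (by omega)] at ih ⊢
        rw [if_pos (by omega)]
        omega
      · rw [if_neg (by omega), if_neg (by omega)] at ih
        rw [if_neg (by omega)]
        split_ifs with h3
        · obtain rfl : r = n + 1 := by omega
          rw [← add_assoc m n 1]
          omega
        · omega
  refine ⟨⟨fun j => d j, lam N, ?_⟩, ?_⟩
  · simp only [hlam, Multiset.mem_sum, not_exists, not_and]
    intro c _ h
    exact absurd (Multiset.eq_of_mem_replicate h) (by omega)
  · ext j
    rcases Nat.lt_or_ge j m with h | h
    · rw [leadExp_apply_lt _ h]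
    · obtain ⟨r, rfl⟩ := Nat.exists_eq_add_of_le h
      rw [leadExp_apply_add]
      have h1 := hcol N r
      rw [hN (m + N) (by omega)] at h1
      split_ifs at h1 with h2
      · omega
      · rw [hN (m + r) (by omega)]
        omega

end MPartition

theorem isInitial_xPow_mul_elemProd {m D : ℕ} (L : MPartition m) (hL : L.degree ≤ D) :
    IsInitial (tailWeight m D) (xPow L.a * elemProd L.lam) L.leadExp := by
  refine IsInitial.mul ?_ ?_
  · rw [xPow_eq_monomial]
    exact isInitial_monomial _ _
  · have hle : ∀ x ∈ L.lam, x ≤ D := fun x hx => by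
      have := Multiset.single_le_sum (fun _ _ => Nat.zero_le _) x hx
      rw [MPartition.degree] at hL
      omega
    rw [elemProd]
    generalize L.lam = μ at hle
    induction μ using Multiset.induction_on with
    | empty => exact isInitial_monomial _ 0
    | cons x μ ih =>
      rw [Multiset.map_cons, Multiset.prod_cons, Multiset.map_cons, Multiset.sum_cons]
      exact (isInitial_elemSeries m (hle x (Multiset.mem_cons_self x μ))).mul
        (ih fun y hy => hle y (Multiset.mem_cons_of_mem hy))

/-! ## The basis `k` -/

/-- By symmetry the tail of an exponent can be sorted without changing the coefficient. Exchanging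
adjacent exponents with `d j < d (j + 1)` lowers `∑ j d_j`, and sorted exponents are leading
exponents. -/
theorem coeff_eq_zero_of_leadExp {m D : ℕ} {f : PS} (hs : SymmetricAfter m f)
    (hD : ∀ d : ℕ →₀ ℕ, D < d.degree → MvPowerSeries.coeff d f = 0)
    (h : ∀ L : MPartition m, L.degree ≤ D → MvPowerSeries.coeff L.leadExp f = 0) : f = 0 := by
  ext d
  rw [map_zero]
  induction hn : Finsupp.weight (fun j => j) d using Nat.strong_induction_on generalizing d with
  | _ n ih =>
  by_cases hd : ∀ j, m ≤ j → d (j + 1) ≤ d j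
  · obtain ⟨L, rfl⟩ := MPartition.exists_leadExp_eq d hd
    rcases Nat.lt_or_ge D L.degree with hL | hL
    · exact hD _ (by rwa [MPartition.degree_leadExp])
    · exact h L hL
  · push Not at hd
    obtain ⟨j, hj, hlt⟩ := hd
    have h1 : exchange j f = f := hs _ fun i hi => by
      rw [Equiv.swap_apply_of_ne_of_ne] <;> omega
    rw [← h1, coeff_exchange]
    refine ih _ ?_ _ rfl
    have h2 : (d.update j (d (j + 1))).update (j + 1) (d j) +
        (Finsupp.single j (d j) + Finsupp.single (j + 1) (d (j + 1))) =
        d + (Finsupp.single j (d (j + 1)) + Finsupp.single (j + 1) (d j)) := by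
      ext i
      simp only [Finsupp.add_apply, Finsupp.coe_update, Function.update_apply, Finsupp.single_apply]
      grind
    have h3 := congrArg (Finsupp.weight (fun j => j)) h2
    simp only [map_add, Finsupp.weight_single, smul_eq_mul] at h3
    rw [← hn]
    nlinarith

instance finite_degree_le (m D : ℕ) : Finite {L : MPartition m // L.degree ≤ D} := by
  have : {L : MPartition m | L.degree ≤ D} ⊆ ⋃ d ∈ Set.Iic D, {L : MPartition m | L.degree = d} := by
    intro L hL
    simpa using hL
  exact ((Set.finite_Iic D).biUnion fun d _ => MPartition.finite_degree m d).subset this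

/-- The vector of coefficients of the leading monomials of the `m`-partitions of degree at
most `D`. -/
noncomputable def leadCoeffs (m D : ℕ) : PS →ₗ[Qqt] ({L : MPartition m // L.degree ≤ D} → Qqt) :=
  LinearMap.pi fun L => MvPowerSeries.coeff L.1.leadExp

/-- The span of the `k_L` for `L` of degree at most `D`. -/
noncomputable def kSpan (m D : ℕ) : Submodule Qqt PS :=
  Submodule.span Qqt (Set.range fun L : {L : MPartition m // L.degree ≤ D} => (k L.1 : PS))

theorem xPow_mul_elemProd_mem {m D : ℕ} (L : MPartition m) (hL : L.degree ≤ D) :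
    xPow L.a * elemProd L.lam ∈ kSpan m D := by
  have h := Submodule.mul_mem_mul (xPow_mem_span_hallLittlewood L.a) (elemProd_mem_schurSpan L.lam)
  rw [schurSpan, Submodule.span_mul_span] at h
  refine Submodule.span_mono ?_ h
  rintro _ ⟨_, ⟨b, hb, rfl⟩, _, ⟨μ, hμ, hs, rfl⟩, rfl⟩
  refine ⟨⟨⟨b, μ, hμ⟩, ?_⟩, rfl⟩
  rw [MPartition.degree] at hL ⊢
  simp only
  omega

/-- The coefficient vectors of the `x^a e_λ` are independent by triangularity and as many as the
dimension, so they span; and they are combinations of those of the `k_L`. -/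
theorem span_leadCoeffs (m D : ℕ) : Submodule.span Qqt
    (Set.range fun L : {L : MPartition m // L.degree ≤ D} => leadCoeffs m D (k L.1)) = ⊤ := by
  have := Fintype.ofFinite {L : MPartition m // L.degree ≤ D}
  have h1 := linearIndependent_of_isInitial (f := fun L : {L : MPartition m // L.degree ≤ D} =>
    xPow L.1.a * elemProd L.1.lam) (α := fun L => L.1.leadExp) (w := tailWeight m D)
    (fun L O h => Subtype.ext (MPartition.leadExp_injective h))
    fun L => isInitial_xPow_mul_elemProd L.1 L.2
  have h2 := h1.span_eq_top_of_card_eq_finrank' (by simp)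
  rw [eq_top_iff, ← h2, Submodule.span_le]
  rintro _ ⟨L, rfl⟩
  have h3 := Submodule.mem_map_of_mem (f := leadCoeffs m D) (xPow_mul_elemProd_mem L.1 L.2)
  rw [kSpan, Submodule.map_span, ← Set.range_comp] at h3
  exact h3

/-- A spanning family with as many members as the dimension is independent, so no initial monomials
of the `k_L` themselves are needed. -/
theorem linearIndependent_k_le (m D : ℕ) : LinearIndependent Qqt
    fun L : {L : MPartition m // L.degree ≤ D} => (k L.1 : PS) := by
  have := Fintype.ofFinite {L : MPartition m // L.degree ≤ D}
  refine LinearIndependent.of_comp (leadCoeffs m D) ?_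
  exact linearIndependent_of_top_le_span_of_card_eq_finrank (span_leadCoeffs m D).ge (by simp)

theorem linearIndependent_coe_k (m : ℕ) :
    LinearIndependent Qqt fun L : MPartition m => (k L : PS) := by
  rw [linearIndependent_iff']
  intro s g hg L hL
  have h1 : LinearIndependent Qqt fun x : s => (k x.1 : PS) :=
    (linearIndependent_k_le m (s.sup MPartition.degree)).comp
      (fun x : s => (⟨x.1, Finset.le_sup (f := MPartition.degree) x.2⟩ :
        {L : MPartition m // L.degree ≤ s.sup MPartition.degree}))
      fun x y e => Subtype.ext (congrArg (fun z => z.1) e)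
  rw [Fintype.linearIndependent_iff] at h1
  refine h1 (fun x => g x.1) ?_ ⟨L, hL⟩
  rw [← hg]
  exact Finset.sum_coe_sort s fun i => g i • (k i : PS)

theorem linearIndependent_k (m : ℕ) : LinearIndependent Qqt (k : MPartition m → R m) :=
  (linearIndependent_coe_k m).of_comp (R m).val.toLinearMap

/-- Some combination of the `k_L` has the same leading coefficients as the given function; their
difference is `m`-symmetric of bounded degree with vanishing leading coefficients, hence zero. -/
theorem span_k (m : ℕ) : ⊤ ≤ Submodule.span Qqt (Set.range (k : MPartition m → R m)) := by
  rintro ⟨f, ⟨D, hD⟩, hs⟩ -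
  have h1 : leadCoeffs m D f ∈ Submodule.map (leadCoeffs m D) (kSpan m D) := by
    rw [kSpan, Submodule.map_span, ← Set.range_comp]
    have := span_leadCoeffs m D
    rw [show (leadCoeffs m D ∘ fun L : {L : MPartition m // L.degree ≤ D} => (k L.1 : PS)) =
      fun L => leadCoeffs m D (k L.1) from rfl, this]
    trivial
  obtain ⟨g, hg, hgf⟩ := h1
  have hk : kSpan m D ≤ Submodule.map (R m).val.toLinearMap
      (Submodule.span Qqt (Set.range (k : MPartition m → R m))) := by
    refine Submodule.span_le.mpr ?_
    rintro _ ⟨L, rfl⟩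
    exact ⟨k L.1, Submodule.subset_span (Set.mem_range_self L.1), rfl⟩
  obtain ⟨g', hg', rfl⟩ := hk hg
  have hgD : ∀ d : ℕ →₀ ℕ, D < d.degree → MvPowerSeries.coeff d (g' : PS) = 0 := by
    have : kSpan m D ≤ ⨆ n ∈ Set.Iic D, homogeneous n := by
      refine Submodule.span_le.mpr ?_
      rintro _ ⟨L, rfl⟩
      exact Submodule.mem_iSup_of_mem L.1.degree
        (Submodule.mem_iSup_of_mem L.2 (k_mem_homogeneous L.1))
    have h2 : ⨆ n ∈ Set.Iic D, homogeneous n ≤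
        ⨅ d ∈ {d : ℕ →₀ ℕ | D < d.degree}, LinearMap.ker (MvPowerSeries.coeff (R := Qqt) d) := by
      refine iSup₂_le fun n hn => le_iInf₂ fun (d : ℕ →₀ ℕ) hd f hf => ?_
      refine hf d ?_
      have h3 : n ≤ D := hn
      have h4 : D < d.degree := hd
      omega
    intro d hd
    have h3 := (h2 (this hg))
    simp only [Submodule.mem_iInf] at h3
    exact h3 d hd
  have h2 : f - g' = 0 := by
    refine coeff_eq_zero_of_leadExp (m := m) (D := D) (f := f - g') ?_ ?_ ?_
    · intro σ hσ
      rw [map_sub, hs σ hσ, g'.2.2 σ hσ]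
    · intro d hd
      rw [map_sub, hD d hd, hgD d hd, sub_zero]
    · intro L hL
      have := congrFun hgf ⟨L, hL⟩
      change MvPowerSeries.coeff L.leadExp (g' : PS) = MvPowerSeries.coeff L.leadExp f at this
      rw [map_sub, this, sub_self]
  have h3 : (⟨f, ⟨D, hD⟩, hs⟩ : R m) = g' := Subtype.ext (sub_eq_zero.mp h2)
  rw [h3]
  exact hg'

/-- The basis of all `k_L` of the ring `R_m`. -/
noncomputable def kBasis (m : ℕ) : Module.Basis (MPartition m) Qqt (R m) :=
  .mk (linearIndependent_k m) (span_k m)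

theorem kBasis_apply {m : ℕ} (L : MPartition m) : kBasis m L = k L := by
  rw [kBasis, Module.Basis.mk_apply]

/-! ## The scalar product and the adjoint Hecke operators -/

open Classical in
theorem isScalarProduct_constr (m : ℕ) :
    IsScalarProduct m ((kBasis m).constr Qqt fun L => (kBasis m).coord L) := by
  intro L O
  rw [← kBasis_apply, ← kBasis_apply, Module.Basis.constr_basis, Module.Basis.coord_apply,
    Module.Basis.repr_self, Finsupp.single_apply]
  simp only [eq_comm]

theorem existsUnique_isScalarProduct (m : ℕ) :
    ∃! B : R m →ₗ[Qqt] R m →ₗ[Qqt] Qqt, IsScalarProduct m B := by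
  refine ⟨_, isScalarProduct_constr m, fun B hB => ?_⟩
  refine (kBasis m).ext fun L => (kBasis m).ext fun O => ?_
  rw [kBasis_apply, kBasis_apply, hB L O, isScalarProduct_constr m L O]

theorem isScalarProduct_scalarProduct (m : ℕ) : IsScalarProduct m (scalarProduct m) :=
  Classical.epsilon_spec (existsUnique_isScalarProduct m).exists

open Classical in
theorem scalarProduct_k_k {m : ℕ} (L O : MPartition m) :
    scalarProduct m (k L) (k O) = if L = O then 1 else 0 := isScalarProduct_scalarProduct m L O

theorem scalarProduct_k_left {m : ℕ} (L : MPartition m) (f : R m) :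
    scalarProduct m (k L) f = (kBasis m).repr f L := by
  classical
  have : scalarProduct m (k L) = (kBasis m).coord L := by
    refine (kBasis m).ext fun O => ?_
    rw [kBasis_apply, scalarProduct_k_k, ← kBasis_apply, Module.Basis.coord_apply,
      Module.Basis.repr_self, Finsupp.single_apply]
    simp only [eq_comm]
  rw [this, Module.Basis.coord_apply]

theorem scalarProduct_comm {m : ℕ} (f g : R m) : scalarProduct m f g = scalarProduct m g f := by
  classical
  have : scalarProduct m = (scalarProduct m).flip := by
    refine (kBasis m).ext fun L => (kBasis m).ext fun O => ?_
    rw [LinearMap.flip_apply, kBasis_apply, kBasis_apply, scalarProduct_k_k, scalarProduct_k_k]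
    exact if_congr eq_comm rfl rfl
  conv_lhs => rw [this, LinearMap.flip_apply]

theorem ext_scalarProduct {m : ℕ} {f g : R m}
    (h : ∀ L : MPartition m, scalarProduct m (k L) f = scalarProduct m (k L) g) : f = g := by
  apply (kBasis m).repr.injective
  ext L
  rw [← scalarProduct_k_left, ← scalarProduct_k_left, h]

namespace MPartition
variable {m : ℕ}

theorem swap_eq_iff {L O : MPartition m} {i : ℕ} {hi : i + 1 < m} :
    L.swap i hi = O ↔ L = O.swap i hi := by
  constructor
  · rintro rfl
    rw [swap_swap]
  · rintro rfl
    rw [swap_swap]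

theorem swap_left (L : MPartition m) {i : ℕ} (hi : i + 1 < m) :
    (L.swap i hi).a ⟨i, Nat.lt_of_succ_lt hi⟩ = L.a ⟨i + 1, hi⟩ := swapEntries_left L.a i hi

theorem swap_right (L : MPartition m) {i : ℕ} (hi : i + 1 < m) :
    (L.swap i hi).a ⟨i + 1, hi⟩ = L.a ⟨i, Nat.lt_of_succ_lt hi⟩ := swapEntries_right L.a i hi

end MPartition

/-- The value of the adjoint Hecke operator on `k_L`. -/
noncomputable def adjValue {m : ℕ} (i : ℕ) (hi : i + 1 < m) (L : MPartition m) : R m :=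
  if L.a ⟨i, Nat.lt_of_succ_lt hi⟩ = L.a ⟨i + 1, hi⟩ then tt • k L
  else if L.a ⟨i + 1, hi⟩ < L.a ⟨i, Nat.lt_of_succ_lt hi⟩ then tt • k (L.swap i hi)
  else (tt - 1) • k L + k (L.swap i hi)

/-- The `k_L` are orthonormal, so the adjoint has the transposed matrix, whose nonzero entries only
relate `L` and `s_i L`. The factor `t` of the off-diagonal entry thereby passes from `a_i < a_{i+1}`
to `a_i > a_{i+1}`. -/
theorem scalarProduct_heckeT_k {m i : ℕ} (hi : i + 1 < m) (M L : MPartition m) :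
    scalarProduct m (heckeT m i hi (k M)) (k L) = scalarProduct m (k M) (adjValue i hi L) := by
  classical
  have hs (N : MPartition m) (h : N.a ⟨i, Nat.lt_of_succ_lt hi⟩ ≠ N.a ⟨i + 1, hi⟩) :
      N.swap i hi ≠ N := by
    intro e
    have := N.swap_left hi
    rw [e] at this
    exact h this
  have hiff : M.swap i hi = L ↔ M = L.swap i hi := MPartition.swap_eq_iff
  have h1 := M.swap_left hi
  have h2 := M.swap_right hi
  rw [adjValue]
  rcases lt_trichotomy (M.a ⟨i, Nat.lt_of_succ_lt hi⟩) (M.a ⟨i + 1, hi⟩) with h | h | h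
  · rw [heckeT_k_of_lt M hi h]
    have hM := hs M h.ne
    by_cases e1 : M = L
    · subst e1
      rw [if_neg h.ne, if_neg h.not_gt]
      simp [scalarProduct_k_k, hM, hM.symm]
    · by_cases e2 : M.swap i hi = L
      · subst e2
        rw [h1, h2, if_neg h.ne', if_pos h, swap_swap]
        simp [scalarProduct_k_k, hM.symm]
      · have e3 : M ≠ L.swap i hi := fun e => e2 (hiff.mpr e)
        split_ifs <;> simp [scalarProduct_k_k, e1, e2, e3]
  · rw [heckeT_k_of_eq M hi h]
    have hM : M.swap i hi = M := MPartition.ext (swapEntries_eq_self M.a i hi h) rfl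
    by_cases e1 : M = L
    · subst e1
      rw [if_pos h]
      simp [scalarProduct_k_k]
    · have e3 : M ≠ L.swap i hi := fun e => e1 (by rw [← hM]; exact hiff.mpr e)
      split_ifs <;> simp [scalarProduct_k_k, e1, e3]
  · rw [heckeT_k_of_gt M hi h]
    have hM := hs M h.ne'
    by_cases e1 : M = L
    · subst e1
      rw [if_neg h.ne', if_pos h]
      simp [scalarProduct_k_k, hM, hM.symm]
    · by_cases e2 : M.swap i hi = L
      · subst e2
        rw [h1, h2, if_neg h.ne, if_neg h.not_gt, swap_swap]
        simp [scalarProduct_k_k, hM.symm]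
      · have e3 : M ≠ L.swap i hi := fun e => e2 (hiff.mpr e)
        split_ifs <;> simp [scalarProduct_k_k, e1, e2, e3]

theorem isHeckeAdjoint_constr {m i : ℕ} (hi : i + 1 < m) :
    IsHeckeAdjoint m i hi ((kBasis m).constr Qqt (adjValue i hi)) := by
  have h : (scalarProduct m) ∘ₗ heckeT m i hi =
      (scalarProduct m).compl₂ ((kBasis m).constr Qqt (adjValue i hi)) := by
    refine (kBasis m).ext fun M => (kBasis m).ext fun L => ?_
    rw [LinearMap.comp_apply, LinearMap.compl₂_apply, Module.Basis.constr_basis, kBasis_apply,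
      kBasis_apply, scalarProduct_heckeT_k]
  intro f g
  exact LinearMap.congr_fun₂ h f g

theorem existsUnique_isHeckeAdjoint {m i : ℕ} (hi : i + 1 < m) :
    ∃! S : R m →ₗ[Qqt] R m, IsHeckeAdjoint m i hi S := by
  refine ⟨_, isHeckeAdjoint_constr hi, fun S hS => ?_⟩
  ext1 g
  refine ext_scalarProduct fun L => ?_
  rw [← hS, ← isHeckeAdjoint_constr hi]

theorem scalarProduct_heckeT {m i : ℕ} (hi : i + 1 < m) (f g : R m) :
    scalarProduct m (heckeT m i hi f) g = scalarProduct m f (heckeTAdj m i hi g) :=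
  Classical.epsilon_spec (p := IsHeckeAdjoint m i hi) (existsUnique_isHeckeAdjoint hi).exists f g

theorem heckeTAdj_k {m i : ℕ} (hi : i + 1 < m) (L : MPartition m) :
    heckeTAdj m i hi (k L) = adjValue i hi L :=
  ext_scalarProduct fun M => by rw [← scalarProduct_heckeT, scalarProduct_heckeT_k]

/-! ## Inclusion and restriction -/

namespace MPartition
variable {m : ℕ}

/-- The `(m+1)`-partition `(a_1, …, a_m, 0; lam)`. -/
def snocZero (L : MPartition m) : MPartition (m + 1) := ⟨Fin.snoc (α := fun _ => ℕ) L.a 0, L.lam, L.pos⟩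

/-- The `m`-partition obtained by omission of the entry `a_{m+1}`. -/
def init (L : MPartition (m + 1)) : MPartition m := ⟨fun i => L.a i.castSucc, L.lam, L.pos⟩

theorem snocZero_eq_iff {L : MPartition m} {O : MPartition (m + 1)} :
    L.snocZero = O ↔ O.a (Fin.last m) = 0 ∧ L = O.init := by
  constructor
  · rintro rfl
    exact ⟨by simp [snocZero], MPartition.ext (by simp [snocZero, init]) rfl⟩
  · rintro ⟨h, rfl⟩
    refine MPartition.ext (funext fun j => ?_) rfl
    refine Fin.lastCases ?_ (fun i => ?_) j
    · simp [snocZero, h]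
    · simp [snocZero, init]

end MPartition

theorem swapEntries_snoc {m i : ℕ} (hi : i + 1 < m) (a : Fin m → ℕ) (x : ℕ) :
    swapEntries (Fin.snoc (α := fun _ => ℕ) a x) i (Nat.lt_succ_of_lt hi) =
      Fin.snoc (α := fun _ => ℕ) (swapEntries a i hi) x := by
  funext j
  refine Fin.lastCases ?_ (fun j => ?_) j
  · rw [swapEntries, Function.comp_apply, Equiv.swap_apply_of_ne_of_ne, Fin.snoc_last,
      Fin.snoc_last]
    · simp only [ne_eq, Fin.ext_iff, Fin.val_last]; omega
    · simp only [ne_eq, Fin.ext_iff, Fin.val_last]; omega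
  · have : Equiv.swap (⟨i, by omega⟩ : Fin (m + 1)) ⟨i + 1, by omega⟩ j.castSucc =
        (Equiv.swap (⟨i, by omega⟩ : Fin m) ⟨i + 1, hi⟩ j).castSucc := by
      simp only [Equiv.swap_apply_def, Fin.ext_iff, Fin.val_castSucc]
      split_ifs <;> rfl
    rw [swapEntries, Function.comp_apply, this, Fin.snoc_castSucc, Fin.snoc_castSucc]
    rfl

theorem snoc_mk_lt {m i : ℕ} (hi : i < m) (a : Fin m → ℕ) (x : ℕ) :
    Fin.snoc (α := fun _ => ℕ) a x ⟨i, Nat.lt_succ_of_lt hi⟩ = a ⟨i, hi⟩ :=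
  Fin.snoc_castSucc (α := fun _ => ℕ) x a ⟨i, hi⟩

/-- A final zero creates no ascent, so both recursions use the same operators and start from the
same monomial. -/
theorem hallLittlewood_snoc_zero {m : ℕ} (a : Fin m → ℕ) :
    (hallLittlewood (m + 1) (Fin.snoc (α := fun _ => ℕ) a 0) : PS) = hallLittlewood m a := by
  induction hn : inv a using Nat.strong_induction_on generalizing a with
  | _ n ih =>
  by_cases hd : ∃ i, HasAscent a i
  · obtain ⟨i, hi, h⟩ := hd
    rw [hallLittlewood_ascent a hi h, ← ih _ (hn ▸ inv_swapEntries_lt a i hi h) _ rfl,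
      hallLittlewood_ascent (Fin.snoc (α := fun _ => ℕ) a 0) (i := i) (Nat.lt_succ_of_lt hi) (by
        rwa [snoc_mk_lt (by omega), snoc_mk_lt hi]), swapEntries_snoc]
  · have hd' : ¬ ∃ i, HasAscent (Fin.snoc (α := fun _ => ℕ) a 0) i := by
      rintro ⟨i, hi, h⟩
      rcases Nat.lt_or_ge (i + 1) m with h1 | h1
      · exact hd ⟨i, h1, by rwa [snoc_mk_lt (by omega), snoc_mk_lt h1] at h⟩
      · have : (⟨i + 1, hi⟩ : Fin (m + 1)) = Fin.last m := Fin.ext (by simp; omega)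
        rw [this, Fin.snoc_last] at h
        exact Nat.not_lt_zero _ h
    rw [hallLittlewood_of_not_ascent a hd, hallLittlewood_of_not_ascent _ hd',
      Fin.prod_univ_castSucc]
    simp

theorem incl_k {m : ℕ} (L : MPartition m) : incl m (k L) = k L.snocZero := by
  apply Subtype.ext
  change (k L : PS) = k L.snocZero
  rw [coe_k, coe_k, MPartition.snocZero, hallLittlewood_snoc_zero]

/-! ### Restriction of the functions `k_L` -/

theorem killCompl_X_skip (m j : ℕ) :
    MvPowerSeries.killCompl (skip m) (MvPowerSeries.X (skip m j) : PS) = MvPowerSeries.X j := by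
  ext d
  rw [MvPowerSeries.coeff_killCompl, MvPowerSeries.coeff_X, MvPowerSeries.coeff_X]
  congr 1
  rw [← Finsupp.embDomain_single, eq_iff_iff]
  exact (Finsupp.embDomain_injective _).eq_iff

theorem killCompl_X_self (m : ℕ) :
    MvPowerSeries.killCompl (skip m) (MvPowerSeries.X m : PS) = 0 := by
  ext d
  rw [MvPowerSeries.coeff_killCompl, MvPowerSeries.coeff_X, if_neg, map_zero]
  intro h
  have h1 := DFunLike.congr_fun h m
  rw [Finsupp.single_eq_same, Finsupp.embDomain_of_notMem_range] at h1
  · exact zero_ne_one h1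
  · rintro ⟨x, hx⟩
    rw [skip_apply] at hx
    split_ifs at hx <;> omega

theorem killCompl_completeHomSeries (m n : ℕ) :
    MvPowerSeries.killCompl (skip m) (completeHomSeries n) = completeHomSeries n := by
  ext d
  rw [MvPowerSeries.coeff_killCompl, coeff_completeHomSeries, coeff_completeHomSeries,
    Finsupp.embDomain_eq_mapDomain, Finsupp.degree_mapDomain]

theorem killCompl_classicalSchur (m : ℕ) (lam : Multiset ℕ) :
    MvPowerSeries.killCompl (skip m) (classicalSchur lam : PS) = classicalSchur lam := by
  have h := (R 0).val.map_det (Matrix.of fun i j : Fin lam.card =>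
    completeHomInt ((rowLen lam i : ℤ) - (i : ℤ) + (j : ℤ)))
  change (classicalSchur lam : PS) = _ at h
  rw [h, AlgHom.map_det]
  congr 1
  ext1 i j
  simp only [AlgHom.mapMatrix_apply, Matrix.map_apply, Matrix.of_apply, completeHomInt]
  split_ifs
  · exact killCompl_completeHomSeries m _
  · exact map_zero _

theorem killCompl_xPow {m : ℕ} (a : Fin m → ℕ) :
    MvPowerSeries.killCompl (skip m) (xPow a) = xPow a := by
  rw [xPow, map_prod]
  refine Finset.prod_congr rfl fun j _ => ?_
  have h := killCompl_X_skip m j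
  rw [skip_apply, if_pos j.2] at h
  rw [map_pow, h]

theorem killCompl_hallLittlewood {m : ℕ} (a : Fin m → ℕ) :
    MvPowerSeries.killCompl (skip m) (hallLittlewood m a : PS) = hallLittlewood m a := by
  have h : xPowSpan m (∑ i, a i) (∑ i, a i ^ 2) ≤ LinearMap.ker
      ((MvPowerSeries.killCompl (skip m)).toLinearMap - LinearMap.id (R := Qqt) (M := PS)) := by
    refine Submodule.span_le.mpr ?_
    rintro _ ⟨b, -, -, rfl⟩
    simp [killCompl_xPow]
  have h1 := h (hallLittlewood_sub_xPow_mem a)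
  simpa [killCompl_xPow, sub_eq_zero] using h1

/-- Only the last position is needed, but in the recursion the distinguished entry moves. When it
moves from `i + 1` to `i`, the relation `heckeOp_X_mul` turns the factor `x_i` back into `x_{i+1}`;
otherwise the operator is linear over the variable. -/
theorem X_dvd_hallLittlewood {m : ℕ} (a : Fin m → ℕ) (j : Fin m) (hj : a j ≠ 0)
    (h : ∀ i, j < i → a i < a j) : (MvPowerSeries.X (j : ℕ) : PS) ∣ hallLittlewood m a := by
  induction hn : inv a using Nat.strong_induction_on generalizing a j with
  | _ n ih =>
  by_cases hd : ∃ i, HasAscent a i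
  · obtain ⟨i, hi, hlt⟩ := hd
    have hinv := hn ▸ inv_swapEntries_lt a i hi hlt
    rw [hallLittlewood_ascent a hi hlt]
    have hij : (j : ℕ) ≠ i := by
      rintro rfl
      exact lt_asymm hlt (h ⟨j + 1, hi⟩ (by simp [Fin.lt_def]))
    by_cases hij' : (j : ℕ) = i + 1
    · obtain ⟨j, hjm⟩ := j
      obtain rfl : j = i + 1 := hij'
      obtain ⟨g, hg⟩ := ih _ hinv (swapEntries a i hi) ⟨i, by omega⟩
        (by rwa [swapEntries_left]) (by
          rintro ⟨l, hl⟩ hil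
          rw [swapEntries_left]
          by_cases e : l = i + 1
          · subst e
            rwa [swapEntries_right]
          · have : i < l := hil
            rw [swapEntries_of_ne _ _ _ (by omega) e]
            exact h _ (by simp only [Fin.mk_lt_mk]; omega)) rfl
      rw [hg, heckeOp_X_mul]
      exact dvd_mul_right _ _
    · have hsj : swapEntries a i hi j = a j := swapEntries_of_ne a hi j.2 hij hij'
      obtain ⟨g, hg⟩ := ih _ hinv (swapEntries a i hi) j (by rwa [hsj]) (by
          rintro ⟨l, hl⟩ hil
          have hjl : (j : ℕ) < l := hil
          rw [hsj]
          by_cases e : l = i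
          · subst e
            rw [swapEntries_left]
            exact h _ (by simp only [Fin.lt_def]; omega)
          by_cases e' : l = i + 1
          · subst e'
            rw [swapEntries_right]
            exact h _ (by simp only [Fin.lt_def]; omega)
          · rw [swapEntries_of_ne _ _ _ e e']
            exact h _ hil) rfl
      rw [hg, mul_comm, heckeOp_mul_of_exchange_eq (exchange_X_of_ne hij hij')]
      exact dvd_mul_left _ _
  · rw [hallLittlewood_of_not_ascent a hd]
    exact (dvd_pow_self _ hj).trans (Finset.dvd_prod_of_mem _ (Finset.mem_univ j))

theorem coe_restr {m : ℕ} (f : R (m + 1)) :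
    (restr m f : PS) = MvPowerSeries.killCompl (skip m) (f : PS) := rfl

theorem restr_k_of_eq_zero {m : ℕ} (L : MPartition (m + 1)) (h : L.a (Fin.last m) = 0) :
    restr m (k L) = k L.init := by
  have e : k L = incl m (k L.init) := by
    rw [incl_k, MPartition.snocZero_eq_iff.mpr ⟨h, rfl⟩]
  apply Subtype.ext
  rw [coe_restr, e]
  change MvPowerSeries.killCompl (skip m) (k L.init : PS) = _
  rw [coe_k, map_mul, killCompl_hallLittlewood, killCompl_classicalSchur]

theorem restr_k_of_ne_zero {m : ℕ} (L : MPartition (m + 1)) (h : L.a (Fin.last m) ≠ 0) :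
    restr m (k L) = 0 := by
  apply Subtype.ext
  obtain ⟨g, hg⟩ := X_dvd_hallLittlewood L.a (Fin.last m) h
    fun i hi => absurd hi (Fin.le_last i).not_gt
  rw [coe_restr, coe_k, hg, map_mul, map_mul, Fin.val_last, killCompl_X_self]
  simp

/-- The inclusion and the restriction are adjoint. -/
theorem scalarProduct_incl {m : ℕ} (f : R m) (g : R (m + 1)) :
    scalarProduct (m + 1) (incl m f) g = scalarProduct m f (restr m g) := by
  classical
  have h : (scalarProduct (m + 1)) ∘ₗ (incl m).toLinearMap =
      (scalarProduct m).compl₂ (restr m).toLinearMap := by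
    refine (kBasis m).ext fun L => (kBasis (m + 1)).ext fun O => ?_
    rw [LinearMap.comp_apply, LinearMap.compl₂_apply, kBasis_apply, kBasis_apply,
      AlgHom.toLinearMap_apply, AlgHom.toLinearMap_apply, incl_k, scalarProduct_k_k]
    by_cases h0 : O.a (Fin.last m) = 0
    · rw [restr_k_of_eq_zero O h0, scalarProduct_k_k]
      simp [MPartition.snocZero_eq_iff, h0]
    · rw [restr_k_of_ne_zero O h0, map_zero, if_neg]
      exact fun e => h0 (MPartition.snocZero_eq_iff.mp e).1
  exact LinearMap.congr_fun₂ h f g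

theorem incl_heckeT {m i : ℕ} (hi : i + 1 < m) (f : R m) :
    incl m (heckeT m i hi f) = heckeT (m + 1) i (Nat.lt_succ_of_lt hi) (incl m f) := by
  apply Subtype.ext
  rw [coe_heckeT]
  change (heckeT m i hi f : PS) = _
  rw [coe_heckeT]
  rfl

/-- The transpose of `incl_heckeT` under the adjunction of inclusion and restriction. -/
theorem restr_heckeTAdj {m i : ℕ} (hi : i + 1 < m) (f : R (m + 1)) :
    restr m (heckeTAdj (m + 1) i (Nat.lt_succ_of_lt hi) f) = heckeTAdj m i hi (restr m f) := by
  refine ext_scalarProduct fun L => ?_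
  rw [← scalarProduct_incl, ← scalarProduct_heckeT, ← incl_heckeT, scalarProduct_incl,
    scalarProduct_heckeT]

/-! ## The leading term of a dual Schur function -/

/-- In a weakly increasing word each letter sought stands after the previous one or does not occur
at all, so the reading never returns to the start. The state is general enough for the induction:
everything already passed is smaller than the next letter. -/
theorem chargeRound_sorted (n x : ℕ) {seen rest : List ℕ}
    (hs : (seen ++ rest).Pairwise (· ≤ ·)) (hx : ∀ y ∈ seen, y < x) :
    (chargeRound (List.range' x n) 0 seen rest).1 = 0 ∧
      (chargeRound (List.range' x n) 0 seen rest).2.Pairwise (· ≤ ·) := by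
  induction n generalizing x seen rest with
  | zero => exact ⟨rfl, hs⟩
  | succ n ih =>
    rw [List.range'_succ, chargeRound]
    by_cases h1 : x ∈ rest
    · rw [if_pos h1]
      have hrest := (List.pairwise_append.mp hs).2.1
      have htd := List.takeWhile_append_dropWhile (p := fun y => decide (y ≠ x)) (l := rest)
      have hsub : (rest.takeWhile (· ≠ x) ++ (rest.dropWhile (· ≠ x)).tail).Sublist rest := by
        conv_rhs => rw [← htd]
        exact List.Sublist.append (List.Sublist.refl _) (List.tail_sublist _)
      have := ih (x + 1) (seen := seen ++ rest.takeWhile (· ≠ x))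
        (rest := (rest.dropWhile (· ≠ x)).tail) (by
          rw [List.append_assoc]
          exact hs.sublist (List.Sublist.append (List.Sublist.refl _) hsub)) (by
          intro y hy
          rcases List.mem_append.mp hy with hy | hy
          · exact (hx y hy).trans (Nat.lt_succ_self x)
          · have hyx : y ≠ x := by simpa using List.mem_takeWhile_imp hy
            have hxd : x ∈ rest.dropWhile (· ≠ x) := by
              rw [← htd] at h1
              rcases List.mem_append.mp h1 with h | h
              · have h3 := List.mem_takeWhile_imp h
                simp at h3
              · exact h
            rw [← htd] at hrest
            have := (List.pairwise_append.mp hrest).2.2 y hy x hxd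
            omega)
      simpa using this
    · rw [if_neg h1, if_neg fun h => lt_irrefl _ (hx x h)]
      exact ⟨rfl, hs⟩

theorem chargeRounds_sorted (m n : ℕ) {w : List ℕ} (hw : w.Pairwise (· ≤ ·)) :
    chargeRounds m n w = 0 := by
  induction n generalizing w with
  | zero => rfl
  | succ n ih =>
    have h := chargeRound_sorted m 0 (seen := []) (rest := w) hw (by simp)
    rw [← List.range_eq_range'] at h
    rw [chargeRounds]
    simp only [h.1, ih h.2]

theorem dominantWord_of_count_antitone {m : ℕ} {w : List ℕ}
    (h : ∀ i, i + 1 < m → w.count (i + 1) ≤ w.count i) : dominantWord m w = w := by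
  have h1 : sortPass m w = w := by
    have key (l : List ℕ) (hl : ∀ i ∈ l, i + 1 < m) : l.foldl
        (fun v i => if v.count i < v.count (i + 1) then sigmaWord i v else v) w = w := by
      induction l with
      | nil => rfl
      | cons i l ih =>
        rw [List.foldl_cons, if_neg (h i (hl i (by simp))).not_gt]
        exact ih fun j hj => hl j (List.mem_cons_of_mem i hj)
    exact key _ fun i hi => by
      have := List.mem_range.mp hi
      omega
  exact Function.iterate_fixed h1 m

/-- In the reversed alphabet `u_a` is weakly decreasing, and the multiplicity of a letter decreases
with the letter. So its evaluation is already dominant, and from the right it is read as a weakly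
increasing word. -/
theorem barCharge_uWord {m : ℕ} {a : Fin m → ℕ} (ha : Antitone a) : barCharge (uWord a) = 0 := by
  set N := univ.sup a with hN
  have hu : (uWord a).map (fun i => (Fin.rev i : ℕ)) =
      (List.range m).reverse.flatMap fun l => List.replicate (N - revEntry a l) l := by
    rw [uWord, List.map_flatMap, ← map_rev_finRange, List.flatMap_map]
    congr 1
    funext i
    rw [List.map_replicate, revEntry_rev]
  have hcount (l : ℕ) (hl : l < m) : ((List.range m).reverse.flatMap fun l =>
      List.replicate (N - revEntry a l) l).count l = N - revEntry a l := by
    rw [List.count_flatMap, List.map_reverse, List.sum_reverse]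
    simp only [Function.comp_def, List.count_replicate, beq_iff_eq]
    change ∑ x ∈ Finset.range m, (if x = l then N - revEntry a x else 0) = N - revEntry a l
    rw [Finset.sum_ite_eq', if_pos (Finset.mem_range.mpr hl)]
  rw [barCharge, hu, wordCharge, dominantWord_of_count_antitone]
  · apply chargeRounds_sorted
    rw [List.pairwise_reverse, List.pairwise_flatMap]
    refine ⟨fun l _ => List.pairwise_replicate.mpr (.inr le_rfl), ?_⟩
    rw [List.pairwise_reverse]
    refine List.Pairwise.imp ?_ List.pairwise_lt_range
    intro x y hxy u hu v hv
    rw [List.eq_of_mem_replicate hu, List.eq_of_mem_replicate hv]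
    exact hxy.le
  · intro i hi
    rw [hcount _ hi, hcount _ (by omega)]
    have := revEntry_mono ha (show i ≤ i + 1 by omega) hi
    omega

theorem sum_colLen {p : Multiset ℕ} {N : ℕ} (hN : p.sum ≤ N) :
    ∑ c ∈ range N, colLen p c = p.sum := by
  induction p using Multiset.induction_on with
  | empty => simp [colLen]
  | cons x p ih =>
    rw [Multiset.sum_cons] at hN ⊢
    have h (c : ℕ) : colLen (x ::ₘ p) c = (if c < x then 1 else 0) + colLen p c := by
      rw [colLen, Multiset.filter_cons, Multiset.card_add, ← colLen]
      split_ifs <;> rfl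
    simp only [h]
    rw [Finset.sum_add_distrib, ih (by omega), ← Finset.sum_filter, ← Finset.card_eq_sum_ones]
    congr 1
    have : {c ∈ range N | c < x} = range x := by
      ext c
      simp only [Finset.mem_filter, Finset.mem_range]
      omega
    rw [this, Finset.card_range]

/-! ### Tableaux for dominant `L` and the diagonal coefficient -/

section
variable {m : ℕ} {L O : MPartition m} {T : Filling L O}

theorem apply_le_of_mem_tableaux (hT : T ∈ tableaux L O) (i : Fin m) : O.a i ≤ L.a i := by
  have h := mem_tableaux.mp hT
  rw [← h.2.2.2.1 i, ← Finset.card_range (L.a i)]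
  apply Finset.card_le_card_of_injOn (fun x => x.1.2)
  · intro x hx
    have hx' : T x = i := by simpa using hx
    have := h.2.2.2.2 x
    rw [hx'] at this
    simpa using this
  · intro x hx y hy hxy
    have hx' : T x = i := by simpa using hx
    have hy' : T y = i := by simpa using hy
    rcases lt_trichotomy x.1.1 y.1.1 with hlt | heq | hlt
    · exact absurd (hx'.trans hy'.symm) (h.2.2.1 x y hxy hlt).ne
    · exact Subtype.ext (Prod.ext heq hxy)
    · exact absurd (hy'.trans hx'.symm) (h.2.2.1 y x hxy.symm hlt).ne

/-- A letter occurs at most once in a column and only in the first `a_i` columns, so `b_i ≤ a_i`.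
Equal degrees then make the symmetric part of `O` at least as large; in the case of equality `b =
a`, and the inclusion of the partition of `L` in that of `O` becomes an equality. -/
theorem eq_or_lt_of_mem_tableaux (hL : Antitone L.a) (hdeg : O.degree = L.degree)
    (hT : T ∈ tableaux L O) : O = L ∨ L.lam.sum < O.lam.sum := by
  have h1 : ∑ i, O.a i ≤ ∑ i, L.a i :=
    Finset.sum_le_sum fun i _ => apply_le_of_mem_tableaux hT i
  rw [MPartition.degree, MPartition.degree] at hdeg
  rcases Nat.lt_or_ge L.lam.sum O.lam.sum with h2 | h2
  · exact .inr h2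
  · left
    have h3 : O.a = L.a := by
      funext i
      exact (Finset.sum_eq_sum_iff_of_le fun i _ => apply_le_of_mem_tableaux hT i).mp
        (by omega) i (Finset.mem_univ i)
    have h4 : O.lam.sum = L.lam.sum := by omega
    have h5 (c : ℕ) : colLen L.lam c ≤ colLen O.lam c := by
      rw [← add_length_barCol hT hL c]
      exact Nat.le_add_right _ _
    refine MPartition.ext h3 (MPartition.eq_of_colLen_eq O.pos L.pos fun c => ?_)
    rcases Nat.lt_or_ge c L.lam.sum with hc | hc
    · refine ((Finset.sum_eq_sum_iff_of_le fun c _ => h5 c).mp ?_ c (Finset.mem_range.mpr hc)).symm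
      rw [sum_colLen le_rfl, sum_colLen h4.le, h4]
    · have h6 (p : Multiset ℕ) (hp : p.sum ≤ c) : colLen p c = 0 := by
        by_contra h
        rw [← ne_eq, ← Nat.pos_iff_ne_zero, ← lt_rowLen_iff] at h
        have := rowLen_le_sum p 0
        omega
      rw [h6 _ hc, h6 _ (h4 ▸ hc)]

theorem colLetters_self {T : Filling L L} (hT : T ∈ tableaux L L) (c : ℕ) :
    colLetters T c = ({i | c < L.a i} : Finset (Fin m)) := by
  refine Finset.eq_of_subset_of_card_le (fun i hi => ?_) ?_
  · simpa using lt_of_mem_colLetters hT hi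
  · have h := card_colLetters hT c
    rw [colLen_total] at h
    omega

theorem apply_eq_of_mem_tableaux_self (hL : Antitone L.a) {T : Filling L L}
    (hT : T ∈ tableaux L L) (x : {c : ℕ × ℕ // c ∈ skewCells L.total L.lam}) :
    (T x : ℕ) = x.1.1 - colLen L.lam x.1.2 := by
  obtain ⟨⟨r, c⟩, hx⟩ := x
  have hx' := mem_skewCells.mp hx
  simp only
  rw [← letterAt_eq hx]
  refine eq_of_forall_gt_iff fun k => ?_
  rw [lt_add_card_filter_iff (letterAt_strictMono hT c) hx'.1 hx'.2, ← card_colLetters_lt hT,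
    colLetters_self hT]
  have h1 := colLen_total L c
  have h2 : #{i ∈ ({i | c < L.a i} : Finset (Fin m)) | i.1 < k} = min #{i | c < L.a i} k := by
    have : ({i ∈ ({i | c < L.a i} : Finset (Fin m)) | i.1 < k} : Finset (Fin m)).map
        Fin.valEmbedding = Finset.range (min #{i | c < L.a i} k) := by
      ext l
      simp only [Finset.mem_map, Finset.mem_filter, Finset.mem_univ, true_and, Finset.mem_range,
        Fin.valEmbedding_apply]
      constructor
      · rintro ⟨i, ⟨hi, hik⟩, rfl⟩
        exact lt_min ((lt_apply_iff hL c i).mp hi) hik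
      · intro hl
        have hlm : l < m := by
          have := Finset.card_le_univ ({i | c < L.a i} : Finset (Fin m))
          rw [Fintype.card_fin] at this
          omega
        exact ⟨⟨l, hlm⟩, ⟨(lt_apply_iff hL c ⟨l, hlm⟩).mpr (show l < _ by omega), by simp; omega⟩, rfl⟩
    rw [← Finset.card_map Fin.valEmbedding, this, Finset.card_range]
  rw [h2]
  omega

/-- Column `c` has as many cells as there are letters allowed in it, so it contains all of them in
increasing order. By dominance they are the first letters of the alphabet, which fixes each entry by
its row. -/
theorem tableaux_self (hL : Antitone L.a) : ∃ T : Filling L L, tableaux L L = {T} := by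
  have hlt {r c : ℕ} (h : (r, c) ∈ skewCells L.total L.lam) :
      r - colLen L.lam c < #{i | c < L.a i} := by
    rw [mem_skewCells, colLen_total] at h
    omega
  have hm (c : ℕ) : #{i | c < L.a i} ≤ m := by
    simpa using Finset.card_le_univ ({i | c < L.a i} : Finset (Fin m))
  refine ⟨fun x => ⟨x.1.1 - colLen L.lam x.1.2, (hlt x.2).trans_le (hm _)⟩, ?_⟩
  rw [Finset.eq_singleton_iff_unique_mem]
  refine ⟨?_, fun T hT => funext fun x => Fin.ext (apply_eq_of_mem_tableaux_self hL hT x)⟩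
  rw [mem_tableaux]
  refine ⟨fun r => ?_, fun x y h1 h2 => ?_, fun x y h1 h2 => ?_, fun i => ?_, fun x => ?_⟩
  · by_contra h
    rw [not_le, lt_rowLen_iff] at h
    have := (lt_rowLen_iff L.total r (rowLen L.total r)).mpr (by rw [colLen_total]; omega)
    omega
  · have := colLen_anti L.lam h2.le
    rw [Fin.mk_le_mk]
    omega
  · obtain ⟨⟨r, c⟩, hx⟩ := x
    obtain ⟨⟨r', c'⟩, hy⟩ := y
    rw [mem_skewCells] at hx hy
    simp only at h1 h2
    subst h1
    rw [Fin.mk_lt_mk]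
    simp only
    omega
  · rw [← Finset.card_range (L.a i)]
    have hcell (c : ℕ) (hc : c < L.a i) :
        (colLen L.lam c + i.1, c) ∈ skewCells L.total L.lam := by
      have := (lt_apply_iff hL c i).mp hc
      rw [mem_skewCells, colLen_total]
      omega
    refine Finset.card_bij' (fun x _ => x.1.2)
      (fun c hc => ⟨(colLen L.lam c + i.1, c), hcell c (Finset.mem_range.mp hc)⟩) ?_ ?_ ?_ ?_
    · intro x hx
      rw [Finset.mem_filter] at hx
      rw [Finset.mem_range, lt_apply_iff hL, ← hx.2]
      exact hlt x.2
    · intro c hc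
      rw [Finset.mem_filter]
      exact ⟨Finset.mem_univ _, Fin.ext (Nat.add_sub_cancel_left _ _)⟩
    · rintro ⟨⟨r, c⟩, h2⟩ hx
      rw [Finset.mem_filter] at hx
      have h1 := congrArg Fin.val hx.2
      rw [mem_skewCells] at h2
      simp only at h1
      apply Subtype.ext
      refine Prod.ext ?_ rfl
      simp only
      omega
    · intro c hc
      rfl
  · rw [lt_apply_iff hL]
    exact hlt x.2

theorem inv_eq_zero_of_antitone {a : Fin m → ℕ} (ha : Antitone a) : inv a = 0 := by
  rw [inv, Finset.card_eq_zero, Finset.filter_eq_empty_iff]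
  rintro ⟨i, j⟩ _ ⟨h1, h2⟩
  exact absurd (ha h1.le) h2.not_ge

theorem dominantCoeff_self (hL : Antitone L.a) : dominantCoeff L L = 1 := by
  obtain ⟨T, hT⟩ := tableaux_self hL
  have hb : barWord T = [] := by
    rw [barWord, List.flatMap_eq_nil_iff]
    intro r _
    rw [Nat.sub_self]
    rfl
  rw [dominantCoeff, hT, Finset.sum_singleton, tableauCharge, inv_eq_zero_of_antitone hL, hb,
    List.nil_append, barCharge_uWord hL]
  rfl

theorem dominantCoeff_eq_zero (hL : Antitone L.a) (hdeg : O.degree = L.degree) (hne : O ≠ L)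
    (hle : O.lam.sum ≤ L.lam.sum) : dominantCoeff L O = 0 := by
  rw [dominantCoeff]
  refine Finset.sum_eq_zero fun T hT => ?_
  rcases eq_or_lt_of_mem_tableaux hL hdeg hT with h | h
  · exact absurd h hne
  · omega

end

/-! ### Triangularity of the dual Schur functions -/

theorem antitone_of_not_ascent {m : ℕ} {a : Fin m → ℕ} (h : ¬ ∃ i, HasAscent a i) :
    Antitone a := by
  rcases m with _ | m
  · exact fun i => i.elim0
  · rw [Fin.antitone_iff_succ_le]
    intro i
    by_contra hlt
    exact h ⟨i, by omega, not_le.mp hlt⟩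

theorem not_ascent_of_antitone {m : ℕ} {a : Fin m → ℕ} (h : Antitone a) :
    ¬ ∃ i, HasAscent a i := by
  rintro ⟨i, hi, hlt⟩
  exact absurd (h (show (⟨i, by omega⟩ : Fin m) ≤ ⟨i + 1, hi⟩ by simp)) hlt.not_ge

theorem mem_ofDegree {m d : ℕ} {L : MPartition m} : L ∈ MPartition.ofDegree m d ↔ L.degree = d := by
  simp [MPartition.ofDegree]

theorem dualSchur_of_antitone {m : ℕ} {L : MPartition m} (hL : Antitone L.a) :
    dualSchur L = ∑ O ∈ MPartition.ofDegree m L.degree, dominantCoeff L O • k O := by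
  rw [dualSchur, dif_neg (not_ascent_of_antitone hL)]

theorem dualSchur_find {m : ℕ} (L : MPartition m) {i : ℕ} (hi : HasAscent L.a i) :
    ∃ k, ∃ hk : k + 1 < m, L.a ⟨k, Nat.lt_of_succ_lt hk⟩ < L.a ⟨k + 1, hk⟩ ∧ k ≤ i ∧
      (∀ j < k, ¬ HasAscent L.a j) ∧
      dualSchur L = tt⁻¹ • heckeTAdj m k hk (dualSchur (L.swap k hk)) := by
  classical
  have h : ∃ i, HasAscent L.a i := ⟨i, hi⟩
  refine ⟨Nat.find h, (Nat.find_spec h).fst, (Nat.find_spec h).snd, Nat.find_min' h hi,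
    fun j hj => Nat.find_min h hj, ?_⟩
  rw [dualSchur, dif_pos h]

/-- The span of the `k_O` with `O` of the same degree as `L` and with a larger symmetric part. -/
noncomputable def upperSpan {m : ℕ} (L : MPartition m) : Submodule Qqt (R m) :=
  Submodule.span Qqt {f | ∃ O : MPartition m, O.degree = L.degree ∧ L.lam.sum < O.lam.sum ∧ f = k O}

theorem degree_swap {m : ℕ} (L : MPartition m) {i : ℕ} (hi : i + 1 < m) :
    (L.swap i hi).degree = L.degree := by
  rw [MPartition.degree, MPartition.degree]
  congr 1
  exact sum_swapEntries hi L.a fun x => x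

theorem adjValue_mem {m i : ℕ} (hi : i + 1 < m) {W : Submodule Qqt (R m)} {O : MPartition m}
    (h1 : k O ∈ W) (h2 : k (O.swap i hi) ∈ W) : adjValue i hi O ∈ W := by
  rw [adjValue]
  split_ifs
  · exact W.smul_mem _ h1
  · exact W.smul_mem _ h2
  · exact W.add_mem (W.smul_mem _ h1) h2

/-- For dominant `L` this is the analysis of tableaux. In general `T_i^*` does not change the
symmetric part of an index, hence preserves the upper terms, and `t⁻¹ T_i^*` sends `k_{s_i L}`
exactly to `k_L` at an ascent of `L`. -/
theorem dualSchur_sub_k_mem {m : ℕ} (L : MPartition m) : dualSchur L - k L ∈ upperSpan L := by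
  induction hn : inv L.a using Nat.strong_induction_on generalizing L with
  | _ n ih =>
  by_cases hd : ∃ i, HasAscent L.a i
  · obtain ⟨i0, h0⟩ := hd
    obtain ⟨i, hi, hlt, -, -, e⟩ := dualSchur_find L h0
    have h1 := ih _ (hn ▸ inv_swapEntries_lt L.a i hi hlt) (L.swap i hi) rfl
    have h2 : upperSpan (L.swap i hi) ≤ (upperSpan L).comap (heckeTAdj m i hi) := by
      refine Submodule.span_le.mpr ?_
      rintro _ ⟨O, hO1, hO2, rfl⟩
      change heckeTAdj m i hi (k O) ∈ upperSpan L
      rw [heckeTAdj_k]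
      rw [degree_swap] at hO1
      exact adjValue_mem hi (Submodule.subset_span ⟨O, hO1, hO2, rfl⟩)
        (Submodule.subset_span ⟨O.swap i hi, by rw [degree_swap, hO1], hO2, rfl⟩)
    have h3 : heckeTAdj m i hi (k (L.swap i hi)) = tt • k L := by
      rw [heckeTAdj_k, adjValue, L.swap_left, L.swap_right, if_neg hlt.ne', if_pos hlt, swap_swap]
    have h4 := (upperSpan L).smul_mem tt⁻¹ (h2 h1)
    rwa [map_sub, h3, smul_sub, smul_smul, inv_mul_cancel₀ tt_ne_zero, one_smul, ← e] at h4
  · classical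
    have hL := antitone_of_not_ascent hd
    rw [dualSchur_of_antitone hL, ← Finset.add_sum_erase _ _ (mem_ofDegree.mpr (rfl : L.degree = _)),
      dominantCoeff_self hL, one_smul, add_sub_cancel_left]
    refine Submodule.sum_mem _ fun O hO => ?_
    rw [Finset.mem_erase, mem_ofDegree] at hO
    rcases Nat.lt_or_ge L.lam.sum O.lam.sum with h | h
    · exact Submodule.smul_mem _ _ (Submodule.subset_span ⟨O, hO.2, h, rfl⟩)
    · rw [dominantCoeff_eq_zero hL hO.2 hO.1 h, zero_smul]
      exact zero_mem _

/-! ## The `m`-symmetric Schur functions -/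

theorem dualSchur_mem_span_k {m : ℕ} (L : MPartition m) : dualSchur L ∈ Submodule.span Qqt
    (Set.range fun O : MPartition.ofDegree m L.degree => k O.1) := by
  have h : upperSpan L ≤ Submodule.span Qqt
      (Set.range fun O : MPartition.ofDegree m L.degree => k O.1) := by
    refine Submodule.span_le.mpr ?_
    rintro _ ⟨O, h1, -, rfl⟩
    exact Submodule.subset_span ⟨⟨O, mem_ofDegree.mpr h1⟩, rfl⟩
  have h1 : k L ∈ Submodule.span Qqt (Set.range fun O : MPartition.ofDegree m L.degree => k O.1) :=
    Submodule.subset_span ⟨⟨L, mem_ofDegree.mpr rfl⟩, rfl⟩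
  simpa using add_mem (h (dualSchur_sub_k_mem L)) h1

/-- Inverts the triangular expansion by descending induction on the size of the symmetric part,
which is bounded by the degree. -/
theorem k_mem_span_dualSchur {m : ℕ} (L : MPartition m) : k L ∈ Submodule.span Qqt
    (Set.range fun O : MPartition.ofDegree m L.degree => dualSchur O.1) := by
  induction hn : L.degree - L.lam.sum using Nat.strong_induction_on generalizing L with
  | _ n ih =>
  have h : upperSpan L ≤ Submodule.span Qqt
      (Set.range fun O : MPartition.ofDegree m L.degree => dualSchur O.1) := by
    refine Submodule.span_le.mpr ?_
    rintro _ ⟨O, h1, h2, rfl⟩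
    have h3 : O.lam.sum ≤ O.degree := Nat.le_add_left _ _
    have := ih _ (by omega) O rfl
    rwa [h1] at this
  have h1 : dualSchur L ∈ Submodule.span Qqt
      (Set.range fun O : MPartition.ofDegree m L.degree => dualSchur O.1) :=
    Submodule.subset_span ⟨⟨L, mem_ofDegree.mpr rfl⟩, rfl⟩
  simpa using sub_mem h1 (h (dualSchur_sub_k_mem L))

theorem ext_scalarProduct_dualSchur {m : ℕ} {f g : R m}
    (h : ∀ O : MPartition m, scalarProduct m f (dualSchur O) = scalarProduct m g (dualSchur O)) :
    f = g := by
  refine ext_scalarProduct fun L => ?_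
  rw [scalarProduct_comm, scalarProduct_comm (k L) g]
  have h1 : Submodule.span Qqt (Set.range fun O : MPartition.ofDegree m L.degree =>
      dualSchur O.1) ≤ LinearMap.ker (scalarProduct m f - scalarProduct m g) := by
    refine Submodule.span_le.mpr ?_
    rintro _ ⟨O, rfl⟩
    simp [h]
  have h2 := h1 (k_mem_span_dualSchur L)
  rwa [LinearMap.mem_ker, LinearMap.sub_apply, sub_eq_zero] at h2

theorem scalarProduct_k_dualSchur_of_degree_ne {m : ℕ} {L O : MPartition m}
    (h : L.degree ≠ O.degree) : scalarProduct m (k L) (dualSchur O) = 0 := by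
  classical
  have h1 : Submodule.span Qqt (Set.range fun M : MPartition.ofDegree m O.degree => k M.1) ≤
      LinearMap.ker (scalarProduct m (k L)) := by
    refine Submodule.span_le.mpr ?_
    rintro _ ⟨M, rfl⟩
    have h2 := mem_ofDegree.mp M.2
    change scalarProduct m (k L) (k M.1) = 0
    rw [scalarProduct_k_k, if_neg]
    rintro rfl
    exact h h2
  exact h1 (dualSchur_mem_span_k O)

theorem exists_dual_dualSchur {m : ℕ} (L : MPartition m) : ∃ f : R m,
    ∀ O : MPartition m, (L = O → scalarProduct m f (dualSchur O) = 1) ∧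
      (L ≠ O → scalarProduct m f (dualSchur O) = 0) := by
  classical
  set d := L.degree with hd
  have h1 (M : MPartition.ofDegree m d) : ∃ c : MPartition.ofDegree m d → Qqt,
      ∑ O, c O • dualSchur O.1 = k M.1 := by
    have h := k_mem_span_dualSchur M.1
    rw [mem_ofDegree.mp M.2] at h
    exact (Submodule.mem_span_range_iff_exists_fun Qqt).mp h
  choose D hD using h1
  set C : Matrix (MPartition.ofDegree m d) (MPartition.ofDegree m d) Qqt :=
    Matrix.of fun O N => scalarProduct m (k N.1) (dualSchur O.1) with hC
  have h2 : Matrix.of D * C = 1 := by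
    ext M N
    rw [Matrix.mul_apply]
    have h3 := congrArg (scalarProduct m (k N.1)) (hD M)
    rw [map_sum, scalarProduct_k_k] at h3
    simp only [map_smul, smul_eq_mul] at h3
    rw [Matrix.one_apply]
    simp only [hC, Matrix.of_apply]
    rw [h3]
    simp only [Subtype.ext_iff, eq_comm]
  -- The expansion of the `k_M` in dual Schur functions is only a left inverse of the matrix of
  -- scalar products; in a fixed degree the matrices are square, so it is a right inverse too, and
  -- its column at `L` gives the coefficients of the dual element.
  have h3 := mul_eq_one_comm.mp h2
  set L' : MPartition.ofDegree m d := ⟨L, mem_ofDegree.mpr rfl⟩ with hL'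
  refine ⟨∑ M, D M L' • k M.1, fun O => ?_⟩
  have h4 : scalarProduct m (∑ M, D M L' • k M.1) (dualSchur O) =
      ∑ M, D M L' * scalarProduct m (k M.1) (dualSchur O) := by
    rw [map_sum, LinearMap.sum_apply]
    simp only [map_smul, LinearMap.smul_apply, smul_eq_mul]
  rw [h4]
  by_cases hO : O.degree = d
  · have h5 := congrFun (congrFun h3 ⟨O, mem_ofDegree.mpr hO⟩) L'
    rw [Matrix.mul_apply, Matrix.one_apply] at h5
    simp only [hC, Matrix.of_apply, hL', Subtype.mk.injEq] at h5
    have h6 : ∑ M, D M L' * scalarProduct m (k M.1) (dualSchur O) = if O = L then 1 else 0 := by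
      rw [← h5]
      exact Finset.sum_congr rfl fun M _ => mul_comm _ _
    rw [h6]
    exact ⟨fun h => if_pos h.symm, fun h => if_neg h.symm⟩
  · have h5 : ∑ M, D M L' * scalarProduct m (k M.1) (dualSchur O) = 0 := by
      refine Finset.sum_eq_zero fun M _ => ?_
      rw [scalarProduct_k_dualSchur_of_degree_ne, mul_zero]
      rw [mem_ofDegree.mp M.2]
      exact fun h => hO h.symm
    rw [h5]
    refine ⟨?_, fun _ => rfl⟩
    rintro rfl
    exact absurd rfl hO

theorem existsUnique_isSchurFamily (m : ℕ) : ∃! F : MPartition m → R m, IsSchurFamily m F := by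
  classical
  choose F hF using exists_dual_dualSchur (m := m)
  refine ⟨F, fun L O => ?_, fun G hG => ?_⟩
  · split_ifs with h
    · exact (hF L O).1 h
    · exact (hF L O).2 h
  · funext L
    refine ext_scalarProduct_dualSchur fun O => ?_
    rw [hG L O]
    split_ifs with h
    · exact ((hF L O).1 h).symm
    · exact ((hF L O).2 h).symm

open Classical in
theorem scalarProduct_schur_dualSchur {m : ℕ} (L O : MPartition m) :
    scalarProduct m (schur L) (dualSchur O) = if L = O then 1 else 0 :=
  Classical.epsilon_spec (existsUnique_isSchurFamily m).exists L O

theorem mem_addCircle {m : ℕ} {L : MPartition m} {O : MPartition (m + 1)} :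
    O ∈ L.addCircle ↔ O.hat = L := by
  rw [MPartition.addCircle, Set.Finite.mem_toFinset]
  constructor
  · exact fun h => MPartition.ext (funext h.1) h.2
  · rintro rfl
    exact ⟨fun _ => rfl, rfl⟩

/-- Both sides are tested on the dual Schur functions. By adjunction the left side pairs to `1` with
those `s*_O` for which `O.hat = L`, and to `0` with the others. -/
theorem incl_schur_of_restr_dualSchur {m : ℕ}
    (h : ∀ O : MPartition (m + 1), restr m (dualSchur O) = dualSchur O.hat) (L : MPartition m) :
    incl m (schur L) = ∑ O ∈ L.addCircle, schur O := by
  classical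
  refine ext_scalarProduct_dualSchur fun O => ?_
  rw [scalarProduct_incl, h, scalarProduct_schur_dualSchur, map_sum, LinearMap.sum_apply]
  simp only [scalarProduct_schur_dualSchur]
  rw [Finset.sum_ite_eq']
  simp only [mem_addCircle, eq_comm]

/-! ## Restriction of the dual Schur functions -/

/-- A zero entry forms inversions exactly with the nonzero entries on its right. -/
theorem inv_eq_add_card {m : ℕ} {p : Fin (m + 1)} {b' : Fin (m + 1) → ℕ} (hp : b' p = 0)
    {b : Fin m → ℕ} (hb : ∀ i, b' (p.succAbove i) = b i) :
    inv b' = inv b + #{i : Fin m | p < p.succAbove i ∧ b i ≠ 0} := by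
  have hs {n : ℕ} (f : Fin n → ℕ) :
      inv f = ∑ x, ∑ y, if x < y ∧ f x < f y then 1 else 0 := by
    rw [inv, Finset.card_filter, Fintype.sum_prod_type]
  rw [hs, hs, Fin.sum_univ_succAbove _ p, Fin.sum_univ_succAbove _ p, Finset.card_filter, add_comm]
  congr 1
  · refine Finset.sum_congr rfl fun x _ => ?_
    rw [Fin.sum_univ_succAbove _ p, hp, if_neg (by simp), zero_add]
    refine Finset.sum_congr rfl fun y _ => ?_
    simp only [hb, (Fin.strictMono_succAbove p).lt_iff_lt]
  · rw [if_neg (by simp), zero_add]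
    refine Finset.sum_congr rfl fun y _ => ?_
    simp only [hb, hp, Nat.pos_iff_ne_zero]

theorem swap_succAbove_castSucc {m : ℕ} (q i : Fin m) :
    Equiv.swap q.castSucc q.succ (q.castSucc.succAbove i) = q.succ.succAbove i := by
  simp only [Fin.succAbove, Fin.lt_def, Equiv.swap_apply_def, Fin.ext_iff, Fin.val_castSucc,
    Fin.val_succ]
  split_ifs <;> simp_all <;> omega

theorem card_castSucc_succAbove {m : ℕ} (q : Fin m) (b : Fin m → ℕ) (hq : b q ≠ 0) :
    #{i : Fin m | q.castSucc < q.castSucc.succAbove i ∧ b i ≠ 0} =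
      #{i : Fin m | q.succ < q.succ.succAbove i ∧ b i ≠ 0} + 1 := by
  have h1 (i : Fin m) : q.castSucc < q.castSucc.succAbove i ↔ q ≤ i := by
    rw [Fin.lt_succAbove_iff_le_castSucc]
    exact Fin.castSucc_le_castSucc_iff
  have h2 (i : Fin m) : q.succ < q.succ.succAbove i ↔ q < i := by
    rw [Fin.lt_succAbove_iff_le_castSucc]
    exact Fin.succ_le_castSucc_iff
  simp only [h1, h2]
  have : ({i : Fin m | q ≤ i ∧ b i ≠ 0} : Finset (Fin m)) =
      insert q ({i : Fin m | q < i ∧ b i ≠ 0} : Finset (Fin m)) := by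
    ext i
    simp only [Finset.mem_filter, Finset.mem_univ, true_and, Finset.mem_insert, le_iff_eq_or_lt]
    constructor
    · rintro ⟨rfl | h, h3⟩
      · exact .inl rfl
      · exact .inr ⟨h, h3⟩
    · rintro (rfl | ⟨h, h3⟩)
      · exact ⟨.inl rfl, hq⟩
      · exact ⟨.inr h, h3⟩
  rw [this, Finset.card_insert_of_notMem (by simp)]

theorem scalarProduct_k_dualSchur_of_antitone {m : ℕ} {L O : MPartition m} (hL : Antitone L.a)
    (hdeg : O.degree = L.degree) :
    scalarProduct m (k O) (dualSchur L) = dominantCoeff L O := by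
  classical
  rw [dualSchur_of_antitone hL, map_sum, Finset.sum_eq_single O]
  · rw [map_smul, scalarProduct_k_k, if_pos rfl, smul_eq_mul, mul_one]
  · intro M _ hM
    rw [map_smul, scalarProduct_k_k, if_neg hM.symm, smul_zero]
  · intro h
    exact absurd (mem_ofDegree.mpr hdeg) h

theorem dominantCoeff_eq {m : ℕ} (L O : MPartition m) : dominantCoeff L O =
    tt ^ inv O.a * ∑ T ∈ tableaux L O, tt ^ barCharge (barWord T ++ uWord L.a) := by
  simp only [dominantCoeff, tableauCharge, pow_add, Finset.mul_sum]

theorem antitone_of_succAbove {m : ℕ} {p : Fin (m + 1)} {a : Fin (m + 1) → ℕ}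
    (h : Antitone fun i => a (p.succAbove i)) (h1 : ∀ i, p < p.succAbove i → a (p.succAbove i) ≤ a p)
    (h2 : ∀ i, p.succAbove i < p → a p ≤ a (p.succAbove i)) : Antitone a := by
  intro x y hxy
  rcases Fin.eq_self_or_eq_succAbove p x with hx | ⟨x, rfl⟩ <;>
    rcases Fin.eq_self_or_eq_succAbove p y with hy | ⟨y, rfl⟩
  · rw [hx, hy]
  · rw [hx] at hxy ⊢
    exact h1 y (lt_of_le_of_ne hxy (Fin.succAbove_ne _ _).symm)
  · rw [hy] at hxy ⊢
    exact h2 x (lt_of_le_of_ne hxy (Fin.succAbove_ne _ _))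
  · exact h ((Fin.strictMono_succAbove p).le_iff_le.mp hxy)

theorem total_swap {m : ℕ} (L : MPartition m) {i : ℕ} (hi : i + 1 < m) :
    (L.swap i hi).total = L.total := by
  rw [MPartition.total, MPartition.total]
  congr 1
  have h := Multiset.map_univ_val_equiv (Equiv.swap (⟨i, by omega⟩ : Fin m) ⟨i + 1, hi⟩)
  conv_rhs => rw [← h, Multiset.map_map]
  rfl

/-- The case in which the inserted entry is at its sorted place: `L` itself is dominant, and the
coefficient is given by its tableaux. -/
theorem scalarProduct_k_dualSchur_insert_of_le {m : ℕ} {L' O' : MPartition m} (hL' : Antitone L'.a)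
    (p : Fin (m + 1)) (L O : MPartition (m + 1)) (hdeg : O.degree = L.degree)
    (h : ∀ c, colLen L.total c = colLen L'.total c) (hO : O.lam = O'.lam)
    (ha : ∀ i, L.a (p.succAbove i) = L'.a i) (hp : O.a p = 0)
    (hb : ∀ i, O.a (p.succAbove i) = O'.a i)
    (hlt : ∀ i, p < p.succAbove i → L.a (p.succAbove i) < L.a p)
    (hge : ∀ i, p.succAbove i < p → L.a p ≤ L.a (p.succAbove i)) :
    scalarProduct (m + 1) (k O) (dualSchur L) =
      tt ^ inv O.a * ∑ T ∈ tableaux L' O', tt ^ barCharge (barWord T ++ uWord L'.a) := by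
  have hfun : (fun i => L.a (p.succAbove i)) = L'.a := funext ha
  have hL : Antitone L.a := antitone_of_succAbove (p := p) (by rwa [hfun])
    (fun i hi => (hlt i hi).le) hge
  rw [scalarProduct_k_dualSchur_of_antitone hL hdeg, dominantCoeff_eq,
    sum_tableaux_insert h hO ha hp hb hL' hL]

/-- The coefficients of a dual Schur function whose composition is dominant up to one entry. -/
theorem scalarProduct_k_dualSchur_insert {m : ℕ} {L' O' : MPartition m} (hL' : Antitone L'.a)
    (p : Fin (m + 1)) (L O : MPartition (m + 1)) (hdeg : O.degree = L.degree)
    (h : ∀ c, colLen L.total c = colLen L'.total c) (hO : O.lam = O'.lam)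
    (ha : ∀ i, L.a (p.succAbove i) = L'.a i) (hp : O.a p = 0)
    (hb : ∀ i, O.a (p.succAbove i) = O'.a i)
    (hlt : ∀ i, p < p.succAbove i → L.a (p.succAbove i) < L.a p) :
    scalarProduct (m + 1) (k O) (dualSchur L) =
      tt ^ inv O.a * ∑ T ∈ tableaux L' O', tt ^ barCharge (barWord T ++ uWord L'.a) := by
  induction p using Fin.induction generalizing L O with
  | zero =>
    exact scalarProduct_k_dualSchur_insert_of_le hL' 0 L O hdeg h hO ha hp hb hlt
      fun i hi => absurd hi (Fin.not_lt_zero _)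
  | succ q ih =>
    have hqs : q.succ.succAbove q = q.castSucc := Fin.succAbove_succ_self q
    -- Either the inserted entry exceeds its left neighbour and is moved one place to the left, or
    -- it is already in its sorted place.
    rcases Nat.lt_or_ge (L.a q.castSucc) (L.a q.succ) with hq | hq
    · have hi : (q : ℕ) + 1 < m + 1 := by omega
      have hasc : HasAscent L.a q := ⟨hi, hq⟩
      have hsw (M : MPartition (m + 1)) (x : Fin (m + 1)) :
          (M.swap q hi).a x = M.a (Equiv.swap q.castSucc q.succ x) := rfl
      obtain ⟨i, hi', h1, h2, -, h3⟩ := dualSchur_find L hasc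
      -- The recursion takes the smallest ascent. Positions before the inserted one keep their
      -- indices in `L'`, whose composition is dominant, so there is no earlier ascent.
      obtain rfl : i = q := by
        rcases h2.eq_or_lt with h2 | h2
        · exact h2
        · exfalso
          have e1 : q.succ.succAbove ⟨i, by omega⟩ = ⟨i, by omega⟩ := by
            rw [Fin.succAbove_of_castSucc_lt _ _ (by simp [Fin.lt_def]; omega)]
            rfl
          have e2 : q.succ.succAbove ⟨i + 1, by omega⟩ = ⟨i + 1, hi'⟩ := by
            rw [Fin.succAbove_of_castSucc_lt _ _ (by simp [Fin.lt_def]; omega)]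
            rfl
          rw [← e1, ← e2, ha, ha] at h1
          exact absurd (hL' (show (⟨i, by omega⟩ : Fin m) ≤ ⟨i + 1, by omega⟩ by simp)) h1.not_ge
      have key := ih (L.swap q hi) (O.swap q hi) (by rw [degree_swap, degree_swap, hdeg])
        (fun c => by rw [total_swap, h]) hO
        (fun i => by rw [hsw, swap_succAbove_castSucc, ha])
        (by rw [hsw, Equiv.swap_apply_left, hp])
        (fun i => by rw [hsw, swap_succAbove_castSucc, hb])
        (fun i hi => by
          rw [hsw, hsw, swap_succAbove_castSucc, Equiv.swap_apply_left]
          rcases eq_or_ne i q with rfl | hne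
          · rwa [hqs]
          · refine hlt i ?_
            rw [Fin.lt_succAbove_iff_le_castSucc] at hi ⊢
            rw [Fin.castSucc_le_castSucc_iff] at hi
            rw [Fin.succ_le_castSucc_iff]
            exact lt_of_le_of_ne hi hne.symm)
      rw [h3, map_smul, ← scalarProduct_heckeT]
      have hp' : O.a ⟨q + 1, hi⟩ = 0 := hp
      have hinv := inv_eq_add_card hp hb
      have hinv' := inv_eq_add_card (p := q.castSucc) (b' := (O.swap q hi).a) (b := O'.a)
        (by rw [hsw, Equiv.swap_apply_left, hp])
        (fun i => by rw [hsw, swap_succAbove_castSucc, hb])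
      have hbq : O'.a q = O.a ⟨q, by omega⟩ := by rw [← hb, hqs]; rfl
      -- After `T_q` is moved to `k_O`, whose entry at `q + 1` is zero: if the entry at `q` is zero
      -- too, then `T_q` multiplies by `t`; if it is positive, `T_q` exchanges the two entries,
      -- which adds one inversion. In both cases the factor `t⁻¹` is compensated.
      rcases Nat.eq_zero_or_pos (O.a ⟨q, by omega⟩) with h0 | h0
      · have hOs : O.swap q hi = O :=
          MPartition.ext (swapEntries_eq_self O.a q hi (by rw [h0, hp'])) rfl
        rw [hOs] at key
        rw [heckeT_k_of_eq O hi (by rw [h0, hp']), map_smul, LinearMap.smul_apply, smul_smul,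
          inv_mul_cancel₀ tt_ne_zero, one_smul]
        exact key
      · rw [card_castSucc_succAbove q O'.a (by omega), ← add_assoc, ← hinv] at hinv'
        rw [heckeT_k_of_gt O hi (by rw [hp']; exact h0)]
        rw [hinv', pow_succ'] at key
        rw [smul_eq_mul]
        change tt⁻¹ * scalarProduct (m + 1) (k (O.swap q hi)) (dualSchur (L.swap q hi)) = _
        rw [key, ← mul_assoc, ← mul_assoc, inv_mul_cancel₀ tt_ne_zero, one_mul]
    · refine scalarProduct_k_dualSchur_insert_of_le hL' _ L O hdeg h hO ha hp hb hlt fun i hi => ?_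
      rw [ha]
      rw [← hqs, ha] at hq
      refine hq.trans (hL' ?_)
      rw [Fin.succAbove_lt_iff_castSucc_lt] at hi
      exact Fin.castSucc_lt_succ_iff.mp hi

theorem colLen_filter_ne_zero (p : Multiset ℕ) (c : ℕ) :
    colLen (p.filter (· ≠ 0)) c = colLen p c := by
  rw [colLen, colLen, Multiset.filter_filter]
  congr 1
  exact Multiset.filter_congr fun x _ => by omega

theorem colLen_total_hat {m : ℕ} (L : MPartition (m + 1)) (c : ℕ) :
    colLen L.total c = colLen L.hat.total c := by
  have h1 : L.hat.lam = (L.a (Fin.last m) ::ₘ L.lam).filter (· ≠ 0) := rfl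
  rw [colLen_total, colLen_total, h1, colLen_filter_ne_zero, ← Multiset.singleton_add, colLen_add,
    ← add_assoc]
  congr 1
  rw [Finset.card_filter, Finset.card_filter, Fin.sum_univ_castSucc, colLen]
  congr 1
  rw [Multiset.filter_singleton]
  split_ifs <;> rfl

/-- By adjunction, the coefficient of `k_M` is that of `k_(M,0)` in the larger ring. The insertion
formula applies at the last position, where the zero entry adds no inversion. -/
theorem restr_dualSchur_of_antitone {m : ℕ} {L : MPartition (m + 1)} (hL : Antitone L.hat.a) :
    restr m (dualSchur L) = dualSchur L.hat := by
  refine ext_scalarProduct fun M => ?_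
  rw [← scalarProduct_incl, incl_k]
  have hsa (i : Fin m) : (Fin.last m).succAbove i = i.castSucc := Fin.succAbove_last_apply i
  have hb (i : Fin m) : M.snocZero.a i.castSucc = M.a i :=
    Fin.snoc_castSucc (α := fun _ => ℕ) 0 M.a i
  have hz : M.snocZero.a (Fin.last m) = 0 := Fin.snoc_last (α := fun _ => ℕ) 0 M.a
  have hMdeg : M.snocZero.degree = M.degree := by
    rw [MPartition.degree, MPartition.degree, Fin.sum_univ_castSucc, hz, add_zero]
    simp only [hb]
    rfl
  by_cases hdeg : M.degree = L.degree
  · rw [scalarProduct_k_dualSchur_of_antitone hL (by rw [MPartition.degree_hat, hdeg]),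
      dominantCoeff_eq, scalarProduct_k_dualSchur_insert (O' := M) hL (Fin.last m) L M.snocZero
        (by rw [hMdeg, hdeg]) (colLen_total_hat L) rfl (fun i => by rw [hsa]; rfl) hz
        (fun i => by rw [hsa, hb]) (fun i hi => absurd hi (Fin.le_last _).not_gt)]
    congr 2
    have h := inv_eq_add_card (p := Fin.last m) hz (b := M.a) fun i => by rw [hsa, hb]
    rw [h, Finset.card_eq_zero.mpr, add_zero]
    rw [Finset.filter_eq_empty_iff]
    exact fun i _ hi => absurd hi.1 (Fin.le_last _).not_gt
  · rw [scalarProduct_k_dualSchur_of_degree_ne (by rwa [hMdeg]),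
      scalarProduct_k_dualSchur_of_degree_ne (by rwa [MPartition.degree_hat])]

/-- The restriction of a dual `m`-symmetric Schur function. -/
theorem restr_dualSchur {m : ℕ} (L : MPartition (m + 1)) :
    restr m (dualSchur L) = dualSchur L.hat := by
  induction hn : inv L.a using Nat.strong_induction_on generalizing L with
  | _ n ih =>
  by_cases hd : ∃ i, HasAscent L.hat.a i
  · obtain ⟨i, hi⟩ := hd
    obtain ⟨j, hj, h1, -, h2, h3⟩ := dualSchur_find L.hat hi
    obtain ⟨l, hl, h4, h5, h6, h7⟩ := dualSchur_find L (i := j) ⟨Nat.lt_succ_of_lt hj, h1⟩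
    -- `L` and `L.hat` agree in the first `m` entries, so an ascent of `L` before `j` would be an
    -- ascent of `L.hat`. Hence both recursions use the same operator.
    obtain rfl : l = j := by
      rcases h5.eq_or_lt with h | h
      · exact h
      · exact absurd ⟨by omega, h4⟩ (h2 l h)
    have h8 : (L.swap l hl).hat = L.hat.swap l hj := by
      have hs (x : Fin m) : Equiv.swap (⟨l, by omega⟩ : Fin (m + 1)) ⟨l + 1, hl⟩ x.castSucc =
          (Equiv.swap (⟨l, by omega⟩ : Fin m) ⟨l + 1, hj⟩ x).castSucc := by
        simp only [Equiv.swap_apply_def, Fin.ext_iff, Fin.val_castSucc]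
        split_ifs <;> rfl
      have hlast : Equiv.swap (⟨l, by omega⟩ : Fin (m + 1)) ⟨l + 1, hl⟩ (Fin.last m) =
          Fin.last m := by
        rw [Equiv.swap_apply_of_ne_of_ne] <;>
          simp only [ne_eq, Fin.ext_iff, Fin.val_last] <;> omega
      refine MPartition.ext (funext fun x => ?_) ?_
      · exact congrArg L.a (hs x)
      · change ((L.a (Equiv.swap _ _ (Fin.last m)) ::ₘ L.lam).filter (· ≠ 0)) =
          (L.a (Fin.last m) ::ₘ L.lam).filter (· ≠ 0)
        rw [hlast]
    rw [h7, map_smul, restr_heckeTAdj hj, ih _ (hn ▸ inv_swapEntries_lt L.a l hl h4) _ rfl, h8,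
      ← h3]
  · exact restr_dualSchur_of_antitone (antitone_of_not_ascent hd)

end MSymmetric

open MSymmetric
theorem mainTheorem8 :
    -- the scalar product, the adjoint Hecke operators and the Schur functions are well defined
    (∀ m : ℕ,
      (∃! B : R m →ₗ[Qqt] R m →ₗ[Qqt] Qqt, IsScalarProduct m B) ∧
      (∀ (i : ℕ) (hi : i + 1 < m), ∃! S : R m →ₗ[Qqt] R m, IsHeckeAdjoint m i hi S) ∧
      (∃! F : MPartition m → R m, IsSchurFamily m F)) ∧
    -- restriction of the dual `m`-symmetric Schur functions
    (∀ (m : ℕ) (L : MPartition (m + 1)), restr m (dualSchur L) = dualSchur L.hat) ∧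
    -- inclusion of the `m`-symmetric Schur functions
    (∀ (m : ℕ) (L : MPartition m), incl m (schur L) = ∑ O ∈ L.addCircle, schur O) := by
  exact ⟨fun m => ⟨existsUnique_isScalarProduct m, fun _ hi => existsUnique_isHeckeAdjoint hi,
    existsUnique_isSchurFamily m⟩, fun _ L => restr_dualSchur L,
    fun _ L => incl_schur_of_restr_dualSchur restr_dualSchur L⟩
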